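/- Let $S$ be a smooth complex surface. A meromorphic affine structure on $S$ is a meromorphic affine connection $\nabla$ on the tangent bundle $T_S$ (i.e. with meromorphic connection matrices $\theta$ in local coordinates) whose torsion and curvature vanish identically; its polar divisor $D$ is the reduced divisor supported on the set of poles of $\nabla$. The structure is logarithmic if, near each point of $D$, $\theta$ and $d\theta$ have at most simple poles along $D$, i.e. $f\theta$ and $f\,d\theta$ are holomorphic, where $f=0$ is a reduced local equation of $D$. Outside $D$, the $\nabla$-parallel $1$-forms are closed and locally form a two-dimensional vector space; one says that the affine structure is given by a pencil $\omega_t=\omega_0+t\,\omega_\infty$ of (possibly multivalued) $1$-forms, with $\omega_0,\omega_\infty$ linearly independent, if each local determination of $\omega_0,\omega_\infty$ is a basis of this space. Consider a logarithmic affine structure on $S$ with polar divisor $D$, and let $D_0$ be a branch (irreducible component) of $D$, i.e. the closure of a connected component of the smooth part of $D$. Suppose that the local monodromy of $\nabla$ around $D_0$ (the parallel transport along a small loop turning once around $D_0$ at a smooth point of $D$, well defined up to conjugacy) is parabolic, i.e. the Möbius transformation of $\mathbb{P}^1$ that it induces has exactly one fixed point. Then there is a closed discrete subset $E\subset D_0$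 such that, for every $p\in D_0\setminus E$, there are local holomorphic coordinates $(x,y)$ on $S$ centred at $p$ in which $D=\{y=0\}$ and the affine structure is given by one of the following models: \begin{enumerate} \item $\omega_t=dx-y^n\ln y\,dy+t\,y^n\,dy$, with $n\in\mathbb{Z}_{\ge 0}$; \item $\omega_t=-\ln y\,dx+\dfrac{dy}{y^n}+(c-x)\dfrac{dy}{y}+t\,dx$, with $n\in\mathbb{Z}_{>0}$ and $c\in\{0,1\}$. \end{enumerate} -/

import Mathlib

open scoped Manifold ContDiff Topology

noncomputable section

namespace LogAffine

/-- `ℂ²`, with coordinates `(x, y)`. -/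
abbrev C2 : Type := ℂ × ℂ

/-- Local expression of a `1`-form with values in endomorphisms of the tangent space, i.e. of a
connection matrix `θ`: `Γ q v w = θ_q(v) w`. -/
abbrev ConnForm : Type := C2 → C2 →L[ℂ] C2 →L[ℂ] C2

/-- Scalar differential `1`-forms on (an open part of) `ℂ²`. -/
abbrev OneForm : Type := C2 → C2 →L[ℂ] ℂ

/-- The constant `1`-form `dx`. -/
abbrev dx : C2 →L[ℂ] ℂ := ContinuousLinearMap.fst ℂ ℂ ℂ

/-- The constant `1`-form `dy`. -/
abbrev dy : C2 →L[ℂ] ℂ := ContinuousLinearMap.snd ℂ ℂ ℂ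

/-- `(dΓ)(v, w) = ∂_v(Γ(w)) - ∂_w(Γ(v))`, the exterior derivative of a connection matrix. -/
def extD (Γ : ConnForm) (q v w : C2) : C2 →L[ℂ] C2 :=
  fderiv ℂ Γ q v w - fderiv ℂ Γ q w v

section Surface

variable {S : Type*} [TopologicalSpace S] [ChartedSpace C2 S]

/-- Local holomorphic coordinate systems on the complex surface `S`. -/
def IsCoord (e : OpenPartialHomeomorph S C2) : Prop :=
  e ∈ IsManifold.maximalAtlas 𝓘(ℂ, C2) ω S

/-- `e = (x, y)` is a system of local coordinates centred at `p` in which `D = {y = 0}`. -/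
structure IsAdapted (D : Set S) (e : OpenPartialHomeomorph S C2) (p : S) : Prop where
  isCoord : IsCoord e
  mem : p ∈ e.source
  centred : e p = 0
  divisor : ∀ x ∈ e.source, x ∈ D ↔ (e x).2 = 0

/-- The points at which `D` is a smooth curve. -/
def regularPart (D : Set S) : Set S := {p | ∃ e, IsAdapted D e p}

/-- `D₀` is a branch (irreducible component) of the analytic curve `D`: the closure of
a connected component of the smooth part of `D`. -/
def IsBranch (D D₀ : Set S) : Prop :=
  ∃ p ∈ regularPart D, D₀ = closure (connectedComponentIn (regularPart D) p)

variable (S) in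
/-- A meromorphic affine structure on the complex surface `S`: a meromorphic affine connection
on the tangent bundle of `S` with vanishing torsion and curvature. It is given by its Christoffel
symbols (connection matrices) `christoffel e` in all systems of local coordinates `e`:
`∇_v Z = ∂_v Z + christoffel e q v Z`. The set `polar` is the set of its poles; the values
of `christoffel e` outside `e.target` or on the polar set are irrelevant. -/
structure MeromorphicAffineStructure where
  /-- The support of the polar divisor. -/
  polar : Set S
  isClosed_polar : IsClosed polar
  /-- The Christoffel symbols in local coordinates. -/
  christoffel : OpenPartialHomeomorph S C2 → ConnForm
  /-- The connection is holomorphic outside the polar set. -/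
  holomorphic : ∀ e, IsCoord e →
    DifferentiableOn ℂ (christoffel e) {q | q ∈ e.target ∧ e.symm q ∉ polar}
  /-- Rule of change of coordinates, for `φ = e' ∘ e⁻¹`. -/
  change : ∀ e e', IsCoord e → IsCoord e' →
    ∀ q ∈ e.target, e.symm q ∈ e'.source → e.symm q ∉ polar → ∀ v w : C2,
      fderiv ℂ (e' ∘ e.symm) q (christoffel e q v w) =
        fderiv ℂ (fderiv ℂ (e' ∘ e.symm)) q v w +
          christoffel e' (e' (e.symm q))
            (fderiv ℂ (e' ∘ e.symm) q v) (fderiv ℂ (e' ∘ e.symm) q w)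
  torsion_eq_zero : ∀ e, IsCoord e → ∀ q ∈ e.target, e.symm q ∉ polar → ∀ v w : C2,
    christoffel e q v w = christoffel e q w v
  /-- Flatness, `dθ + θ ∧ θ = 0`. -/
  curvature_eq_zero : ∀ e, IsCoord e → ∀ q ∈ e.target, e.symm q ∉ polar → ∀ v w : C2,
    extD (christoffel e) q v w + (christoffel e q v ∘L christoffel e q w
      - christoffel e q w ∘L christoffel e q v) = 0
  /-- The Christoffel symbols are meromorphic at the points of the polar set. -/
  meromorphic : ∀ p ∈ polar, ∀ e, IsCoord e → p ∈ e.source →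
    ∃ (g : C2 → ℂ) (G : ConnForm), AnalyticAt ℂ g (e p) ∧ AnalyticAt ℂ G (e p) ∧
      (¬ ∀ᶠ q in 𝓝 (e p), g q = 0) ∧
      ∀ᶠ q in 𝓝 (e p), e.symm q ∉ polar → g q • christoffel e q = G q
  /-- Every point of the polar set is a pole. -/
  pole : ∀ p ∈ polar, ∀ e, IsCoord e → p ∈ e.source →
    ¬ ∃ G : ConnForm, AnalyticAt ℂ G (e p) ∧
      ∀ᶠ q in 𝓝 (e p), e.symm q ∉ polar → christoffel e q = G q

namespace MeromorphicAffineStructure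

variable (A : MeromorphicAffineStructure S)

/-- The affine structure is logarithmic: near every point of the polar divisor, with
reduced local equation `f = 0`, the connection matrix `θ` and its differential `dθ` have at most
simple poles, i.e. `f θ` and `f dθ` are holomorphic. (`f` is reduced when `df ≠ 0` on a dense
part of `{f = 0}`.) -/
def IsLogarithmic : Prop :=
  ∀ p ∈ A.polar, ∃ (e : OpenPartialHomeomorph S C2) (f : C2 → ℂ) (G : ConnForm)
      (K : C2 → C2 → C2 → C2 →L[ℂ] C2),
    IsCoord e ∧ p ∈ e.source ∧
    DifferentiableOn ℂ f e.target ∧ DifferentiableOn ℂ G e.target ∧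
    (∀ v w : C2, DifferentiableOn ℂ (fun q => K q v w) e.target) ∧
    (∀ q ∈ e.target, e.symm q ∈ A.polar ↔ f q = 0) ∧
    (∀ q ∈ e.target, f q = 0 →
      q ∈ closure {q' | q' ∈ e.target ∧ f q' = 0 ∧ fderiv ℂ f q' ≠ 0}) ∧
    (∀ q ∈ e.target, f q ≠ 0 → f q • A.christoffel e q = G q) ∧
    (∀ q ∈ e.target, f q ≠ 0 → ∀ v w : C2,
      f q • extD (A.christoffel e) q v w = K q v w)

end MeromorphicAffineStructure

end Surface

/-- `w` is the parallel transport of `v` along the path `γ : [0, 1] → ℂ²`: there is a solution `Z`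
of `Z' + θ(γ') Z = 0` with `Z 0 = v` and `Z 1 = w`. -/
def IsTransport (Γ : ConnForm) (γ : ℝ → C2) (v w : C2) : Prop :=
  ∃ Z : ℝ → C2, Z 0 = v ∧ Z 1 = w ∧ ∀ s ∈ Set.Icc (0 : ℝ) 1,
    HasDerivWithinAt Z (-(Γ (γ s) (deriv γ s) (Z s))) (Set.Icc 0 1) s

/-- The loop `s ↦ (0, r e^{2π i s})`, turning once around `{y = 0}`. -/
def meridian (r : ℝ) (s : ℝ) : C2 :=
  (0, (r : ℂ) * Complex.exp (2 * (Real.pi : ℂ) * Complex.I * (s : ℂ)))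

/-- A linear automorphism of `ℂ²` is (projectively) parabolic if the Möbius transformation that it
induces on `ℙ¹` has exactly one fixed point, i.e. if it preserves exactly one line. -/
def IsParabolic (M : C2 ≃ₗ[ℂ] C2) : Prop :=
  ∃! L : Submodule ℂ C2, Module.finrank ℂ L = 1 ∧ L.map (M : C2 →ₗ[ℂ] C2) = L

section Surface

variable {S : Type*} [TopologicalSpace S] [ChartedSpace C2 S]

namespace MeromorphicAffineStructure

variable (A : MeromorphicAffineStructure S)

/-- The local monodromy around the branch `D₀` (well defined up to conjugacy: it is the parallel
transport along a small loop that turns once around `D₀`, at a smooth point of `D` on `D₀`)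
is parabolic. -/
def HasParabolicLocalMonodromy (D₀ : Set S) : Prop :=
  ∃ p ∈ D₀, ∃ e : OpenPartialHomeomorph S C2, IsAdapted A.polar e p ∧
    ∃ r : ℝ, 0 < r ∧ Metric.closedBall (0 : C2) r ⊆ e.target ∧
    ∃ M : C2 ≃ₗ[ℂ] C2, (∀ v, IsTransport (A.christoffel e) (meridian r) v (M v)) ∧ IsParabolic M

end MeromorphicAffineStructure

end Surface

/-- The `1`-form `η` is parallel at `q` for the connection induced on the cotangent bundle. -/
def IsParallelAt (Γ : ConnForm) (η : OneForm) (q : C2) : Prop :=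
  DifferentiableAt ℂ η q ∧ ∀ v w : C2, fderiv ℂ η q v w = η q (Γ q v w)

section Surface

variable {S : Type*} [TopologicalSpace S] [ChartedSpace C2 S]

/-- In the coordinates `e = (x, y)` and outside `y = 0`, the affine structure is given by the
multivalued pencil `ω_t`: here `η ℓ t` is the expression of `ω_t` when `ℓ` is a branch of `ln y`,
and, for every local branch, the forms `ω_t` are parallel, and two of them form a basis (the local
parallel `1`-forms make up a vector space of dimension two, so they are the linear
combinations of the `ω_t`). -/
def MeromorphicAffineStructure.IsGivenBy (A : MeromorphicAffineStructure S)
    (e : OpenPartialHomeomorph S C2) (η : (ℂ → ℂ) → ℂ → OneForm) : Prop :=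
  ∀ q ∈ e.target, q.2 ≠ 0 → ∀ ℓ : ℂ → ℂ, AnalyticAt ℂ ℓ q.2 →
    (∀ᶠ y in 𝓝 q.2, Complex.exp (ℓ y) = y) →
      (∀ t : ℂ, IsParallelAt (A.christoffel e) (η ℓ t) q) ∧
      LinearIndependent ℂ ![η ℓ 0 q, η ℓ 1 q]

end Surface

/-- `ω_t = dx - yⁿ ln y dy + t yⁿ dy`, for the branch `ℓ` of `ln`. -/
def modelOne (n : ℕ) (ℓ : ℂ → ℂ) (t : ℂ) : OneForm := fun q =>
  dx - (q.2 ^ n * ℓ q.2) • dy + (t * q.2 ^ n) • dy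

/-- `ω_t = -ln y dx + dy / yⁿ + (c - x) dy / y + t dx`, for the branch `ℓ` of `ln`. -/
def modelTwo (n : ℕ) (c : ℂ) (ℓ : ℂ → ℂ) (t : ℂ) : OneForm := fun q =>
  -(ℓ q.2 • dx) + (1 / q.2 ^ n) • dy + ((c - q.1) / q.2) • dy + t • dx

end LogAffine

end

set_option linter.unusedSectionVars false

/-! Near a smooth point of D take coordinates with D = {y = 0}. Holomorphy of fθ and of df∧θ = d(fθ)
- f dθ forces θ = A dx + B dy/y with A, B holomorphic (`exists_logConnection`). Pulled back by (x,
w) ↦ (x, e^w), the connection loses its pole and lives on a convex domain, so flatness provides a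
fundamental matrix F there (`exists_fundamental`). Its rows are parallel 1-forms, and F(x, w + 2πi)
= N F(x, w) defines the monodromy N.

If N is parabolic, a change of basis makes it act by ω_∞ ↦ l ω_∞, ω_0 ↦ l (ω_0 - 2πi ω_∞). A
Gronwall bound gives moderate growth, so ω_∞ = y^k ψ and ω_0 = y^j χ - ln y ω_∞ with ψ, χ
holomorphic, neither identically zero on the axis, and k - j an integer
(`IsFundamental.exists_shape`). The vanishing torsion makes both forms closed and makes the residue
B kill ∂/∂x along the axis. Comparing lowest-order terms leaves two cases
(`IsFundamental.exists_cases`): k = n, j = 0 with ψ(∂x) = 0 on the axis, or k = 0, j = -n < 0 with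
χ(∂x) = 0 on the axis.

In each case coordinates X, Y = y e^L are found by integrating closed forms. In the first
(`exists_normal_form_one`), Y is defined by Y^n dY = ω_∞ and X by dX = ω_0 + Y^n ln Y dY. In the
second (`exists_normal_form_two`), X is a multiple of a primitive of ω_∞. The closed single-valued
form ω_0 + d(ln y · X) has a primitive y^{-n+1} H up to a residue, which rescaling makes 0 or 1, and
comparing primitives gives an equation for L, solved by the implicit function theorem (by division
when n = 1).

Globally, monodromies computed at neighbouring smooth points of D are conjugate. The smooth points
of D on D₀ form a connected set, so parabolicity at one of them holds at all
(`isParabolicPoint_of_mem_branch`). The exceptional set E consists of the singular points of D lying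
on D₀. They are isolated (`eventually_mem_regularPart`): the number of distinct zeros of f(x, ·) is
constant for x ≠ 0 near 0, as Hankel determinants of power sums show, and where it is locally
constant the curve is a union of graphs (`eventually_exists_graph`). -/

noncomputable section
open Set Metric
namespace LogAffine

/-! ### Calculus of operator-valued maps. -/

section Bilinear

variable {X E F G : Type*} [NormedAddCommGroup X] [NormedSpace ℂ X] [NormedAddCommGroup E]
  [NormedSpace ℂ E] [NormedAddCommGroup F] [NormedSpace ℂ F] [NormedAddCommGroup G]
  [NormedSpace ℂ G]

lemma analyticAt_clm_apply {f : X → E →L[ℂ] F} {g : X → E} {x : X} (hf : AnalyticAt ℂ f x)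
    (hg : AnalyticAt ℂ g x) : AnalyticAt ℂ (fun x => f x (g x)) x :=
  ((ContinuousLinearMap.id ℂ (E →L[ℂ] F)).analyticAt_bilinear (f x, g x)).comp₂ hf hg

lemma analyticAt_clm_comp {f : X → F →L[ℂ] G} {g : X → E →L[ℂ] F} {x : X}
    (hf : AnalyticAt ℂ f x) (hg : AnalyticAt ℂ g x) : AnalyticAt ℂ (fun x => (f x) ∘L (g x)) x :=
  ((ContinuousLinearMap.compL ℂ E F G).analyticAt_bilinear (f x, g x)).comp₂ hf hg

lemma analyticAt_smulRight (c : E →L[ℂ] ℂ) {f : X → F} {x : X} (hf : AnalyticAt ℂ f x) :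
    AnalyticAt ℂ (fun x => c.smulRight (f x)) x :=
  ((ContinuousLinearMap.smulRightL ℂ E F c).analyticAt _).comp hf

lemma hasFDerivAt_clm_comp_apply {f : X → F →L[ℂ] G} {f' : X →L[ℂ] F →L[ℂ] G} {g : X → E →L[ℂ] F}
    {g' : X →L[ℂ] E →L[ℂ] F} {x : X} (hf : HasFDerivAt f f' x) (hg : HasFDerivAt g g' x)
    {h : X → E →L[ℂ] G} (hh : h =ᶠ[𝓝 x] fun x => f x ∘L g x) (v : X) (w : E) :
    fderiv ℂ h x v w = f' v (g x w) + f x (g' v w) := by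
  rw [((hf.clm_comp hg).congr_of_eventuallyEq hh).fderiv]
  exact add_comm _ _

end Bilinear

/-! ### Holomorphic functions of two variables: Cauchy integrals, Osgood, Riemann extension. -/

section DoubleCauchy

variable {E : Type*} [NormedAddCommGroup E] [NormedSpace ℂ E]

/-- The interval of angles. -/
abbrev Angle : Type := Icc (0:ℝ) (2 * Real.pi)

instance : MeasureTheory.MeasureSpace Angle := MeasureTheory.Measure.Subtype.measureSpace

instance : MeasureTheory.IsFiniteMeasure (MeasureTheory.volume : MeasureTheory.Measure Angle) :=
  ⟨by
    rw [show (MeasureTheory.volume : MeasureTheory.Measure Angle) =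
      MeasureTheory.Measure.comap Subtype.val MeasureTheory.volume from rfl,
      MeasureTheory.Measure.comap_apply _ Subtype.val_injective
        (fun s hs => measurableSet_Icc.subtype_image hs) _ MeasurableSet.univ]
    simp only [image_univ, Subtype.range_coe]
    exact measure_Icc_lt_top⟩

/-- Integration over the square of angles against a continuous function, as a continuous linear
functional. -/
def squareIntegral {E : Type*} [NormedAddCommGroup E] [NormedSpace ℂ E]
    (F : C(Angle × Angle, E)) : C(Angle × Angle, ℂ) →L[ℂ] E :=
  LinearMap.mkContinuous
    { toFun := fun g => ∫ p, g p • F p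
      map_add' := fun g h => by
        simp only [ContinuousMap.add_apply, add_smul]
        exact MeasureTheory.integral_add
          ((g.continuous.smul F.continuous).integrable_of_hasCompactSupport
            (HasCompactSupport.of_compactSpace _))
          ((h.continuous.smul F.continuous).integrable_of_hasCompactSupport
            (HasCompactSupport.of_compactSpace _))
      map_smul' := fun c g => by
        simp only [ContinuousMap.smul_apply, smul_assoc]
        exact MeasureTheory.integral_smul c _ }
    (‖F‖ * (MeasureTheory.volume : MeasureTheory.Measure (Angle × Angle)).real univ) (fun g => by
      have := MeasureTheory.norm_integral_le_of_norm_le_const (C := ‖g‖ * ‖F‖)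
        (μ := (MeasureTheory.volume : MeasureTheory.Measure (Angle × Angle)))
        (f := fun p => g p • F p)
        (Filter.Eventually.of_forall fun p => (norm_smul_le _ _).trans
          (mul_le_mul (g.norm_coe_le_norm p) (F.norm_coe_le_norm p) (norm_nonneg _)
            (norm_nonneg _)))
      refine this.trans (le_of_eq ?_)
      ring)

lemma circleIntegral_eq_integral_angle (f : ℂ → E) (c : ℂ) (R : ℝ) :
    (∮ z in C(c, R), f z) = ∫ θ : Angle, deriv (circleMap c R) θ • f (circleMap c R θ) := by
  rw [circleIntegral, intervalIntegral.integral_of_le Real.two_pi_pos.le,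
    ← MeasureTheory.integral_Icc_eq_integral_Ioc]
  exact (MeasureTheory.integral_subtype measurableSet_Icc
    (fun θ : ℝ => deriv (circleMap c R) θ • f (circleMap c R θ))).symm

/-- A function given on a bidisc by an iterated Cauchy integral is analytic. -/
lemma analyticOnNhd_of_doubleCauchy {f : C2 → E} {a b : ℂ} {r s : ℝ} (hr : 0 < r) (hs : 0 < s) (c : ℂ)
    (hc : ContinuousOn f (sphere a r ×ˢ sphere b s))
    (hf : ∀ x ∈ ball a r, ∀ y ∈ ball b s, f (x, y) =
      c • ∮ v in C(b, s), (v - y)⁻¹ • ∮ u in C(a, r), (u - x)⁻¹ • f (u, v)) :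
    AnalyticOnNhd ℂ f (ball a r ×ˢ ball b s) := by
  let U : C(Angle × Angle, ℂ) := ⟨fun p => circleMap a r p.1, by fun_prop⟩
  let V : C(Angle × Angle, ℂ) := ⟨fun p => circleMap b s p.2, by fun_prop⟩
  let FF : C(Angle × Angle, E) := ⟨fun p => (deriv (circleMap a r) p.1 * deriv (circleMap b s) p.2) •
      f (circleMap a r p.1, circleMap b s p.2), by
    refine Continuous.smul ?_ ?_
    · simp only [deriv_circleMap]; fun_prop
    · refine hc.comp_continuous (by fun_prop) fun p => ?_
      exact ⟨circleMap_mem_sphere _ hr.le _, circleMap_mem_sphere _ hs.le _⟩⟩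
  -- The Cauchy kernel is the inverse of `W q` in the Banach algebra of continuous functions on the
  -- square of angles. Inversion is analytic there and integration is continuous and linear, so f is
  -- a composite of analytic maps.
  let W : C2 → C(Angle × Angle, ℂ) := fun q =>
    (U - algebraMap ℂ _ q.1) * (V - algebraMap ℂ _ q.2)
  have hW : ∀ q p, W q p = (circleMap a r p.1 - q.1) * (circleMap b s p.2 - q.2) := by
    intro q p; simp [W, U, V]
  have hne : ∀ q ∈ ball a r ×ˢ ball b s, ∀ p, W q p ≠ 0 := by
    rintro q ⟨h1, h2⟩ p
    rw [hW]
    refine mul_ne_zero (sub_ne_zero.2 ?_) (sub_ne_zero.2 ?_)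
    · exact circleMap_ne_mem_ball h1 _
    · exact circleMap_ne_mem_ball h2 _
  have hunit : ∀ q ∈ ball a r ×ˢ ball b s, IsUnit (W q) := by
    intro q hq
    rw [ContinuousMap.isUnit_iff_forall_ne_zero]
    exact hne q hq
  have hWan : ∀ q, AnalyticAt ℂ W q := by
    intro q
    have h1 : AnalyticAt ℂ (fun q : C2 => algebraMap ℂ C(Angle × Angle, ℂ) q.1) q :=
      ((Algebra.linearMap ℂ C(Angle × Angle, ℂ)).toContinuousLinearMap.analyticAt _).comp
        analyticAt_fst
    have h2 : AnalyticAt ℂ (fun q : C2 => algebraMap ℂ C(Angle × Angle, ℂ) q.2) q :=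
      ((Algebra.linearMap ℂ C(Angle × Angle, ℂ)).toContinuousLinearMap.analyticAt _).comp
        analyticAt_snd
    exact (analyticAt_const.sub h1).mul (analyticAt_const.sub h2)
  have hkey : ∀ q ∈ ball a r ×ˢ ball b s,
      f q = c • squareIntegral FF (Ring.inverse (W q)) := by
    rintro ⟨x, y⟩ hq
    obtain ⟨w, hw⟩ := hunit _ hq
    have hinv : ∀ p, Ring.inverse (W (x, y)) p = (W (x, y) p)⁻¹ := by
      intro p
      rw [← hw, Ring.inverse_unit]
      have : ((w⁻¹ : (C(Angle × Angle, ℂ))ˣ) : C(Angle × Angle, ℂ)) p *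
          (w : C(Angle × Angle, ℂ)) p = 1 := by
        rw [← ContinuousMap.mul_apply, Units.inv_mul]; rfl
      exact eq_inv_of_mul_eq_one_left this
    rw [hf x hq.1 y hq.2]
    congr 1
    have hint := MeasureTheory.integral_prod_symm
      (μ := (MeasureTheory.volume : MeasureTheory.Measure Angle))
      (ν := (MeasureTheory.volume : MeasureTheory.Measure Angle))
      (fun p => Ring.inverse (W (x, y)) p • FF p)
      (((ContinuousMap.continuous _).smul FF.continuous).integrable_of_hasCompactSupport
        (HasCompactSupport.of_compactSpace _))
    refine Eq.trans ?_ hint.symm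
    rw [circleIntegral_eq_integral_angle]
    congr 1; ext1 θ
    rw [circleIntegral_eq_integral_angle, ← MeasureTheory.integral_smul,
      ← MeasureTheory.integral_smul]
    congr 1; ext1 φ
    simp only [hinv, hW, FF, ContinuousMap.coe_mk, smul_smul]
    congr 1
    rw [mul_inv]; ring
  intro q hq
  have : AnalyticAt ℂ (fun q => c • squareIntegral FF (Ring.inverse (W q))) q := by
    have h1 : AnalyticAt ℂ (fun q => Ring.inverse (W q)) q := by
      obtain ⟨w, hw⟩ := hunit _ hq
      have := analyticAt_inverse (𝕜 := ℂ) w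
      rw [hw] at this
      exact this.comp (hWan q)
    exact (((squareIntegral FF).analyticAt _).comp h1).const_smul
  refine this.congr ?_
  filter_upwards [(isOpen_ball.prod isOpen_ball).mem_nhds hq] with q' hq'
  exact (hkey q' hq').symm

lemma differentiableAt_slice_fst {f : C2 → E} {q : C2} (h : DifferentiableAt ℂ f q) :
    DifferentiableAt ℂ (fun x => f (x, q.2)) q.1 :=
  DifferentiableAt.comp (g := f) q.1 h
    (differentiableAt_id.prodMk (differentiableAt_const q.2))

lemma differentiableAt_slice_snd {f : C2 → E} {q : C2} (h : DifferentiableAt ℂ f q) :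
    DifferentiableAt ℂ (fun y => f (q.1, y)) q.2 :=
  DifferentiableAt.comp (g := f) q.2 h
    ((differentiableAt_const q.1).prodMk differentiableAt_id)

variable [CompleteSpace E]

/-- Iterating the one-variable Cauchy formula, first in y and then in x, only requires holomorphy in
x over the boundary circle of the y-disc. This asymmetry matters for extension across y = 0: the
circle avoids the axis, where nothing is known in the x-direction. -/
lemma analyticOnNhd_of_slices {f : C2 → E} {a b : ℂ} {r s : ℝ} (hr : 0 < r) (hs : 0 < s)
    (hc : ContinuousOn f (sphere a r ×ˢ sphere b s))
    (h2 : ∀ x ∈ ball a r, DiffContOnCl ℂ (fun y => f (x, y)) (ball b s))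
    (h1 : ∀ v ∈ sphere b s, DiffContOnCl ℂ (fun x => f (x, v)) (ball a r)) :
    AnalyticOnNhd ℂ f (ball a r ×ˢ ball b s) := by
  refine analyticOnNhd_of_doubleCauchy hr hs
    ((2 * Real.pi * Complex.I : ℂ)⁻¹ * (2 * Real.pi * Complex.I : ℂ)⁻¹) hc fun x hx y hy => ?_
  rw [← (h2 x hx).two_pi_i_inv_smul_circleIntegral_sub_inv_smul hy, mul_smul]
  congr 1
  rw [← circleIntegral.integral_smul]
  refine circleIntegral.integral_congr hs.le fun v hv => ?_
  rw [← (h1 v hv).two_pi_i_inv_smul_circleIntegral_sub_inv_smul hx, smul_comm]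

/-- **Osgood's lemma**: a continuous, separately holomorphic function is analytic. -/
lemma analyticOnNhd_of_continuousOn_of_separately {f : C2 → E} {U : Set C2} (hU : IsOpen U)
    (hc : ContinuousOn f U) (h1 : ∀ q ∈ U, DifferentiableAt ℂ (fun x => f (x, q.2)) q.1)
    (h2 : ∀ q ∈ U, DifferentiableAt ℂ (fun y => f (q.1, y)) q.2) : AnalyticOnNhd ℂ f U := by
  intro q hq
  obtain ⟨r, hr, hrU⟩ := Metric.nhds_basis_closedBall.mem_iff.1 (hU.mem_nhds hq)
  have hsub : closedBall q.1 r ×ˢ closedBall q.2 r ⊆ U := by rwa [closedBall_prod_same]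
  refine analyticOnNhd_of_slices (a := q.1) (b := q.2) hr hr (hc.mono ?_) ?_ ?_ q
    ⟨mem_ball_self hr, mem_ball_self hr⟩
  · exact (prod_mono sphere_subset_closedBall sphere_subset_closedBall).trans hsub
  · intro x hx
    refine DifferentiableOn.diffContOnCl fun y hy => ?_
    rw [closure_ball _ hr.ne'] at hy
    exact (h2 (x, y) (hsub ⟨ball_subset_closedBall hx, hy⟩)).differentiableWithinAt
  · intro v hv
    refine DifferentiableOn.diffContOnCl fun x hx => ?_
    rw [closure_ball _ hr.ne'] at hx
    exact (h1 (x, v) (hsub ⟨hx, sphere_subset_closedBall hv⟩)).differentiableWithinAt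

lemma analyticOnNhd_of_differentiableOn {f : C2 → E} {U : Set C2} (hU : IsOpen U)
    (hf : DifferentiableOn ℂ f U) : AnalyticOnNhd ℂ f U :=
  analyticOnNhd_of_continuousOn_of_separately hU hf.continuousOn
    (fun _ hq => differentiableAt_slice_fst (hf.differentiableAt (hU.mem_nhds hq)))
    (fun _ hq => differentiableAt_slice_snd (hf.differentiableAt (hU.mem_nhds hq)))

lemma isOpen_snd_ne_zero {U : Set C2} (hU : IsOpen U) : IsOpen {q : C2 | q ∈ U ∧ q.2 ≠ 0} :=
  hU.inter (isOpen_ne.preimage continuous_snd)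

/-- **Riemann extension** along the line `y = 0`. -/
lemma exists_analytic_extension {g : C2 → E} {U : Set C2} (hU : IsOpen U)
    (hg : DifferentiableOn ℂ g {q | q ∈ U ∧ q.2 ≠ 0})
    (hb : ∀ q ∈ U, q.2 = 0 → ∃ C : ℝ, ∀ᶠ q' in 𝓝 q, q'.2 ≠ 0 → ‖g q'‖ ≤ C) :
    ∃ G : C2 → E, AnalyticOnNhd ℂ G U ∧ ∀ q, q.2 ≠ 0 → G q = g q := by
  -- The extension is the one-variable removable-singularity value on each vertical line; joint
  -- analyticity is recovered afterwards from `analyticOnNhd_of_slices`.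
  let G : C2 → E := fun q =>
    Function.update (fun y => g (q.1, y)) 0 (Filter.limUnder (𝓝[≠] 0) (fun y => g (q.1, y))) q.2
  have hG : ∀ q, q.2 ≠ 0 → G q = g q := by
    intro q hq
    simp [G, Function.update_of_ne hq]
  have hgd : ∀ q ∈ U, q.2 ≠ 0 → DifferentiableAt ℂ g q := fun q hq h =>
    hg.differentiableAt ((isOpen_snd_ne_zero hU).mem_nhds ⟨hq, h⟩)
  refine ⟨G, fun q hq => ?_, hG⟩
  by_cases hq2 : q.2 = 0
  · obtain ⟨C, hC⟩ := hb q hq hq2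
    obtain ⟨R, hR, hRU⟩ := Metric.nhds_basis_ball.mem_iff.1 (Filter.inter_mem (hU.mem_nhds hq) hC)
    have hsub : ∀ x ∈ ball q.1 R, ∀ y ∈ ball (0 : ℂ) R, (x, y) ∈ U ∧ (y ≠ 0 → ‖g (x, y)‖ ≤ C) := by
      intro x hx y hy
      have : (x, y) ∈ ball q R := by
        rw [← Prod.mk.eta (p := q), ← ball_prod_same, hq2]; exact ⟨hx, hy⟩
      exact hRU this
    have hr : 0 < R / 2 := by positivity
    have hlt : R / 2 < R := by linarith
    have key : AnalyticOnNhd ℂ G (ball q.1 (R / 2) ×ˢ ball 0 (R / 2)) := by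
      have hs0 : ∀ v ∈ sphere (0 : ℂ) (R / 2), v ≠ 0 ∧ v ∈ ball (0 : ℂ) R := by
        intro v hv
        exact ⟨ne_of_mem_sphere hv hr.ne', sphere_subset_closedBall.trans
          (closedBall_subset_ball hlt) hv⟩
      refine analyticOnNhd_of_slices hr hr ?_ ?_ ?_
      · rintro ⟨u, v⟩ ⟨hu, hv⟩
        have hu' : u ∈ ball q.1 R := sphere_subset_closedBall.trans (closedBall_subset_ball hlt) hu
        obtain ⟨hv0, hv'⟩ := hs0 v hv
        have := (hgd (u, v) (hsub u hu' v hv').1 hv0).continuousAt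
        refine (this.congr ?_).continuousWithinAt
        filter_upwards [(isOpen_ne.preimage continuous_snd).mem_nhds
          (show (u, v) ∈ Prod.snd ⁻¹' {y : ℂ | y ≠ 0} from hv0)] with q' hq'
        exact (hG q' hq').symm
      · intro x hx
        have hx' := ball_subset_ball hlt.le hx
        have := Complex.differentiableOn_update_limUnder_of_bddAbove
          (s := ball (0 : ℂ) R) (c := 0) (f := fun y => g (x, y)) (ball_mem_nhds _ hR) ?_ ?_
        · refine DifferentiableOn.diffContOnCl ?_
          rw [closure_ball _ hr.ne']
          exact this.mono (closedBall_subset_ball hlt)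
        · rintro y ⟨hy, hy0⟩
          exact (differentiableAt_slice_snd (q := (x, y))
            (hgd (x, y) (hsub x hx' y hy).1 hy0)).differentiableWithinAt
        · refine ⟨C, ?_⟩
          rintro _ ⟨y, ⟨hy, hy0⟩, rfl⟩
          exact (hsub x hx' y hy).2 hy0
      · intro v hv
        obtain ⟨hv0, hv'⟩ := hs0 v hv
        refine DifferentiableOn.diffContOnCl fun x hx => ?_
        rw [closure_ball _ hr.ne'] at hx
        have := differentiableAt_slice_fst (q := (x, v))
            (hgd (x, v) (hsub x (closedBall_subset_ball hlt hx) v hv').1 hv0)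
        refine (this.congr_of_eventuallyEq (Filter.Eventually.of_forall fun x' => ?_))
          |>.differentiableWithinAt
        exact hG (x', v) hv0
    exact key q ⟨mem_ball_self hr, by rw [hq2]; exact mem_ball_self hr⟩
  · have h := analyticOnNhd_of_differentiableOn (isOpen_snd_ne_zero hU) hg q ⟨hq, hq2⟩
    refine h.congr ?_
    filter_upwards [(isOpen_ne.preimage continuous_snd).mem_nhds
      (show q ∈ Prod.snd ⁻¹' {y : ℂ | y ≠ 0} from hq2)] with q' hq'
    exact (hG q' hq').symm

/-- Division by `y` of a function vanishing on the line `y = 0`. -/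
lemma exists_eq_snd_smul {f : C2 → E} {U : Set C2} (hU : IsOpen U) (hf : AnalyticOnNhd ℂ f U)
    (h0 : ∀ q ∈ U, q.2 = 0 → f q = 0) :
    ∃ g : C2 → E, AnalyticOnNhd ℂ g U ∧ ∀ q ∈ U, f q = q.2 • g q := by
  suffices h : ∃ G : C2 → E, AnalyticOnNhd ℂ G U ∧ ∀ q, q.2 ≠ 0 → G q = q.2⁻¹ • f q by
    obtain ⟨G, hG, hGeq⟩ := h
    refine ⟨G, hG, fun q hq => ?_⟩
    by_cases h : q.2 = 0
    · rw [h0 q hq h, h, zero_smul]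
    · rw [hGeq q h, smul_inv_smul₀ h]
  refine exists_analytic_extension (g := fun q => q.2⁻¹ • f q) hU ?_ ?_
  · rintro q ⟨hq, hq2⟩
    exact ((differentiableAt_snd.inv hq2).smul (hf q hq).differentiableAt).differentiableWithinAt
  · intro q hq hq2
    -- Since f is Lipschitz near q and vanishes at the projection (x, 0), at distance |y|, the
    -- quotient f / y is bounded.
    obtain ⟨K, t, ht, hK⟩ := ((hf q hq).contDiffAt (n := 1)).exists_lipschitzOnWith
    refine ⟨K, ?_⟩
    have hproj : Filter.Tendsto (fun q' : C2 => ((q'.1, 0) : C2)) (𝓝 q) (𝓝 q) := by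
      have : Continuous (fun q' : C2 => ((q'.1, 0) : C2)) := by fun_prop
      have := this.tendsto q
      rwa [show ((q.1, 0) : C2) = q by rw [← hq2]] at this
    filter_upwards [ht, hproj (Filter.inter_mem ht (hU.mem_nhds hq))] with q' h1 h2 h3
    have := hK.dist_le_mul _ h1 _ h2.1
    rw [h0 _ h2.2 rfl, dist_zero_right, Prod.dist_eq] at this
    simp only [dist_self, dist_zero_right] at this
    rw [max_eq_right (norm_nonneg _)] at this
    rw [norm_smul, norm_inv]
    exact (inv_mul_le_iff₀ (norm_pos_iff.2 h3)).2 (by rwa [mul_comm])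

/-- A normally convergent series of analytic functions is analytic. -/
lemma analyticOnNhd_tsum {f : ℕ → C2 → E} {u : ℕ → ℝ} {U : Set C2} (hU : IsOpen U)
    (hf : ∀ n, AnalyticOnNhd ℂ (f n) U) (hu : Summable u) (hfu : ∀ n, ∀ q ∈ U, ‖f n q‖ ≤ u n) :
    AnalyticOnNhd ℂ (fun q => ∑' n, f n q) U := by
  refine analyticOnNhd_of_continuousOn_of_separately hU
    (continuousOn_tsum (fun n => (hf n).continuousOn) hu hfu) ?_ ?_
  · intro q hq
    have hV : IsOpen ((fun x : ℂ => ((x, q.2) : C2)) ⁻¹' U) := hU.preimage (by fun_prop)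
    refine (Complex.differentiableOn_tsum_of_summable_norm hu (F := fun n x => f n (x, q.2))
      (fun n x hx => ?_) hV (fun n x hx => hfu n _ hx)).differentiableAt (hV.mem_nhds hq)
    exact (differentiableAt_slice_fst (hf n (x, q.2) hx).differentiableAt).differentiableWithinAt
  · intro q hq
    have hV : IsOpen ((fun y : ℂ => ((q.1, y) : C2)) ⁻¹' U) := hU.preimage (by fun_prop)
    refine (Complex.differentiableOn_tsum_of_summable_norm hu (F := fun n y => f n (q.1, y))
      (fun n x hx => ?_) hV (fun n x hx => hfu n _ hx)).differentiableAt (hV.mem_nhds hq)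
    exact (differentiableAt_slice_snd (hf n (q.1, x) hx).differentiableAt).differentiableWithinAt

/-- Holomorphic dependence of path integrals on a parameter. -/
lemma differentiableAt_integral_path {X : Type*} [NormedAddCommGroup X] [NormedSpace ℂ X]
    [ProperSpace X] {Φ : X × ℂ → E} {γ c : ℝ → ℂ} (hγ : Continuous γ) (hc : Continuous c)
    {a b : ℝ} {x : X} (hΦ : ∀ t ∈ uIcc a b, AnalyticAt ℂ Φ (x, γ t)) :
    DifferentiableAt ℂ (fun z => ∫ t in a..b, c t • Φ (z, γ t)) x := by
  let W : Set (X × ℂ) := {p | AnalyticAt ℂ Φ p}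
  have hW : IsOpen W := isOpen_analyticAt ℂ Φ
  have hWan : AnalyticOnNhd ℂ Φ W := fun p hp => hp
  let K : Set ℂ := γ '' uIcc a b
  have hK : IsCompact K := isCompact_uIcc.image hγ
  have hsub : ({x} : Set X) ×ˢ K ⊆ W := by
    rintro ⟨_, _⟩ ⟨rfl, t, ht, rfl⟩
    exact hΦ t ht
  -- A compact tube around the path inside the domain of analyticity gives the uniform bound on the
  -- derivative needed for domination.
  obtain ⟨u, v, hu, -, hxu, hKv, huv⟩ := generalized_tube_lemma isCompact_singleton hK hW hsub
  obtain ⟨r, hr, hru⟩ := Metric.nhds_basis_closedBall.mem_iff.1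
    (hu.mem_nhds (singleton_subset_iff.1 hxu))
  have hin : ∀ z ∈ closedBall x r, ∀ t ∈ uIcc a b, (z, γ t) ∈ W := fun z hz t ht =>
    huv ⟨hru hz, hKv (mem_image_of_mem _ ht)⟩
  have hcomp : IsCompact (closedBall x r ×ˢ K) := (isCompact_closedBall x r).prod hK
  have hsub2 : closedBall x r ×ˢ K ⊆ W := by
    rintro ⟨z, _⟩ ⟨hz, t, ht, rfl⟩
    exact hin z hz t ht
  obtain ⟨C, hC⟩ := hcomp.exists_bound_of_continuousOn (hWan.fderiv.continuousOn.mono hsub2)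
  obtain ⟨C', hC'⟩ := (isCompact_uIcc (a := a) (b := b)).exists_bound_of_continuousOn hc.continuousOn
  have hcont : ∀ z ∈ closedBall x r, ContinuousOn (fun t => c t • Φ (z, γ t)) (uIcc a b) :=
    fun z hz => hc.continuousOn.smul
      (hWan.continuousOn.comp (by fun_prop) (fun t ht => hin z hz t ht))
  let I : X →L[ℂ] X × ℂ := ContinuousLinearMap.inl ℂ X ℂ
  refine (intervalIntegral.hasFDerivAt_integral_of_dominated_of_fderiv_le
    (F := fun z t => c t • Φ (z, γ t)) (F' := fun z t => c t • (fderiv ℂ Φ (z, γ t) ∘L I))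
    (bound := fun _ => C' * (C * ‖I‖)) (s := ball x r) (ball_mem_nhds x hr) ?_ ?_ ?_ ?_ ?_ ?_).differentiableAt
  · filter_upwards [closedBall_mem_nhds x hr] with z hz
    exact ((hcont z hz).mono uIoc_subset_uIcc).aestronglyMeasurable measurableSet_uIoc
  · exact (hcont x (mem_closedBall_self hr.le)).intervalIntegrable
  · refine ContinuousOn.aestronglyMeasurable ?_ measurableSet_uIoc
    refine ContinuousOn.mono ?_ uIoc_subset_uIcc
    refine hc.continuousOn.smul (ContinuousOn.clm_comp ?_ continuousOn_const)
    exact hWan.fderiv.continuousOn.comp (by fun_prop)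
      (fun t ht => hin x (mem_closedBall_self hr.le) t ht)
  · refine Filter.Eventually.of_forall fun t ht z hz => ?_
    have ht' := uIoc_subset_uIcc ht
    rw [norm_smul]
    refine mul_le_mul (hC' t ht') ?_ (norm_nonneg _) ((norm_nonneg _).trans (hC' t ht'))
    refine (ContinuousLinearMap.opNorm_comp_le _ _).trans ?_
    exact mul_le_mul_of_nonneg_right (hC _ ⟨ball_subset_closedBall hz, mem_image_of_mem _ ht'⟩)
      (norm_nonneg _)
  · exact intervalIntegrable_const
  · refine Filter.Eventually.of_forall fun t ht z hz => ?_
    have h := (hin z (ball_subset_closedBall hz) t (uIoc_subset_uIcc ht)).differentiableAt.hasFDerivAt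
    have h2 : HasFDerivAt (fun z : X => (z, γ t)) I z := hasFDerivAt_prodMk_left z (γ t)
    exact (HasFDerivAt.comp z h h2).const_smul (c t)

end DoubleCauchy
end LogAffine

end

/-! ### Flat connections on convex domains: Picard series and fundamental matrices. -/

noncomputable section
open Set Metric
namespace LogAffine

section Flat

variable {𝔸 : Type*} [NormedRing 𝔸] [NormedAlgebra ℂ 𝔸] [CompleteSpace 𝔸]

/-- The integral of the `1`-form `H` along the segment from `z₀` to `z`. -/
def radialPrimitive (H : C2 → C2 →L[ℂ] 𝔸) (z₀ z : C2) : 𝔸 :=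
  ∫ t in (0:ℝ)..1, H (z₀ + (t : ℂ) • (z - z₀)) (z - z₀)

lemma segment_point_mem {U : Set C2} (hc : Convex ℝ U) {z₀ z : C2} (h₀ : z₀ ∈ U) (hz : z ∈ U)
    {t : ℝ} (ht : t ∈ Icc (0:ℝ) 1) : z₀ + (t : ℂ) • (z - z₀) ∈ U := by
  rw [Complex.coe_smul]
  exact hc.add_smul_sub_mem h₀ hz ht

lemma analyticOnNhd_radialPrimitive {H : C2 → C2 →L[ℂ] 𝔸} {U : Set C2} (hU : IsOpen U)
    (hc : Convex ℝ U) {z₀ : C2} (h₀ : z₀ ∈ U) (hH : AnalyticOnNhd ℂ H U) :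
    AnalyticOnNhd ℂ (radialPrimitive H z₀) U := by
  refine analyticOnNhd_of_differentiableOn hU fun z hz => DifferentiableAt.differentiableWithinAt ?_
  have := differentiableAt_integral_path (X := C2) (E := 𝔸)
    (Φ := fun p => H (z₀ + p.2 • (p.1 - z₀)) (p.1 - z₀)) (γ := fun t : ℝ => (t : ℂ))
    (c := fun _ => 1) (a := 0) (b := 1) (x := z) Complex.continuous_ofReal continuous_const ?_
  · simp only [one_smul] at this
    exact this
  · intro t ht
    rw [uIcc_of_le zero_le_one] at ht
    have h1 : AnalyticAt ℂ (fun p : C2 × ℂ => z₀ + p.2 • (p.1 - z₀)) (z, (t : ℂ)) :=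
      analyticAt_const.add (analyticAt_snd.smul (analyticAt_fst.sub analyticAt_const))
    have h2 : AnalyticAt ℂ (fun p : C2 × ℂ => H (z₀ + p.2 • (p.1 - z₀))) (z, (t : ℂ)) :=
      AnalyticAt.comp (g := H) (hH _ (segment_point_mem hc h₀ hz ht)) h1
    have h3 : AnalyticAt ℂ (fun p : C2 × ℂ => p.1 - z₀) (z, (t : ℂ)) :=
      analyticAt_fst.sub analyticAt_const
    exact analyticAt_clm_apply h2 h3

lemma continuousOn_radial {E : Type*} [TopologicalSpace E] {H : C2 → E} {U : Set C2} 
    (hH : ContinuousOn H U) (z₀ h : C2) :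
    ContinuousOn (fun t : ℝ => H (z₀ + (t : ℂ) • h)) {t : ℝ | z₀ + (t : ℂ) • h ∈ U} :=
  hH.comp (by fun_prop) (fun _ ht => ht)

/-- On the ray through z the substitution t ↦ s t turns the primitive at parameter s into an
integral from 0 to s, and the fundamental theorem of calculus applies. Without closedness of H only
this radial derivative is controlled. -/
lemma fderiv_radialPrimitive {H : C2 → C2 →L[ℂ] 𝔸} {U : Set C2} (hU : IsOpen U)
    (hc : Convex ℝ U) {z₀ z : C2} (h₀ : z₀ ∈ U) (hH : AnalyticOnNhd ℂ H U) (hz : z ∈ U) :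
    fderiv ℂ (radialPrimitive H z₀) z (z - z₀) = H z (z - z₀) := by
  set h := z - z₀ with hh
  have hz' : z₀ + ((1:ℝ):ℂ) • h = z := by simp [hh]
  have hT := (analyticOnNhd_radialPrimitive hU hc h₀ hH z hz).differentiableAt.hasFDerivAt
  have hline : HasDerivAt (fun s : ℝ => z₀ + (s : ℂ) • h) h 1 := by
    have : HasDerivAt (fun s : ℝ => (s : ℂ) • h) ((1:ℂ) • h) 1 :=
      (Complex.ofRealCLM.hasDerivAt (x := (1:ℝ))).smul_const h
    simpa using this.const_add z₀
  have h1 : HasDerivAt (fun s : ℝ => radialPrimitive H z₀ (z₀ + (s : ℂ) • h))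
      (fderiv ℂ (radialPrimitive H z₀) z h) 1 := by
    have hT' := hT.restrictScalars ℝ
    rw [← hz'] at hT'
    have := HasFDerivAt.comp_hasDerivAt (1:ℝ) hT' hline
    rw [hz'] at this
    exact this
  have hVo : IsOpen {t : ℝ | z₀ + (t : ℂ) • h ∈ U} := hU.preimage (by fun_prop)
  have hcont : ContinuousOn (fun t : ℝ => H (z₀ + (t : ℂ) • h) h) {t : ℝ | z₀ + (t : ℂ) • h ∈ U} :=
    (continuousOn_radial hH.continuousOn z₀ h).clm_apply continuousOn_const
  have h2 : HasDerivAt (fun s : ℝ => ∫ t in (0:ℝ)..s, H (z₀ + (t : ℂ) • h) h)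
      (H (z₀ + ((1:ℝ) : ℂ) • h) h) 1 := by
    have h1V : (1:ℝ) ∈ {t : ℝ | z₀ + (t : ℂ) • h ∈ U} := by rw [mem_ofPred, hz']; exact hz
    refine intervalIntegral.integral_hasDerivAt_right ?_ ?_ ?_
    · refine (hcont.mono ?_).intervalIntegrable
      rw [uIcc_of_le zero_le_one]
      exact fun t ht => segment_point_mem hc h₀ hz ht
    · exact hcont.stronglyMeasurableAtFilter hVo _ h1V
    · exact hcont.continuousAt (hVo.mem_nhds h1V)
  have heq : (fun s : ℝ => radialPrimitive H z₀ (z₀ + (s : ℂ) • h)) =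
      fun s : ℝ => ∫ t in (0:ℝ)..s, H (z₀ + (t : ℂ) • h) h := by
    ext s
    have := intervalIntegral.smul_integral_comp_mul_left (a := 0) (b := 1)
      (fun t : ℝ => H (z₀ + (t : ℂ) • h) h) s
    rw [mul_zero, mul_one] at this
    rw [← this, radialPrimitive, ← intervalIntegral.integral_smul]
    congr 1; ext t
    rw [add_sub_cancel_left, map_smul, smul_smul, Complex.coe_smul]
    push_cast
    rw [mul_comm (t : ℂ)]
  rw [heq] at h1
  rw [h1.unique h2, hz']

/-- The terms of the Picard series of the radial equation. -/
def picardTerm (Θ : C2 → C2 →L[ℂ] 𝔸) (z₀ : C2) : ℕ → C2 → 𝔸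
  | 0 => fun _ => 1
  | n + 1 => radialPrimitive
      (fun z => (ContinuousLinearMap.mul ℂ 𝔸 (picardTerm Θ z₀ n z)) ∘L Θ z) z₀

variable {Θ : C2 → C2 →L[ℂ] 𝔸} {U : Set C2} {z₀ : C2} {K : ℝ}

lemma analyticOnNhd_mul_form {F : C2 → 𝔸} (hF : AnalyticOnNhd ℂ F U) (hΘ : AnalyticOnNhd ℂ Θ U) :
    AnalyticOnNhd ℂ (fun z => (ContinuousLinearMap.mul ℂ 𝔸 (F z)) ∘L Θ z) U := fun z hz =>
  analyticAt_clm_comp (((ContinuousLinearMap.mul ℂ 𝔸).analyticAt _).comp (hF z hz)) (hΘ z hz)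

lemma analyticOnNhd_picardTerm (hU : IsOpen U) (hc : Convex ℝ U) (h₀ : z₀ ∈ U)
    (hΘ : AnalyticOnNhd ℂ Θ U) (n : ℕ) : AnalyticOnNhd ℂ (picardTerm Θ z₀ n) U := by
  induction n with
  | zero => exact analyticOnNhd_const
  | succ n ih => exact analyticOnNhd_radialPrimitive hU hc h₀ (analyticOnNhd_mul_form ih hΘ)

/-- At the point with parameter t of the segment the inductive bound carries a factor t^n, and
integrating it produces the 1/(n+1) that builds the factorial. -/
lemma norm_picardTerm_le (hc : Convex ℝ U) (h₀ : z₀ ∈ U)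
    (hK : ∀ z ∈ U, ‖Θ z‖ ≤ K) (n : ℕ) :
    ∀ z ∈ U, ‖picardTerm Θ z₀ n z‖ ≤ ‖(1 : 𝔸)‖ * ((K * ‖z - z₀‖) ^ n / n.factorial) := by
  have hK0 : 0 ≤ K := (norm_nonneg _).trans (hK z₀ h₀)
  induction n with
  | zero => intro z _; simp [picardTerm]
  | succ n ih =>
    intro z hz
    set r := ‖z - z₀‖
    have hb : ∀ t ∈ Ioc (0:ℝ) 1, ‖((ContinuousLinearMap.mul ℂ 𝔸
        (picardTerm Θ z₀ n (z₀ + (t : ℂ) • (z - z₀)))) ∘L Θ (z₀ + (t : ℂ) • (z - z₀))) (z - z₀)‖ ≤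
        ‖(1 : 𝔸)‖ * (K * r) ^ (n + 1) / n.factorial * t ^ n := by
      intro t ht
      have htU := segment_point_mem hc h₀ hz (Ioc_subset_Icc_self ht)
      have h1 := ih _ htU
      have h2 : ‖Θ (z₀ + (t : ℂ) • (z - z₀)) (z - z₀)‖ ≤ K * r :=
        (ContinuousLinearMap.le_opNorm _ _).trans
          (mul_le_mul_of_nonneg_right (hK _ htU) (norm_nonneg _))
      simp only [ContinuousLinearMap.comp_apply, ContinuousLinearMap.mul_apply']
      refine (norm_mul_le _ _).trans ((mul_le_mul h1 h2 (norm_nonneg _) ?_).trans (le_of_eq ?_))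
      · positivity
      · rw [add_sub_cancel_left, norm_smul, Complex.norm_real, Real.norm_of_nonneg ht.1.le]
        rw [pow_succ (K * r) n]
        simp only [mul_pow]; ring
    have hint := intervalIntegral.norm_integral_le_of_norm_le (a := 0) (b := 1) zero_le_one
      (Filter.Eventually.of_forall hb) (μ := MeasureTheory.volume)
      (by apply Continuous.intervalIntegrable; fun_prop)
    refine hint.trans (le_of_eq ?_)
    rw [intervalIntegral.integral_const_mul, integral_pow, Nat.factorial_succ]
    push_cast
    have : (n.factorial : ℝ) ≠ 0 := by positivity
    field_simp
    simp

/-- The sum of the Picard series. -/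
def picardSum (Θ : C2 → C2 →L[ℂ] 𝔸) (z₀ z : C2) : 𝔸 := ∑' n, picardTerm Θ z₀ n z

lemma summable_picard_bound (r : ℝ) :
    Summable fun n : ℕ => ‖(1 : 𝔸)‖ * ((K * r) ^ n / n.factorial) :=
  (Real.summable_pow_div_factorial (K * r)).mul_left _

lemma norm_picardTerm_le_of_ball (hc : Convex ℝ U) (h₀ : z₀ ∈ U) (hK : ∀ z ∈ U, ‖Θ z‖ ≤ K)
    (R : ℝ) (n : ℕ) : ∀ z ∈ U ∩ ball z₀ R,
      ‖picardTerm Θ z₀ n z‖ ≤ ‖(1 : 𝔸)‖ * ((K * R) ^ n / n.factorial) := by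
  intro z hz
  have hK0 : 0 ≤ K := (norm_nonneg _).trans (hK z₀ h₀)
  refine (norm_picardTerm_le hc h₀ hK n z hz.1).trans ?_
  have := (mem_ball_iff_norm.1 hz.2).le
  gcongr

lemma analyticOnNhd_picardSum (hU : IsOpen U) (hc : Convex ℝ U) (h₀ : z₀ ∈ U)
    (hΘ : AnalyticOnNhd ℂ Θ U) (hK : ∀ z ∈ U, ‖Θ z‖ ≤ K) :
    AnalyticOnNhd ℂ (picardSum Θ z₀) U := by
  intro z hz
  obtain ⟨R, hR⟩ := exists_gt (dist z z₀)
  exact analyticOnNhd_tsum (hU.inter isOpen_ball)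
    (fun n => (analyticOnNhd_picardTerm hU hc h₀ hΘ n).mono inter_subset_left)
    (summable_picard_bound R) (norm_picardTerm_le_of_ball hc h₀ hK R) z ⟨hz, hR⟩

/-- Dominated convergence exchanges the series and the radial integral, so the sum is a fixed point
of the Picard operator. -/
lemma picardSum_eq (hU : IsOpen U) (hc : Convex ℝ U) (h₀ : z₀ ∈ U)
    (hΘ : AnalyticOnNhd ℂ Θ U) (hK : ∀ z ∈ U, ‖Θ z‖ ≤ K) {z : C2} (hz : z ∈ U) :
    picardSum Θ z₀ z = 1 + radialPrimitive
      (fun z => (ContinuousLinearMap.mul ℂ 𝔸 (picardSum Θ z₀ z)) ∘L Θ z) z₀ z := by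
  obtain ⟨R, hR⟩ := exists_gt (dist z z₀)
  have hK0 : 0 ≤ K := (norm_nonneg _).trans (hK z₀ h₀)
  have hb := norm_picardTerm_le_of_ball hc h₀ hK R
  have hsum : ∀ z ∈ U ∩ ball z₀ R, Summable fun n => picardTerm Θ z₀ n z := fun z hz =>
    Summable.of_norm_bounded (summable_picard_bound R) (fun n => hb n z hz)
  have hseg : ∀ t ∈ Icc (0:ℝ) 1, z₀ + (t : ℂ) • (z - z₀) ∈ U ∩ ball z₀ R := fun t ht =>
    segment_point_mem (hc.inter (convex_ball z₀ R))
      ⟨h₀, mem_ball_self (dist_nonneg.trans_lt hR)⟩ ⟨hz, hR⟩ ht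
  rw [picardSum, (hsum z ⟨hz, hR⟩).tsum_eq_zero_add]
  congr 1
  have hterm : ∀ n, picardTerm Θ z₀ (n + 1) z = ∫ t in (0:ℝ)..1,
      picardTerm Θ z₀ n (z₀ + (t : ℂ) • (z - z₀)) * Θ (z₀ + (t : ℂ) • (z - z₀)) (z - z₀) :=
    fun n => rfl
  simp only [hterm]
  have hkey := intervalIntegral.hasSum_integral_of_dominated_convergence (a := 0) (b := 1)
    (μ := MeasureTheory.volume) (ι := ℕ)
    (F := fun n t => picardTerm Θ z₀ n (z₀ + (t : ℂ) • (z - z₀)) *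
      Θ (z₀ + (t : ℂ) • (z - z₀)) (z - z₀))
    (f := fun t => picardSum Θ z₀ (z₀ + (t : ℂ) • (z - z₀)) *
      Θ (z₀ + (t : ℂ) • (z - z₀)) (z - z₀))
    (fun n _ => (‖(1 : 𝔸)‖ * ((K * R) ^ n / n.factorial)) * (K * ‖z - z₀‖)) ?_ ?_ ?_ ?_ ?_
  · exact hkey.tsum_eq
  · intro n
    refine ContinuousOn.aestronglyMeasurable ?_ measurableSet_uIoc
    have hsub : uIoc (0:ℝ) 1 ⊆ {t : ℝ | z₀ + (t : ℂ) • (z - z₀) ∈ U} := by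
      rw [uIoc_of_le zero_le_one]
      exact fun t ht => (hseg t (Ioc_subset_Icc_self ht)).1
    exact ((continuousOn_radial (analyticOnNhd_picardTerm hU hc h₀ hΘ n).continuousOn _ _).mul
      ((continuousOn_radial hΘ.continuousOn _ _).clm_apply continuousOn_const)).mono hsub
  · intro n
    refine Filter.Eventually.of_forall fun t ht => ?_
    rw [uIoc_of_le zero_le_one] at ht
    have htU := hseg t (Ioc_subset_Icc_self ht)
    refine (norm_mul_le _ _).trans (mul_le_mul (hb n _ htU) ?_ (norm_nonneg _) ?_)
    · exact (ContinuousLinearMap.le_opNorm _ _).trans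
        (mul_le_mul_of_nonneg_right (hK _ htU.1) (norm_nonneg _))
    · exact (norm_nonneg _).trans (hb n _ htU)
  · exact Filter.Eventually.of_forall fun t ht => (summable_picard_bound R).mul_right _
  · exact intervalIntegrable_const
  · refine Filter.Eventually.of_forall fun t ht => ?_
    rw [uIoc_of_le zero_le_one] at ht
    exact (hsum _ (hseg t (Ioc_subset_Icc_self ht))).hasSum.mul_right _

lemma picardSum_self : picardSum Θ z₀ z₀ = 1 := by
  rw [picardSum, tsum_eq_single 0]
  · rfl
  · intro n hn
    obtain ⟨m, rfl⟩ := Nat.exists_eq_succ_of_ne_zero hn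
    simp [picardTerm, radialPrimitive]

lemma fderiv_picardSum_radial (hU : IsOpen U) (hc : Convex ℝ U) (h₀ : z₀ ∈ U)
    (hΘ : AnalyticOnNhd ℂ Θ U) (hK : ∀ z ∈ U, ‖Θ z‖ ≤ K) {z : C2} (hz : z ∈ U) :
    fderiv ℂ (picardSum Θ z₀) z (z - z₀) = picardSum Θ z₀ z * Θ z (z - z₀) := by
  have h1 := fderiv_radialPrimitive hU hc h₀
    (analyticOnNhd_mul_form (analyticOnNhd_picardSum hU hc h₀ hΘ hK) hΘ) hz
  rw [show picardSum Θ z₀ z * Θ z (z - z₀) = ((ContinuousLinearMap.mul ℂ 𝔸 (picardSum Θ z₀ z)) ∘L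
    Θ z) (z - z₀) from rfl, ← h1]
  congr 1
  have : picardSum Θ z₀ =ᶠ[𝓝 z] fun z => 1 + radialPrimitive
      (fun z => (ContinuousLinearMap.mul ℂ 𝔸 (picardSum Θ z₀ z)) ∘L Θ z) z₀ z := by
    filter_upwards [hU.mem_nhds hz] with z' hz'
    exact picardSum_eq hU hc h₀ hΘ hK hz'
  rw [this.fderiv_eq, fderiv_const_add]

/-- `F` is a parallel section: `dF = F Θ`. -/
def IsParallel (F : C2 → 𝔸) (Θ : C2 → C2 →L[ℂ] 𝔸) (U : Set C2) : Prop :=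
  ∀ z ∈ U, HasFDerivAt F ((ContinuousLinearMap.mul ℂ 𝔸 (F z)) ∘L Θ z) z

/-- Gronwall on [0, 1]. It serves to bound parallel sections and, when f 0 = 0, to show that a
solution of a linear equation vanishes. -/
lemma norm_le_of_radial {E : Type*} [NormedAddCommGroup E] [NormedSpace ℝ E] {f f' : ℝ → E}
    {K : ℝ} (hf : ∀ s ∈ Icc (0:ℝ) 1, HasDerivAt f (f' s) s)
    (hK : ∀ s ∈ Icc (0:ℝ) 1, ‖f' s‖ ≤ K * ‖f s‖) : ‖f 1‖ ≤ ‖f 0‖ * Real.exp K := by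
  have := norm_le_gronwallBound_of_norm_deriv_right_le (f := f) (f' := f') (δ := ‖f 0‖) (K := K)
    (ε := 0) (a := 0) (b := 1) (fun s hs => (hf s hs).continuousAt.continuousWithinAt)
    (fun s hs => (hf s (Ico_subset_Icc_self hs)).hasDerivWithinAt) le_rfl
    (fun s hs => by simpa using hK s (Ico_subset_Icc_self hs)) 1 (right_mem_Icc.2 zero_le_one)
  simpa [gronwallBound_ε0] using this

lemma hasDerivAt_segment (z₀ h : C2) (s : ℝ) :
    HasDerivAt (fun s : ℝ => z₀ + (s : ℂ) • h) h s := by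
  have : HasDerivAt (fun s : ℝ => (s : ℂ) • h) ((1:ℂ) • h) s :=
    (Complex.ofRealCLM.hasDerivAt (x := s)).smul_const h
  simpa using this.const_add z₀

/-- A parallel section grows at most exponentially. -/
lemma IsParallel.norm_le {F : C2 → 𝔸} (hF : IsParallel F Θ U) (hc : Convex ℝ U)
    (hK : ∀ z ∈ U, ‖Θ z‖ ≤ K) {z₁ z : C2} (h₁ : z₁ ∈ U) (hz : z ∈ U) :
    ‖F z‖ ≤ ‖F z₁‖ * Real.exp (K * ‖z - z₁‖) := by
  have := norm_le_of_radial (f := fun s : ℝ => F (z₁ + (s : ℂ) • (z - z₁)))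
    (f' := fun s => F (z₁ + (s : ℂ) • (z - z₁)) * Θ (z₁ + (s : ℂ) • (z - z₁)) (z - z₁))
    (K := K * ‖z - z₁‖) (fun s hs => ?_) (fun s hs => ?_)
  · simpa using this
  · exact ((hF _ (segment_point_mem hc h₁ hz hs)).restrictScalars ℝ).comp_hasDerivAt s
      (hasDerivAt_segment z₁ (z - z₁) s)
  · have hs' := hK _ (segment_point_mem hc h₁ hz hs)
    refine (norm_mul_le _ _).trans ?_
    rw [mul_comm]
    exact mul_le_mul_of_nonneg_right ((ContinuousLinearMap.le_opNorm _ _).trans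
      (mul_le_mul_of_nonneg_right hs' (norm_nonneg _))) (norm_nonneg _)

lemma IsParallel.eqOn {F G : C2 → 𝔸} (hF : IsParallel F Θ U) (hG : IsParallel G Θ U)
    (hc : Convex ℝ U) (hK : ∀ z ∈ U, ‖Θ z‖ ≤ K) {z₁ : C2} (h₁ : z₁ ∈ U) (h : F z₁ = G z₁) :
    EqOn F G U := by
  intro z hz
  have hFG : IsParallel (fun z => F z - G z) Θ U := by
    intro z hz
    refine ((hF z hz).sub (hG z hz)).congr_fderiv ?_
    refine ContinuousLinearMap.ext fun v => ?_
    simp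
  have := hFG.norm_le hc hK h₁ hz
  rw [h, sub_self, norm_zero, zero_mul] at this
  exact sub_eq_zero.1 (norm_le_zero_iff.1 this)

lemma IsParallel.const_mul {F : C2 → 𝔸} (hF : IsParallel F Θ U) (P : 𝔸) :
    IsParallel (fun z => P * F z) Θ U := by
  intro z hz
  refine (((ContinuousLinearMap.mul ℂ 𝔸 P).hasFDerivAt).comp z (hF z hz)).congr_fderiv ?_
  refine ContinuousLinearMap.ext fun v => ?_
  simp [mul_assoc]

/-- The series solves dF = F Θ only along rays from z₀. Flatness implies that the defect Ω = dF - F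
Θ satisfies, on the ray of direction h, the linear equation (sΩ)' = (sΩ) Θ(h). As sΩ vanishes at s =
0, Gronwall gives Ω = 0. -/
lemma isParallel_picardSum (hU : IsOpen U) (hc : Convex ℝ U) (h₀ : z₀ ∈ U)
    (hΘ : AnalyticOnNhd ℂ Θ U) (hK : ∀ z ∈ U, ‖Θ z‖ ≤ K)
    (hflat : ∀ z ∈ U, ∀ v w, fderiv ℂ Θ z v w - fderiv ℂ Θ z w v +
      (Θ z v * Θ z w - Θ z w * Θ z v) = 0) :
    IsParallel (picardSum Θ z₀) Θ U := by
  have hK0 : 0 ≤ K := (norm_nonneg _).trans (hK z₀ h₀)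
  set F := picardSum Θ z₀ with hFdef
  have hF : AnalyticOnNhd ℂ F U := analyticOnNhd_picardSum hU hc h₀ hΘ hK
  set Ω : C2 → C2 →L[ℂ] 𝔸 := fun z => fderiv ℂ F z - (ContinuousLinearMap.mul ℂ 𝔸 (F z)) ∘L Θ z
    with hΩ
  have hrad : ∀ z ∈ U, fderiv ℂ F z (z - z₀) = F z * Θ z (z - z₀) := fun z hz =>
    fderiv_picardSum_radial hU hc h₀ hΘ hK hz
  have hdF : ∀ z ∈ U, HasFDerivAt F (fderiv ℂ F z) z := fun z hz =>
    (hF z hz).differentiableAt.hasFDerivAt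
  have hddF : ∀ z ∈ U, HasFDerivAt (fderiv ℂ F) (fderiv ℂ (fderiv ℂ F) z) z := fun z hz =>
    (hF z hz).fderiv.differentiableAt.hasFDerivAt
  have hdΘ : ∀ z ∈ U, HasFDerivAt Θ (fderiv ℂ Θ z) z := fun z hz =>
    (hΘ z hz).differentiableAt.hasFDerivAt
  have hdΩ : ∀ z ∈ U, ∀ v w, fderiv ℂ Ω z v w = fderiv ℂ (fderiv ℂ F) z v w -
      (fderiv ℂ F z v * Θ z w + F z * fderiv ℂ Θ z v w) := by
    intro z hz v w
    have h1 : HasFDerivAt Ω _ z := (hddF z hz).sub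
      (((ContinuousLinearMap.mul ℂ 𝔸).hasFDerivAt.comp z (hdF z hz)).clm_comp (hdΘ z hz))
    rw [h1.fderiv]
    simp [add_comm]
  -- The radial equation differentiated in an arbitrary direction v.
  have hderiv : ∀ z ∈ U, ∀ v, fderiv ℂ (fderiv ℂ F) z v (z - z₀) + fderiv ℂ F z v =
      fderiv ℂ F z v * Θ z (z - z₀) + F z * (fderiv ℂ Θ z v (z - z₀) + Θ z v) := by
    intro z hz v
    have hid : HasFDerivAt (fun z : C2 => z - z₀) (ContinuousLinearMap.id ℂ C2) z :=
      (hasFDerivAt_id z).sub_const z₀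
    have h1 := (hddF z hz).clm_apply hid
    have h2 := (hdF z hz).mul' ((hdΘ z hz).clm_apply hid)
    have heq : (fun z => fderiv ℂ F z (z - z₀)) =ᶠ[𝓝 z] (fun z => F z * Θ z (z - z₀)) := by
      filter_upwards [hU.mem_nhds hz] with z' hz' using hrad z' hz'
    have h3 := h1.unique (h2.congr_of_eventuallyEq heq)
    have h4 := congrArg (fun L : C2 →L[ℂ] 𝔸 => L v) h3
    simp [-map_sub] at h4
    rw [add_comm, h4]
    simp [-map_sub, mul_add, add_comm, add_left_comm]
  -- Symmetry of the second derivative of F and vanishing curvature allow v and the radial direction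
  -- to be exchanged.
  have hode : ∀ z ∈ U, ∀ v, Ω z v + fderiv ℂ Ω z (z - z₀) v = Ω z v * Θ z (z - z₀) := by
    intro z hz v
    have hsymm : fderiv ℂ (fderiv ℂ F) z v (z - z₀) = fderiv ℂ (fderiv ℂ F) z (z - z₀) v :=
      ((hF z hz).contDiffAt (n := ω)).isSymmSndFDerivAt (by simp) v (z - z₀)
    have h1 := hderiv z hz v
    have h2 := hflat z hz v (z - z₀)
    rw [hdΩ z hz]
    simp only [hΩ, sub_apply, ContinuousLinearMap.comp_apply,
      ContinuousLinearMap.mul_apply']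
    rw [← hsymm, hrad z hz]
    have h3 : fderiv ℂ (fderiv ℂ F) z v (z - z₀) = fderiv ℂ F z v * Θ z (z - z₀) +
        F z * (fderiv ℂ Θ z v (z - z₀) + Θ z v) - fderiv ℂ F z v := eq_sub_of_add_eq h1
    have h4 : fderiv ℂ Θ z v (z - z₀) = fderiv ℂ Θ z (z - z₀) v -
        (Θ z v * Θ z (z - z₀) - Θ z (z - z₀) * Θ z v) := by
      rw [← sub_eq_zero, ← h2]; abel
    rw [h3, h4]
    noncomm_ring
  have hΩan : AnalyticOnNhd ℂ Ω U := fun z hz =>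
    (hF z hz).fderiv.sub (analyticOnNhd_mul_form hF hΘ z hz)
  have hzero : ∀ z ∈ U, ∀ v, Ω z v = 0 := by
    intro z hz v
    set h := z - z₀ with hh
    have := norm_le_of_radial (f := fun s : ℝ => (s : ℂ) • Ω (z₀ + (s : ℂ) • h) v)
      (f' := fun s => ((s : ℂ) • Ω (z₀ + (s : ℂ) • h) v) * Θ (z₀ + (s : ℂ) • h) h)
      (K := K * ‖h‖) (fun s hs => ?_) (fun s hs => ?_)
    · rw [Complex.ofReal_zero, zero_smul, norm_zero, zero_mul, Complex.ofReal_one, one_smul,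
        one_smul, hh, add_sub_cancel] at this
      exact norm_le_zero_iff.1 this
    · have hsU := segment_point_mem hc h₀ hz hs
      have h1 : HasDerivAt (fun s : ℝ => Ω (z₀ + (s : ℂ) • h)) (fderiv ℂ Ω (z₀ + (s : ℂ) • h) h) s :=
        ((hΩan _ hsU).differentiableAt.hasFDerivAt.restrictScalars ℝ).comp_hasDerivAt s
          (hasDerivAt_segment z₀ h s)
      have h1v : HasDerivAt (fun s : ℝ => Ω (z₀ + (s : ℂ) • h) v)
          (fderiv ℂ Ω (z₀ + (s : ℂ) • h) h v) s :=
        ((ContinuousLinearMap.apply ℂ 𝔸 v).restrictScalars ℝ).hasFDerivAt.comp_hasDerivAt s h1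
      have h2 : HasDerivAt (fun s : ℝ => (s : ℂ) • Ω (z₀ + (s : ℂ) • h) v) _ s :=
        (Complex.ofRealCLM.hasDerivAt (x := s)).smul h1v
      refine h2.congr_deriv ?_
      have h3 := hode _ hsU v
      rw [add_sub_cancel_left, map_smul, map_smul] at h3
      simp only [← hh] at h3
      rw [smul_mul_assoc, ← mul_smul_comm, ← h3]
      simp [-map_sub, add_comm]
    · have hs' := hK _ (segment_point_mem hc h₀ hz hs)
      refine (norm_mul_le _ _).trans ?_
      rw [mul_comm]
      exact mul_le_mul_of_nonneg_right ((ContinuousLinearMap.le_opNorm _ _).trans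
        (mul_le_mul_of_nonneg_right hs' (norm_nonneg _))) (norm_nonneg _)
  intro z hz
  refine (hdF z hz).congr_fderiv ?_
  refine ContinuousLinearMap.ext fun v => ?_
  exact sub_eq_zero.1 (hzero z hz v)

/-- A flat connection on a convex domain has a fundamental matrix. -/
lemma exists_fundamental (hU : IsOpen U) (hc : Convex ℝ U) (h₀ : z₀ ∈ U)
    (hΘ : AnalyticOnNhd ℂ Θ U) (hK : ∀ z ∈ U, ‖Θ z‖ ≤ K)
    (hflat : ∀ z ∈ U, ∀ v w, fderiv ℂ Θ z v w - fderiv ℂ Θ z w v +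
      (Θ z v * Θ z w - Θ z w * Θ z v) = 0) :
    ∃ F : C2 → 𝔸, IsParallel F Θ U ∧ ∀ z ∈ U, IsUnit (F z) := by
  have hp : ∀ z₀ ∈ U, IsParallel (picardSum Θ z₀) Θ U := fun z₀ h₀ =>
    isParallel_picardSum hU hc h₀ hΘ hK hflat
  refine ⟨picardSum Θ z₀, hp z₀ h₀, fun z hz => ?_⟩
  -- By uniqueness the solution normalised at z₀ and evaluated at z is inverse to the solution
  -- normalised at z and evaluated at z₀.
  have h1 := ((hp z₀ h₀).eqOn ((hp z hz).const_mul (picardSum Θ z₀ z)) hc hK hz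
    (by rw [picardSum_self, mul_one])) h₀
  have h2 := ((hp z hz).eqOn ((hp z₀ h₀).const_mul (picardSum Θ z z₀)) hc hK h₀
    (by rw [picardSum_self, mul_one])) hz
  simp only [picardSum_self] at h1 h2
  exact ⟨⟨_, _, h1.symm, h2.symm⟩, rfl⟩

end Flat
end LogAffine

end

/-! ### The universal cover of the complement of y = 0, and descent of periodic functions. -/

noncomputable section
open Set Metric
namespace LogAffine

section Cover

/-- The universal covering `(x, w) ↦ (x, e^w)` of the complement of `y = 0`. -/
def expMap (z : C2) : C2 := (z.1, Complex.exp z.2)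

/-- The inverse image of the bidisc of radius `ρ` under `expMap`. -/
def cover (ρ : ℝ) : Set C2 := {z | z.1 ∈ ball (0 : ℂ) ρ ∧ z.2.re < Real.log ρ}

/-- The generator of the deck group of `expMap`. -/
def deck (z : C2) : C2 := z + (0, 2 * Real.pi * Complex.I)

variable {ρ : ℝ}

lemma isOpen_cover : IsOpen (cover ρ) :=
  (isOpen_ball.preimage continuous_fst).inter
    (isOpen_lt (Complex.continuous_re.comp continuous_snd) continuous_const)

/-- Convexity allows the Picard construction on the cover, where the multivalued parallel forms
become single-valued. -/
lemma convex_cover : Convex ℝ (cover ρ) := by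
  have h : cover ρ = ball (0 : ℂ) ρ ×ˢ {w : ℂ | w.re < Real.log ρ} := rfl
  rw [h]
  exact (convex_ball _ _).prod (convex_halfSpace_re_lt _)

lemma expMap_mem_ball_iff (hρ : 0 < ρ) {z : C2} : expMap z ∈ ball (0 : C2) ρ ↔ z ∈ cover ρ := by
  rw [← Prod.mk_zero_zero, ← ball_prod_same]
  simp only [expMap, mem_prod, cover, mem_ofPred_eq, mem_ball_zero_iff, Complex.norm_exp,
    Real.lt_log_iff_exp_lt hρ]

lemma expMap_mem_ball (hρ : 0 < ρ) {z : C2} (hz : z ∈ cover ρ) : expMap z ∈ ball (0 : C2) ρ :=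
  (expMap_mem_ball_iff hρ).2 hz

lemma expMap_snd_ne_zero (z : C2) : (expMap z).2 ≠ 0 := Complex.exp_ne_zero _

lemma expMap_deck (z : C2) : expMap (deck z) = expMap z := by
  simp [expMap, deck, Complex.exp_add]

lemma deck_mem_cover {z : C2} (hz : z ∈ cover ρ) : deck z ∈ cover ρ := by
  simpa [cover, deck] using hz

lemma analyticAt_expMap (z : C2) : AnalyticAt ℂ expMap z :=
  analyticAt_fst.prod analyticAt_snd.cexp

/-- The derivative of `expMap`. -/
def expMapDeriv (z : C2) : C2 →L[ℂ] C2 :=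
  (ContinuousLinearMap.fst ℂ ℂ ℂ).prod (Complex.exp z.2 • ContinuousLinearMap.snd ℂ ℂ ℂ)

lemma hasFDerivAt_expMap (z : C2) : HasFDerivAt expMap (expMapDeriv z) z :=
  hasFDerivAt_fst.prodMk (hasFDerivAt_snd.cexp)

lemma expMap_log {q : C2} (hq : q.2 ≠ 0) : expMap (q.1, Complex.log q.2) = q := by
  simp [expMap, Complex.exp_log hq]

lemma log_mem_cover (hρ : 0 < ρ) {q : C2} (hq : q.2 ≠ 0) (hqρ : q ∈ ball (0 : C2) ρ) :
    (q.1, Complex.log q.2) ∈ cover ρ := by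
  rw [← expMap_mem_ball_iff hρ, expMap_log hq]; exact hqρ

variable {E : Type*} [NormedAddCommGroup E] [NormedSpace ℂ E]

lemma periodic_eq_of_exp_eq {f : C2 → E} (hf : ∀ z ∈ cover ρ, f (deck z) = f z) {x w w' : ℂ}
    (hz : (x, w) ∈ cover ρ) (h : Complex.exp w = Complex.exp w') : f (x, w') = f (x, w) := by
  have hN : ∀ (n : ℕ) (z : C2), z ∈ cover ρ →
      f (z.1, z.2 + n * (2 * Real.pi * Complex.I)) = f z := by
    intro n
    induction n with
    | zero => intro z _; simp
    | succ n ih =>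
      intro z hz
      rw [← ih z hz]
      refine Eq.trans ?_ (hf (z.1, z.2 + n * (2 * Real.pi * Complex.I)) (by simpa [cover] using hz))
      congr 1
      ext
      · simp [deck]
      · simp [deck]; ring
  obtain ⟨n, hn⟩ := Complex.exp_eq_exp_iff_exists_int.1 h
  obtain ⟨m, rfl | rfl⟩ := n.eq_nat_or_neg
  · have hw' : (x, w') ∈ cover ρ := by
      rw [hn] at hz
      simpa [cover] using hz
    rw [← hN m (x, w') hw']
    simp [hn]
  · rw [← hN m (x, w) hz]
    congr 1
    ext
    · rfl
    · simp [hn]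

/-- A periodic function on the cover descends to the complement of `y = 0`. -/
lemma exists_descent (hρ : 0 < ρ) {f : C2 → E} (hf : AnalyticOnNhd ℂ f (cover ρ))
    (hp : ∀ z ∈ cover ρ, f (deck z) = f z) :
    ∃ g : C2 → E, DifferentiableOn ℂ g {q | q ∈ ball (0 : C2) ρ ∧ q.2 ≠ 0} ∧
      ∀ z ∈ cover ρ, f z = g (expMap z) := by
  let g : C2 → E := fun q => f (q.1, Complex.log q.2)
  have hg : ∀ z ∈ cover ρ, f z = g (expMap z) := by
    rintro ⟨x, w⟩ hz
    exact (periodic_eq_of_exp_eq hp hz (w' := Complex.log (Complex.exp w))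
      (by rw [Complex.exp_log (Complex.exp_ne_zero w)])).symm
  refine ⟨g, ?_, hg⟩
  rintro q ⟨hq, hq2⟩
  refine DifferentiableAt.differentiableWithinAt ?_
  -- By periodicity g may be computed with any local branch of ln y: the principal one on the slit
  -- plane, log(-y) + πi on the negative axis.
  have key : ∀ l : C2 → ℂ, DifferentiableAt ℂ l q → (∀ᶠ q' in 𝓝 q, Complex.exp (l q') = q'.2) →
      DifferentiableAt ℂ g q := by
    intro l hl hexp
    have hmem : ∀ᶠ q' in 𝓝 q, (q'.1, l q') ∈ cover ρ ∧ Complex.exp (l q') = q'.2 := by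
      filter_upwards [hexp, isOpen_ball.mem_nhds hq] with q' h1 h2
      refine ⟨?_, h1⟩
      rw [← expMap_mem_ball_iff hρ, expMap, h1]; exact h2
    have hd : DifferentiableAt ℂ (fun q' => f (q'.1, l q')) q :=
      (hf _ hmem.self_of_nhds.1).differentiableAt.comp q (differentiableAt_fst.prodMk hl)
    refine hd.congr_of_eventuallyEq ?_
    filter_upwards [hmem] with q' hq'
    rw [hg _ hq'.1, expMap, hq'.2]
  by_cases hs : q.2 ∈ Complex.slitPlane
  · refine key (fun q' => Complex.log q'.2) (differentiableAt_snd.clog hs) ?_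
    filter_upwards [(isOpen_snd_ne_zero isOpen_univ).mem_nhds ⟨mem_univ q, hq2⟩] with q' hq'
    exact Complex.exp_log hq'.2
  · have hs' : -q.2 ∈ Complex.slitPlane := by
      rw [Complex.mem_slitPlane_iff] at hs ⊢
      push Not at hs
      left
      have h0 : q.2.re ≠ 0 := fun h => hq2 (Complex.ext h hs.2)
      rw [Complex.neg_re]
      have := lt_of_le_of_ne hs.1 h0
      linarith
    refine key (fun q' => Complex.log (-q'.2) + Real.pi * Complex.I)
      ((differentiableAt_snd.neg.clog hs').add_const _) ?_
    filter_upwards [(isOpen_snd_ne_zero isOpen_univ).mem_nhds ⟨mem_univ q, hq2⟩] with q' hq'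
    rw [Complex.exp_add, Complex.exp_log (neg_ne_zero.2 hq'.2), Complex.exp_pi_mul_I]
    ring

/-- Moderate growth along `y = 0`, in sectors. -/
def ModerateGrowth (ρ : ℝ) (f : C2 → E) : Prop :=
  ∃ (C : ℝ) (M : ℕ), ∀ z ∈ cover ρ, |z.2.im| ≤ Real.pi → ‖f z‖ ≤ C * Real.exp (-(M * z.2.re))

/-- Re w is bounded above on the cover, so |Re w| and -Re w differ by a bounded amount as far as
upper bounds are concerned. This symmetric form is the one stable under sums and products. -/
lemma moderateGrowth_of_le {f : C2 → E} {C M : ℝ}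
    (h : ∀ z ∈ cover ρ, |z.2.im| ≤ Real.pi → ‖f z‖ ≤ C * Real.exp (M * |z.2.re|)) :
    ModerateGrowth ρ f := by
  obtain ⟨n, hn⟩ := exists_nat_ge M
  refine ⟨|C| * Real.exp (n * (2 * |Real.log ρ|)), n, fun z hz hz2 => ?_⟩
  refine (h z hz hz2).trans ?_
  rw [mul_assoc, ← Real.exp_add]
  refine mul_le_mul (le_abs_self C) (Real.exp_le_exp.2 ?_) (Real.exp_pos _).le (abs_nonneg _)
  have h1 : |z.2.re| ≤ -z.2.re + 2 * |Real.log ρ| := by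
    have h2 := hz.2
    have h3 := le_abs_self (Real.log ρ)
    rcases abs_cases z.2.re with h | h <;> linarith [abs_nonneg (Real.log ρ)]
  calc M * |z.2.re| ≤ n * |z.2.re| := mul_le_mul_of_nonneg_right hn (abs_nonneg _)
    _ ≤ n * (-z.2.re + 2 * |Real.log ρ|) := mul_le_mul_of_nonneg_left h1 (Nat.cast_nonneg _)
    _ = n * (2 * |Real.log ρ|) + -(n * z.2.re) := by ring

lemma ModerateGrowth.exists_abs {f : C2 → E} (hf : ModerateGrowth ρ f) :
    ∃ C M : ℝ, 0 ≤ C ∧ 0 ≤ M ∧ ∀ z ∈ cover ρ, |z.2.im| ≤ Real.pi →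
      ‖f z‖ ≤ C * Real.exp (M * |z.2.re|) := by
  obtain ⟨C, M, h⟩ := hf
  refine ⟨|C|, M, abs_nonneg _, Nat.cast_nonneg _, fun z hz hz2 => (h z hz hz2).trans ?_⟩
  refine mul_le_mul (le_abs_self C) (Real.exp_le_exp.2 ?_) (Real.exp_pos _).le (abs_nonneg _)
  rw [← mul_neg]
  exact mul_le_mul_of_nonneg_left (neg_le_abs _) (Nat.cast_nonneg _)

lemma ModerateGrowth.add {f g : C2 → E} (hf : ModerateGrowth ρ f) (hg : ModerateGrowth ρ g) :
    ModerateGrowth ρ (fun z => f z + g z) := by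
  obtain ⟨C, M, hC, hM, h⟩ := hf.exists_abs
  obtain ⟨C', M', hC', hM', h'⟩ := hg.exists_abs
  refine moderateGrowth_of_le (C := C + C') (M := M + M') fun z hz hz2 => ?_
  refine (norm_add_le _ _).trans ?_
  have h1 := h z hz hz2
  have h2 := h' z hz hz2
  have e1 : Real.exp (M * |z.2.re|) ≤ Real.exp ((M + M') * |z.2.re|) := by
    gcongr; linarith
  have e2 : Real.exp (M' * |z.2.re|) ≤ Real.exp ((M + M') * |z.2.re|) := by
    gcongr; linarith
  rw [add_mul]
  exact add_le_add (h1.trans (mul_le_mul_of_nonneg_left e1 hC))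
    (h2.trans (mul_le_mul_of_nonneg_left e2 hC'))

lemma ModerateGrowth.smul {c : C2 → ℂ} {f : C2 → E} (hc : ModerateGrowth ρ c)
    (hf : ModerateGrowth ρ f) : ModerateGrowth ρ (fun z => c z • f z) := by
  obtain ⟨C, M, hC, hM, h⟩ := hc.exists_abs
  obtain ⟨C', M', hC', hM', h'⟩ := hf.exists_abs
  refine moderateGrowth_of_le (C := C * C') (M := M + M') fun z hz hz2 => ?_
  rw [norm_smul]
  refine (mul_le_mul (h z hz hz2) (h' z hz hz2) (norm_nonneg _) (by positivity)).trans
    (le_of_eq ?_)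
  rw [add_mul, Real.exp_add]; ring

lemma moderateGrowth_snd : ModerateGrowth ρ (fun z : C2 => z.2) := by
  refine moderateGrowth_of_le (C := Real.exp Real.pi) (M := 1) fun z _ hz2 => ?_
  rw [one_mul, ← Real.exp_add]
  have := Real.add_one_le_exp (Real.pi + |z.2.re|)
  have := Complex.norm_le_abs_re_add_abs_im z.2
  linarith

lemma moderateGrowth_exp (μ : ℂ) : ModerateGrowth ρ (fun z : C2 => Complex.exp (μ * z.2)) := by
  refine moderateGrowth_of_le (C := Real.exp (|μ.im| * Real.pi)) (M := |μ.re|) fun z _ hz2 => ?_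
  rw [Complex.norm_exp, ← Real.exp_add, Complex.mul_re]
  refine Real.exp_le_exp.2 ?_
  have h1 : μ.re * z.2.re ≤ |μ.re| * |z.2.re| := (le_abs_self _).trans (abs_mul _ _).le
  have h2 : -(μ.im * z.2.im) ≤ |μ.im| * |z.2.im| := (neg_le_abs _).trans (abs_mul _ _).le
  have h3 : |μ.im| * |z.2.im| ≤ |μ.im| * Real.pi := mul_le_mul_of_nonneg_left hz2 (abs_nonneg _)
  linarith

lemma ModerateGrowth.clm {F : Type*} [NormedAddCommGroup F] [NormedSpace ℂ F] {f : C2 → E}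
    (hf : ModerateGrowth ρ f) (L : E →L[ℂ] F) : ModerateGrowth ρ (fun z => L (f z)) := by
  obtain ⟨C, M, h⟩ := hf
  refine ⟨‖L‖ * C, M, fun z hz hz2 => (L.le_opNorm _).trans ?_⟩
  rw [mul_assoc]
  exact mul_le_mul_of_nonneg_left (h z hz hz2) (norm_nonneg _)

/-- Gronwall bounds are exponential in the distance on the cover; in the strip |Im w| ≤ π this
becomes a power of 1/|y|. -/
lemma moderateGrowth_of_exp_norm_sub {f : C2 → E} {C K : ℝ} {z₁ : C2} (hC : 0 ≤ C) (hK : 0 ≤ K)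
    (h : ∀ z ∈ cover ρ, ‖f z‖ ≤ C * Real.exp (K * ‖z - z₁‖)) : ModerateGrowth ρ f := by
  refine moderateGrowth_of_le (C := C * Real.exp (K * (|ρ| + Real.pi + ‖z₁‖))) (M := K)
    fun z hz hz2 => (h z hz).trans ?_
  rw [mul_assoc, ← Real.exp_add, ← mul_add]
  refine mul_le_mul_of_nonneg_left (Real.exp_le_exp.2 (mul_le_mul_of_nonneg_left ?_ hK)) hC
  have h1 := Complex.norm_le_abs_re_add_abs_im z.2
  have h2 : ‖z.1‖ < ρ := mem_ball_zero_iff.1 hz.1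
  have h3 := norm_sub_le z z₁
  have h4 : ‖z‖ ≤ |ρ| + Real.pi + |z.2.re| := by
    rw [Prod.norm_def]
    refine max_le ?_ ?_
    · linarith [le_abs_self ρ, Real.pi_pos, abs_nonneg z.2.re]
    · linarith [abs_nonneg ρ]
  linarith

variable [CompleteSpace E]

/-- Extracts the largest power of y. If the process never stopped, ψ would vanish to infinite order
in y at the axis on every vertical line, hence vanish identically on the ball. -/
lemma exists_order_factor (hρ : 0 < ρ) {ψ : C2 → E} (hψ : AnalyticOnNhd ℂ ψ (ball 0 ρ))
    (h0 : ∃ q ∈ ball (0 : C2) ρ, ψ q ≠ 0) :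
    ∃ (n : ℕ) (χ : C2 → E), AnalyticOnNhd ℂ χ (ball 0 ρ) ∧
      (∀ q ∈ ball (0 : C2) ρ, ψ q = q.2 ^ n • χ q) ∧ ∃ x ∈ ball (0 : ℂ) ρ, χ (x, 0) ≠ 0 := by
  by_contra hcon
  push Not at hcon
  have hall : ∀ n : ℕ, ∃ χ : C2 → E, AnalyticOnNhd ℂ χ (ball 0 ρ) ∧
      (∀ q ∈ ball (0 : C2) ρ, ψ q = q.2 ^ n • χ q) := by
    intro n
    induction n with
    | zero => exact ⟨ψ, hψ, by simp⟩
    | succ n ih =>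
      obtain ⟨χ, hχ, hχeq⟩ := ih
      have hz := hcon n χ hχ hχeq
      obtain ⟨g, hg, hgeq⟩ := exists_eq_snd_smul isOpen_ball hχ (fun q hq hq2 => by
        rw [← Prod.mk_zero_zero, ← ball_prod_same] at hq
        have := hz q.1 hq.1
        rwa [← hq2] at this)
      refine ⟨g, hg, fun q hq => ?_⟩
      rw [hχeq q hq, hgeq q hq, smul_smul, pow_succ]
  obtain ⟨q, hq, hne⟩ := h0
  have hmem : ∀ y ∈ ball (0 : ℂ) ρ, (q.1, y) ∈ ball (0 : C2) ρ := fun y hy => by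
    rw [← Prod.mk_zero_zero, ← ball_prod_same] at hq ⊢
    exact ⟨hq.1, hy⟩
  have hs : AnalyticOnNhd ℂ (fun y => ψ (q.1, y)) (ball 0 ρ) := by
    refine DifferentiableOn.analyticOnNhd (fun y hy => ?_) isOpen_ball
    exact (differentiableAt_slice_snd (q := (q.1, y))
      (hψ _ (hmem y hy)).differentiableAt).differentiableWithinAt
  have htop : analyticOrderAt (fun y => ψ (q.1, y)) 0 = ⊤ := by
    refine ENat.eq_top_iff_forall_ge.2 fun n => ?_
    rw [natCast_le_analyticOrderAt (hs 0 (mem_ball_self hρ))]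
    obtain ⟨χ, hχ, hχeq⟩ := hall n
    refine ⟨fun y => χ (q.1, y), ?_, ?_⟩
    · refine DifferentiableOn.analyticAt (s := ball 0 ρ) (fun y hy => ?_) (ball_mem_nhds 0 hρ)
      exact (differentiableAt_slice_snd (q := (q.1, y))
        (hχ _ (hmem y hy)).differentiableAt).differentiableWithinAt
    · filter_upwards [ball_mem_nhds (0 : ℂ) hρ] with y hy
      rw [sub_zero, hχeq _ (hmem y hy)]
  rw [analyticOrderAt_eq_top] at htop
  have hq2 : q.2 ∈ ball (0 : ℂ) ρ := by
    rw [← Prod.mk_zero_zero, ← ball_prod_same] at hq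
    exact hq.2
  exact hne (hs.eqOn_zero_of_preconnected_of_eventuallyEq_zero
    (convex_ball (0 : ℂ) ρ).isPreconnected (mem_ball_self hρ) htop hq2)

/-- A periodic function of moderate growth on the cover is meromorphic along `y = 0`. -/
lemma exists_meromorphic_descent (hρ : 0 < ρ) {f : C2 → E} (hf : AnalyticOnNhd ℂ f (cover ρ))
    (hp : ∀ z ∈ cover ρ, f (deck z) = f z) (hg : ModerateGrowth ρ f)
    (h0 : ∃ z ∈ cover ρ, f z ≠ 0) :
    ∃ (m : ℤ) (ψ : C2 → E), AnalyticOnNhd ℂ ψ (ball 0 ρ) ∧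
      (∀ z ∈ cover ρ, f z = Complex.exp (m * z.2) • ψ (expMap z)) ∧
      ∃ x ∈ ball (0 : ℂ) ρ, ψ (x, 0) ≠ 0 := by
  obtain ⟨g, hgd, hgf⟩ := exists_descent hρ hf hp
  obtain ⟨C, M, hb⟩ := hg
  -- The strip |Im w| ≤ π contains the principal logarithm of every y, so moderate growth makes y^M
  -- g bounded near the axis.
  obtain ⟨ψ, hψ, hψeq⟩ := exists_analytic_extension (g := fun q => q.2 ^ M • g q)
    (U := ball (0 : C2) ρ) isOpen_ball (fun q hq => by
      exact ((differentiableAt_snd.pow M).differentiableWithinAt).smul (hgd q hq))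
    (fun q hq _ => by
      refine ⟨C, ?_⟩
      filter_upwards [isOpen_ball.mem_nhds hq] with q' hq' hne
      have hz := log_mem_cover hρ hne hq'
      have h1 := hb _ hz (by rw [Complex.log_im]; exact Complex.abs_arg_le_pi _)
      rw [hgf _ hz, expMap_log hne, Complex.log_re] at h1
      rw [norm_smul, norm_pow]
      have hpos : 0 < ‖q'.2‖ := norm_pos_iff.2 hne
      calc ‖q'.2‖ ^ M * ‖g q'‖ ≤ ‖q'.2‖ ^ M * (C * Real.exp (-(M * Real.log ‖q'.2‖))) := by gcongr
        _ = C := by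
          rw [Real.exp_neg, Real.exp_nat_mul, Real.exp_log hpos]
          field_simp)
  have hfψ : ∀ z ∈ cover ρ, f z = Complex.exp (-(M * z.2)) • ψ (expMap z) := by
    intro z hz
    rw [hψeq _ (expMap_snd_ne_zero z), ← hgf z hz, smul_smul, Complex.exp_neg, expMap,
      ← Complex.exp_nat_mul, inv_mul_cancel₀ (Complex.exp_ne_zero _), one_smul]
  obtain ⟨n, χ, hχ, hχeq, hχ0⟩ := exists_order_factor hρ hψ (by
    obtain ⟨z, hz, hne⟩ := h0
    refine ⟨expMap z, expMap_mem_ball hρ hz, fun h => hne ?_⟩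
    rw [hfψ z hz, h, smul_zero])
  refine ⟨(n : ℤ) - M, χ, hχ, fun z hz => ?_, hχ0⟩
  rw [hfψ z hz, hχeq _ (expMap_mem_ball hρ hz), smul_smul, expMap]
  congr 1
  rw [← Complex.exp_nat_mul, ← Complex.exp_add]
  congr 1
  push_cast; ring

end Cover
end LogAffine

end

/-! ### Connections with a simple pole along y = 0 and their fundamental matrices. -/

noncomputable section
open Set Metric
namespace LogAffine

/-- Endomorphisms of `ℂ²`. -/
abbrev End2 : Type := C2 →L[ℂ] C2

/-- A flat torsion-free connection on an open subset of `ℂ²` with a simple pole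
`A dx + B dy / y` along `y = 0`. -/
structure LogConnection (Γ : ConnForm) (U : Set C2) (A B : C2 → End2) : Prop where
  analytic_A : AnalyticOnNhd ℂ A U
  analytic_B : AnalyticOnNhd ℂ B U
  eq : ∀ q ∈ U, q.2 ≠ 0 → ∀ v, Γ q v = v.1 • A q + (v.2 / q.2) • B q
  torsion : ∀ q ∈ U, q.2 ≠ 0 → ∀ v w, Γ q v w = Γ q w v
  curvature : ∀ q ∈ U, q.2 ≠ 0 → ∀ v w,
    extD Γ q v w + (Γ q v ∘L Γ q w - Γ q w ∘L Γ q v) = 0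

lemma LogConnection.mono {Γ : ConnForm} {U V : Set C2} {A B : C2 → End2}
    (h : LogConnection Γ U A B) (hV : V ⊆ U) : LogConnection Γ V A B where
  analytic_A := h.analytic_A.mono hV
  analytic_B := h.analytic_B.mono hV
  eq q hq := h.eq q (hV hq)
  torsion q hq := h.torsion q (hV hq)
  curvature q hq := h.curvature q (hV hq)

/-- The pullback of `A dx + B dy / y` to the cover. -/
def coverForm (A B : C2 → End2) (z : C2) : C2 →L[ℂ] End2 :=
  (ContinuousLinearMap.fst ℂ ℂ ℂ).smulRight (A (expMap z)) +
    (ContinuousLinearMap.snd ℂ ℂ ℂ).smulRight (B (expMap z))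

lemma coverForm_apply (A B : C2 → End2) (z v : C2) :
    coverForm A B z v = v.1 • A (expMap z) + v.2 • B (expMap z) := rfl

lemma coverForm_deck (A B : C2 → End2) (z : C2) : coverForm A B (deck z) = coverForm A B z := by
  rw [coverForm, coverForm, expMap_deck]

/-- Two functions continuous near the origin line which agree off `y = 0` agree. -/
lemma eqOn_of_eqOn_snd_ne_zero {E : Type*} [TopologicalSpace E] [T2Space E] {f g : C2 → E}
    {U : Set C2} (hU : IsOpen U) (hf : ContinuousOn f U) (hg : ContinuousOn g U)
    (h : ∀ q ∈ U, q.2 ≠ 0 → f q = g q) : EqOn f g U := by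
  intro q hq
  by_cases hq2 : q.2 = 0
  · have hline : Filter.Tendsto (fun y : ℂ => ((q.1, y) : C2)) (𝓝[≠] 0) (𝓝 q) := by
      have h1 : Continuous (fun y : ℂ => ((q.1, y) : C2)) := by fun_prop
      have h2 := h1.tendsto 0
      rw [show ((q.1, (0 : ℂ)) : C2) = q by rw [← hq2]] at h2
      exact h2.mono_left nhdsWithin_le_nhds
    refine tendsto_nhds_unique_of_eventuallyEq
      ((hf.continuousAt (hU.mem_nhds hq)).tendsto.comp hline)
      ((hg.continuousAt (hU.mem_nhds hq)).tendsto.comp hline) ?_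
    filter_upwards [hline (hU.mem_nhds hq), self_mem_nhdsWithin] with y hy hy0
    exact h _ hy hy0
  · exact h q hq hq2

section Local

variable {Γ : ConnForm} {U : Set C2} {A B : C2 → End2} {ρ : ℝ}

lemma LogConnection.analyticAt (h : LogConnection Γ U A B) (hU : IsOpen U) {q : C2} (hq : q ∈ U)
    (hq2 : q.2 ≠ 0) : AnalyticAt ℂ Γ q := by
  have hA := h.analytic_A q hq
  have hB := h.analytic_B q hq
  have h1 : AnalyticAt ℂ (fun q : C2 => (ContinuousLinearMap.fst ℂ ℂ ℂ).smulRight (A q) +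
      q.2⁻¹ • (ContinuousLinearMap.snd ℂ ℂ ℂ).smulRight (B q)) q := by
    have e1 := analyticAt_smulRight (ContinuousLinearMap.fst ℂ ℂ ℂ) hA
    have e2 := analyticAt_smulRight (ContinuousLinearMap.snd ℂ ℂ ℂ) hB
    exact e1.add ((analyticAt_snd.inv hq2).smul e2)
  refine h1.congr ?_
  filter_upwards [(isOpen_snd_ne_zero hU).mem_nhds ⟨hq, hq2⟩] with q' hq'
  refine ContinuousLinearMap.ext fun v => ?_
  rw [h.eq q' hq'.1 hq'.2]
  simp [smul_smul, div_eq_inv_mul]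

/-- Since dy / y pulls back to dw, the connection pulled back by `expMap` has no pole. -/
lemma coverForm_eq (h : LogConnection Γ (ball 0 ρ) A B) (hρ : 0 < ρ) {z : C2} (hz : z ∈ cover ρ) :
    coverForm A B z = Γ (expMap z) ∘L expMapDeriv z := by
  refine ContinuousLinearMap.ext fun v => ?_
  rw [ContinuousLinearMap.comp_apply, h.eq _ (expMap_mem_ball hρ hz) (expMap_snd_ne_zero z),
    coverForm_apply]
  have : Complex.exp z.2 ≠ 0 := Complex.exp_ne_zero _
  simp [expMapDeriv, expMap]

lemma analyticOnNhd_coverForm (h : LogConnection Γ (ball 0 ρ) A B) (hρ : 0 < ρ) :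
    AnalyticOnNhd ℂ (coverForm A B) (cover ρ) := by
  intro z hz
  have hA := (h.analytic_A _ (expMap_mem_ball hρ hz)).comp (analyticAt_expMap z)
  have hB := (h.analytic_B _ (expMap_mem_ball hρ hz)).comp (analyticAt_expMap z)
  exact (analyticAt_smulRight (ContinuousLinearMap.fst ℂ ℂ ℂ) hA).add
    (analyticAt_smulRight (ContinuousLinearMap.snd ℂ ℂ ℂ) hB)

lemma hasFDerivAt_expMapDeriv (z : C2) : ∃ D : C2 →L[ℂ] C2 →L[ℂ] C2,
    HasFDerivAt expMapDeriv D z ∧ ∀ v w, D v w = D w v := by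
  have h1 : AnalyticAt ℂ (fderiv ℂ expMap) z := (analyticAt_expMap z).fderiv
  have h2 : fderiv ℂ expMap = expMapDeriv := funext fun z => (hasFDerivAt_expMap z).fderiv
  refine ⟨fderiv ℂ (fderiv ℂ expMap) z, ?_, fun v w => ?_⟩
  · have := h1.differentiableAt.hasFDerivAt
    rwa [h2] at this ⊢
  · exact ((analyticAt_expMap z).contDiffAt (n := ω)).isSymmSndFDerivAt (by simp) v w

/-- Curvature is tensorial: the second derivative of `expMap` enters symmetrically and cancels. -/
lemma coverForm_flat (h : LogConnection Γ (ball 0 ρ) A B) (hρ : 0 < ρ) {z : C2} (hz : z ∈ cover ρ)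
    (v w : C2) : fderiv ℂ (coverForm A B) z v w - fderiv ℂ (coverForm A B) z w v +
      (coverForm A B z v * coverForm A B z w - coverForm A B z w * coverForm A B z v) = 0 := by
  obtain ⟨D, hD, hsymm⟩ := hasFDerivAt_expMapDeriv z
  have hq := expMap_mem_ball hρ hz
  have hΓ := (h.analyticAt isOpen_ball hq (expMap_snd_ne_zero z)).differentiableAt.hasFDerivAt
  have heq : coverForm A B =ᶠ[𝓝 z] fun z => Γ (expMap z) ∘L expMapDeriv z := by
    filter_upwards [isOpen_cover.mem_nhds hz] with z' hz' using coverForm_eq h hρ hz'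
  have h2 : ∀ v w, fderiv ℂ (coverForm A B) z v w =
      fderiv ℂ Γ (expMap z) (expMapDeriv z v) (expMapDeriv z w) + Γ (expMap z) (D v w) := fun v w =>
    hasFDerivAt_clm_comp_apply (hΓ.comp z (hasFDerivAt_expMap z)) hD heq v w
  have h3 := h.curvature _ hq (expMap_snd_ne_zero z) (expMapDeriv z v) (expMapDeriv z w)
  rw [h2, h2, hsymm w v, coverForm_eq h hρ hz, ← h3, extD]
  simp only [ContinuousLinearMap.comp_apply]
  change _ + (_ ∘L _ - _ ∘L _) = _
  abel

/-- The form of the connection matrices forces the residue to kill `∂/∂x`. -/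
lemma LogConnection.residue_fst (h : LogConnection Γ (ball 0 ρ) A B) {q : C2}
    (hq : q ∈ ball (0 : C2) ρ) : B q (1, 0) = q.2 • A q (0, 1) := by
  refine eqOn_of_eqOn_snd_ne_zero (f := fun q => B q (1, 0)) (g := fun q => q.2 • A q (0, 1))
    isOpen_ball (h.analytic_B.continuousOn.clm_apply continuousOn_const)
    (continuous_snd.continuousOn.smul (h.analytic_A.continuousOn.clm_apply continuousOn_const))
    (fun q hq hq2 => ?_) hq
  -- Vanishing torsion on the coordinate frame reads A(∂y) = B(∂x) / y.
  have h1 := h.torsion q hq hq2 (1, 0) (0, 1)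
  rw [h.eq q hq hq2, h.eq q hq hq2] at h1
  simp at h1
  rw [h1, smul_inv_smul₀ hq2]

/-- The connection has bounded coefficients. -/
def BoundedCoeff (ρ : ℝ) (A B : C2 → End2) : Prop :=
  ∃ K : ℝ, ∀ q ∈ ball (0 : C2) ρ, ‖A q‖ ≤ K ∧ ‖B q‖ ≤ K

lemma BoundedCoeff.exists_coverForm_le (hρ : 0 < ρ) (hb : BoundedCoeff ρ A B) :
    ∃ K : ℝ, 0 ≤ K ∧ (∀ q ∈ ball (0 : C2) ρ, ‖A q‖ ≤ K ∧ ‖B q‖ ≤ K) ∧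
      ∀ z ∈ cover ρ, ‖coverForm A B z‖ ≤ 2 * K := by
  obtain ⟨K, hK⟩ := hb
  have hK0 : 0 ≤ K := (norm_nonneg _).trans (hK 0 (mem_ball_self hρ)).1
  refine ⟨K, hK0, hK, fun z hz => ContinuousLinearMap.opNorm_le_bound _ (by positivity) fun v => ?_⟩
  obtain ⟨h1, h2⟩ := hK _ (expMap_mem_ball hρ hz)
  rw [coverForm_apply]
  refine (norm_add_le _ _).trans ?_
  rw [norm_smul, norm_smul]
  have h3 := norm_fst_le v
  have h4 := norm_snd_le v
  nlinarith [mul_le_mul h3 h1 (norm_nonneg _) (norm_nonneg v),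
    mul_le_mul h4 h2 (norm_nonneg _) (norm_nonneg v)]

/-- A fundamental matrix on the cover, with its monodromy. -/
structure IsFundamental (F : C2 → End2) (A B : C2 → End2) (ρ : ℝ) (N : End2) : Prop where
  parallel : IsParallel F (coverForm A B) (cover ρ)
  isUnit : ∀ z ∈ cover ρ, IsUnit (F z)
  deck : ∀ z ∈ cover ρ, F (deck z) = N * F z

lemma cover_nonempty (hρ : 0 < ρ) : ((0, Real.log ρ - 1) : C2) ∈ cover ρ := by
  simp [cover, hρ]

/-- The pulled-back connection is invariant under the deck transformation, so F composed with it is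
again parallel. By uniqueness it is F multiplied on the left by a constant matrix, the monodromy. -/
lemma exists_isFundamental (h : LogConnection Γ (ball 0 ρ) A B) (hρ : 0 < ρ)
    (hb : BoundedCoeff ρ A B) : ∃ F N, IsFundamental F A B ρ N := by
  obtain ⟨K, hK0, -, hK⟩ := hb.exists_coverForm_le hρ
  obtain ⟨F, hF, hunit⟩ := exists_fundamental isOpen_cover convex_cover (cover_nonempty hρ)
    (analyticOnNhd_coverForm h hρ) hK (fun z hz v w => coverForm_flat h hρ hz v w)
  set z₁ : C2 := (0, Real.log ρ - 1)
  have hz₁ : z₁ ∈ cover ρ := cover_nonempty hρ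
  obtain ⟨u, hu⟩ := hunit z₁ hz₁
  have hFd : IsParallel (fun z => F (deck z)) (coverForm A B) (cover ρ) := by
    intro z hz
    have h1 := hF (deck z) (deck_mem_cover hz)
    have h2 : HasFDerivAt deck (ContinuousLinearMap.id ℂ C2) z :=
      (hasFDerivAt_id z).add_const _
    have h3 := h1.comp z h2
    rwa [ContinuousLinearMap.comp_id, coverForm_deck] at h3
  refine ⟨F, F (deck z₁) * ↑u⁻¹, hF, hunit, fun z hz => ?_⟩
  refine hFd.eqOn (hF.const_mul (F (deck z₁) * ↑u⁻¹)) convex_cover hK hz₁ ?_ hz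
  rw [← hu, mul_assoc, Units.inv_mul, mul_one]

lemma IsFundamental.moderateGrowth {F : C2 → End2} {N : End2} (hF : IsFundamental F A B ρ N)
    (hρ : 0 < ρ) (hb : BoundedCoeff ρ A B) :
    ∃ C K : ℝ, 0 ≤ C ∧ 0 ≤ K ∧ ∀ z ∈ cover ρ,
      ‖F z‖ ≤ C * Real.exp (K * ‖z - (0, (Real.log ρ - 1 : ℂ))‖) := by
  obtain ⟨K, hK0, -, hK⟩ := hb.exists_coverForm_le hρ
  exact ⟨_, 2 * K, norm_nonneg _, by positivity, fun z hz =>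
    hF.parallel.norm_le convex_cover hK (cover_nonempty hρ) hz⟩

lemma IsFundamental.analyticOnNhd {F : C2 → End2} {N : End2} (hF : IsFundamental F A B ρ N) :
    AnalyticOnNhd ℂ F (cover ρ) :=
  analyticOnNhd_of_differentiableOn isOpen_cover fun z hz =>
    (hF.parallel z hz).differentiableAt.differentiableWithinAt

end Local
end LogAffine

end

/-! ### Shape of a fundamental matrix with parabolic monodromy. -/

noncomputable section
open Set Metric
namespace LogAffine

/-- The normal form of a parabolic monodromy, acting on `(ω_∞, ω_0)`. -/
def jordan (l : ℂ) : End2 :=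
  (l • ContinuousLinearMap.fst ℂ ℂ ℂ).prod (l • (ContinuousLinearMap.snd ℂ ℂ ℂ -
    (2 * Real.pi * Complex.I : ℂ) • ContinuousLinearMap.fst ℂ ℂ ℂ))

/-- The monodromy is conjugate to a parabolic normal form. -/
def HasJordanForm (N : End2) : Prop :=
  ∃ P : End2, IsUnit P ∧ ∃ l : ℂ, l ≠ 0 ∧ P * N = jordan l * P

lemma one_smul_add_zero_smul {E : Type*} [NormedAddCommGroup E] [NormedSpace ℂ E] (x y : E) :
    (1 : ℂ) • x + (0 : ℂ) • y = x := by simp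

lemma smul_add_one_smul {E : Type*} [NormedAddCommGroup E] [NormedSpace ℂ E] (c : ℂ) (x y : E) :
    c • x + (1 : ℂ) • y = y + c • x := by rw [one_smul, add_comm]

section Local

variable {Γ : ConnForm} {A B : C2 → End2} {ρ : ℝ} {F : C2 → End2} {N : End2}

lemma IsFundamental.const_mul (hF : IsFundamental F A B ρ N) {P N' : End2} (hP : IsUnit P)
    (h : P * N = N' * P) : IsFundamental (fun z => P * F z) A B ρ N' where
  parallel := hF.parallel.const_mul P
  isUnit z hz := hP.mul (hF.isUnit z hz)
  deck z hz := by
    rw [hF.deck z hz, ← mul_assoc, h, mul_assoc]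

lemma IsFundamental.hasFDerivAt_row (hF : IsFundamental F A B ρ N) (ℓ : C2 →L[ℂ] ℂ) {z : C2}
    (hz : z ∈ cover ρ) : ∃ D : C2 →L[ℂ] C2 →L[ℂ] ℂ, HasFDerivAt (fun z => ℓ ∘L F z) D z ∧
      ∀ v, D v = (ℓ ∘L F z) ∘L coverForm A B z v := by
  have h1 := ((ContinuousLinearMap.compL ℂ C2 C2 ℂ ℓ).hasFDerivAt).comp z (hF.parallel z hz)
  exact ⟨_, h1, fun v => rfl⟩

lemma hasFDerivAt_exp_smul {E : Type*} [NormedAddCommGroup E] [NormedSpace ℂ E] {R : C2 → E}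
    {z : C2} (k : ℂ) (hR : AnalyticAt ℂ R (expMap z)) :
    ∃ D : C2 →L[ℂ] E, HasFDerivAt (fun z => Complex.exp (k * z.2) • R (expMap z)) D z ∧
      ∀ v, D v = Complex.exp (k * z.2) • (v.1 • fderiv ℂ R (expMap z) (1, 0) +
        v.2 • ((expMap z).2 • fderiv ℂ R (expMap z) (0, 1) + k • R (expMap z))) := by
  have h1 : HasFDerivAt (fun z : C2 => Complex.exp (k * z.2)) _ z :=
    ((hasFDerivAt_snd (𝕜 := ℂ) (p := z)).const_mul k).cexp
  have h2 := (hR.differentiableAt.hasFDerivAt).comp z (hasFDerivAt_expMap z)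
  refine ⟨_, h1.smul h2, fun v => ?_⟩
  have h3 : expMapDeriv z v = v.1 • ((1, 0) : C2) + (v.2 * (expMap z).2) • ((0, 1) : C2) := by
    ext
    · simp [expMapDeriv]
    · simp [expMapDeriv, expMap, mul_comm]
  have h4 : fderiv ℂ R (expMap z) (expMapDeriv z v) = v.1 • fderiv ℂ R (expMap z) (1, 0) +
      (v.2 * (expMap z).2) • fderiv ℂ R (expMap z) (0, 1) := by
    rw [h3, map_add, map_smul, map_smul]
  simp only [add_apply, smul_apply, ContinuousLinearMap.smulRight_apply,
    ContinuousLinearMap.comp_apply, h4, ContinuousLinearMap.coe_snd',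
    smul_add, smul_smul, smul_eq_mul]
  module

lemma jordan_fst (l : ℂ) (T : End2) : (ContinuousLinearMap.fst ℂ ℂ ℂ) ∘L (jordan l * T) =
    l • ((ContinuousLinearMap.fst ℂ ℂ ℂ) ∘L T) := by
  refine ContinuousLinearMap.ext fun v => ?_
  simp [jordan]

lemma jordan_snd (l : ℂ) (T : End2) : (ContinuousLinearMap.snd ℂ ℂ ℂ) ∘L (jordan l * T) =
    l • ((ContinuousLinearMap.snd ℂ ℂ ℂ) ∘L T -
      (2 * Real.pi * Complex.I : ℂ) • (ContinuousLinearMap.fst ℂ ℂ ℂ) ∘L T) := by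
  refine ContinuousLinearMap.ext fun v => ?_
  simp [jordan]

/-- The rows of a fundamental matrix are not proportional. -/
lemma IsFundamental.row_comb_ne_zero (hF : IsFundamental F A B ρ N) {z : C2} (hz : z ∈ cover ρ)
    {a b : ℂ} (h : a • ((ContinuousLinearMap.fst ℂ ℂ ℂ) ∘L F z) +
      b • ((ContinuousLinearMap.snd ℂ ℂ ℂ) ∘L F z) = 0) : a = 0 ∧ b = 0 := by
  obtain ⟨u, hu⟩ := hF.isUnit z hz
  have key : ∀ v : C2, a * v.1 + b * v.2 = 0 := by
    intro v
    have h1 := congrArg (fun L : C2 →L[ℂ] ℂ => L ((u⁻¹ : End2ˣ).val v)) h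
    have h2 : F z ((u⁻¹ : End2ˣ).val v) = v := by
      rw [← hu]
      change ((u : End2) * (u⁻¹ : End2ˣ).val) v = v
      rw [Units.mul_inv]; rfl
    simpa [h2] using h1
  exact ⟨by simpa using key (1, 0), by simpa using key (0, 1)⟩

/-- Shape of a pair of functions on the cover with parabolic monodromy. -/
lemma exists_shape {E : Type*} [NormedAddCommGroup E] [NormedSpace ℂ E] [CompleteSpace E]
    (hρ : 0 < ρ) {l : ℂ} (hl : l ≠ 0) {φ₁ φ₂ : C2 → E}
    (han1 : AnalyticOnNhd ℂ φ₁ (cover ρ)) (han2 : AnalyticOnNhd ℂ φ₂ (cover ρ))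
    (hg1 : ModerateGrowth ρ φ₁) (hg2 : ModerateGrowth ρ φ₂)
    (hd1 : ∀ z ∈ cover ρ, φ₁ (deck z) = l • φ₁ z)
    (hd2 : ∀ z ∈ cover ρ, φ₂ (deck z) = l • (φ₂ z - (2 * Real.pi * Complex.I : ℂ) • φ₁ z))
    {z₀ : C2} (hz₀ : z₀ ∈ cover ρ) (hne1 : φ₁ z₀ ≠ 0) (hne2 : φ₂ z₀ + z₀.2 • φ₁ z₀ ≠ 0) :
    ∃ (k j : ℂ) (d : ℤ) (ψ χ : C2 → E), k = j + d ∧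
      AnalyticOnNhd ℂ ψ (ball 0 ρ) ∧ AnalyticOnNhd ℂ χ (ball 0 ρ) ∧
      (∀ z ∈ cover ρ, φ₁ z = Complex.exp (k * z.2) • ψ (expMap z)) ∧
      (∀ z ∈ cover ρ, φ₂ z = Complex.exp (j * z.2) • χ (expMap z) - z.2 • φ₁ z) ∧
      (∃ x ∈ ball (0 : ℂ) ρ, ψ (x, 0) ≠ 0) ∧ (∃ x ∈ ball (0 : ℂ) ρ, χ (x, 0) ≠ 0) := by
  have hpi : (2 * Real.pi * Complex.I : ℂ) ≠ 0 := Complex.two_pi_I_ne_zero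
  -- With e^{2πiμ} = l, both e^{-μw} φ₁ and e^{-μw} (φ₂ + w φ₁) are periodic: the increment 2πi of w
  -- compensates the off-diagonal entry of the Jordan form.
  set μ : ℂ := Complex.log l / (2 * Real.pi * Complex.I) with hμ
  have hexp : Complex.exp (μ * (2 * Real.pi * Complex.I)) = l := by
    rw [hμ, div_mul_cancel₀ _ hpi, Complex.exp_log hl]
  have hdk : ∀ z : C2, (deck z).2 = z.2 + 2 * Real.pi * Complex.I := fun z => by simp [deck]
  have hexpd : ∀ z : C2, Complex.exp (-μ * (deck z).2) = Complex.exp (-μ * z.2) * l⁻¹ := by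
    intro z
    rw [← hexp, ← Complex.exp_neg, ← Complex.exp_add, hdk]
    congr 1
    ring
  have hean : ∀ z : C2, AnalyticAt ℂ (fun z : C2 => Complex.exp (-μ * z.2)) z := fun z =>
    (analyticAt_const.mul analyticAt_snd).cexp
  obtain ⟨m₁, ψ, hψ, hψeq, hψ0⟩ := exists_meromorphic_descent hρ
    (f := fun z => Complex.exp (-μ * z.2) • φ₁ z)
    (fun z hz => (hean z).smul (han1 z hz))
    (fun z hz => by
      rw [hexpd, hd1 z hz, smul_smul, inv_mul_cancel_right₀ hl])
    ((moderateGrowth_exp (-μ)).smul hg1)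
    ⟨_, hz₀, smul_ne_zero (Complex.exp_ne_zero _) hne1⟩
  obtain ⟨m₂, χ, hχ, hχeq, hχ0⟩ := exists_meromorphic_descent hρ
    (f := fun z => Complex.exp (-μ * z.2) • (φ₂ z + z.2 • φ₁ z))
    (fun z hz => (hean z).smul ((han2 z hz).add (analyticAt_snd.smul (han1 z hz))))
    (fun z hz => by
      rw [hexpd, hd1 z hz, hd2 z hz, hdk, mul_smul, smul_comm _ l, ← smul_add, inv_smul_smul₀ hl]
      module)
    ((moderateGrowth_exp (-μ)).smul (hg2.add (moderateGrowth_snd.smul hg1)))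
    ⟨_, hz₀, smul_ne_zero (Complex.exp_ne_zero _) hne2⟩
  have hun : ∀ (m : ℤ) (z : C2) (X R : E),
      Complex.exp (-μ * z.2) • X = Complex.exp (m * z.2) • R →
      X = Complex.exp ((μ + m) * z.2) • R := by
    intro m z X R h
    rw [add_mul, Complex.exp_add, mul_smul, ← h, smul_smul, ← Complex.exp_add]
    simp
  refine ⟨μ + m₁, μ + m₂, m₁ - m₂, ψ, χ, by push_cast; ring, hψ, hχ,
    fun z hz => hun _ _ _ _ (hψeq z hz), fun z hz => ?_, hψ0, hχ0⟩
  rw [← hun _ _ _ _ (hχeq z hz), add_sub_cancel_right]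

/-- Shape of a fundamental matrix with parabolic monodromy. -/
lemma IsFundamental.exists_shape (hρ : 0 < ρ) (hb : BoundedCoeff ρ A B) {l : ℂ} (hl : l ≠ 0)
    (hF : IsFundamental F A B ρ (jordan l)) :
    ∃ (k j : ℂ) (d : ℤ) (ψ χ : C2 → C2 →L[ℂ] ℂ), k = j + d ∧
      AnalyticOnNhd ℂ ψ (ball 0 ρ) ∧ AnalyticOnNhd ℂ χ (ball 0 ρ) ∧
      (∀ z ∈ cover ρ, (ContinuousLinearMap.fst ℂ ℂ ℂ) ∘L F z =
        Complex.exp (k * z.2) • ψ (expMap z)) ∧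
      (∀ z ∈ cover ρ, (ContinuousLinearMap.snd ℂ ℂ ℂ) ∘L F z =
        Complex.exp (j * z.2) • χ (expMap z) - z.2 • ((ContinuousLinearMap.fst ℂ ℂ ℂ) ∘L F z)) ∧
      (∃ x ∈ ball (0 : ℂ) ρ, ψ (x, 0) ≠ 0) ∧ (∃ x ∈ ball (0 : ℂ) ρ, χ (x, 0) ≠ 0) := by
  have han : ∀ ℓ : C2 →L[ℂ] ℂ, AnalyticOnNhd ℂ (fun z => ℓ ∘L F z) (cover ρ) := fun ℓ z hz =>
    analyticAt_clm_comp analyticAt_const (hF.analyticOnNhd z hz)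
  obtain ⟨C, K, hC, hK, hgr⟩ := hF.moderateGrowth hρ hb
  have hmgl : ∀ ℓ : C2 →L[ℂ] ℂ, ModerateGrowth ρ (fun z => ℓ ∘L F z) := fun ℓ =>
    (moderateGrowth_of_exp_norm_sub hC hK hgr).clm (ContinuousLinearMap.compL ℂ C2 C2 ℂ ℓ)
  refine LogAffine.exists_shape (E := C2 →L[ℂ] ℂ) hρ hl (han _) (han _) (hmgl _) (hmgl _)
    (fun z hz => by rw [hF.deck z hz, jordan_fst]) (fun z hz => by rw [hF.deck z hz, jordan_snd])
    (cover_nonempty hρ) (fun h => ?_) (fun h => ?_)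
  · exact one_ne_zero (hF.row_comb_ne_zero (cover_nonempty hρ) (a := 1) (b := 0)
      ((one_smul_add_zero_smul (E := C2 →L[ℂ] ℂ) _ _).trans h)).1
  · exact one_ne_zero (hF.row_comb_ne_zero (cover_nonempty hρ)
      (a := ((0, Real.log ρ - 1) : C2).2) (b := 1)
      ((smul_add_one_smul (E := C2 →L[ℂ] ℂ) _ _ _).trans h)).2

/-- The equations satisfied by `e^{kw} ψ(x, e^w)` descend to `ψ`. -/
lemma descend_equations {E : Type*} [NormedAddCommGroup E] [NormedSpace ℂ E] [CompleteSpace E]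
    (hρ : 0 < ρ) {k : ℂ} {ψ a b : C2 → E} (hψ : AnalyticOnNhd ℂ ψ (ball 0 ρ))
    (ha : ContinuousOn a (ball 0 ρ)) (hb : ContinuousOn b (ball 0 ρ))
    (h : ∀ z ∈ cover ρ, ∃ D : C2 →L[ℂ] E,
      HasFDerivAt (fun z => Complex.exp (k * z.2) • ψ (expMap z)) D z ∧
      ∀ v, D v = Complex.exp (k * z.2) • (v.1 • a (expMap z) + v.2 • b (expMap z))) :
    ∀ q ∈ ball (0 : C2) ρ, fderiv ℂ ψ q (1, 0) = a q ∧
      q.2 • fderiv ℂ ψ q (0, 1) + k • ψ q = b q := by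
  have hoff : ∀ q ∈ ball (0 : C2) ρ, q.2 ≠ 0 → fderiv ℂ ψ q (1, 0) = a q ∧
      q.2 • fderiv ℂ ψ q (0, 1) + k • ψ q = b q := by
    intro q hq hq2
    have hz := log_mem_cover hρ hq2 hq
    obtain ⟨D, hD, hDv⟩ := h _ hz
    obtain ⟨D', hD', hDv'⟩ := hasFDerivAt_exp_smul (z := (q.1, Complex.log q.2)) k
      (by rw [expMap_log hq2]; exact hψ q hq)
    have hDD := hD.unique hD'
    have he : Complex.exp (k * Complex.log q.2) ≠ 0 := Complex.exp_ne_zero _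
    constructor
    · have h1 := hDv (1, 0)
      rw [hDD, hDv'] at h1
      simp only [expMap_log hq2, one_smul, zero_smul, add_zero] at h1
      exact smul_right_injective _ he h1
    · have h1 := hDv (0, 1)
      rw [hDD, hDv'] at h1
      simp only [expMap_log hq2, one_smul, zero_smul, zero_add] at h1
      exact smul_right_injective _ he h1
  have hdψ := hψ.fderiv.continuousOn
  intro q hq
  exact ⟨eqOn_of_eqOn_snd_ne_zero (f := fun q => fderiv ℂ ψ q (1, 0)) isOpen_ball
      (hdψ.clm_apply continuousOn_const) ha (fun q hq hq2 => (hoff q hq hq2).1) hq,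
    eqOn_of_eqOn_snd_ne_zero (f := fun q => q.2 • fderiv ℂ ψ q (0, 1) + k • ψ q) isOpen_ball
      ((continuous_snd.continuousOn.smul (hdψ.clm_apply continuousOn_const)).add
        (continuousOn_const.smul hψ.continuousOn)) hb
      (fun q hq hq2 => (hoff q hq hq2).2) hq⟩

lemma mk_zero_mem_ball {x : ℂ} (hx : x ∈ ball (0 : ℂ) ρ) : ((x, 0) : C2) ∈ ball (0 : C2) ρ := by
  rw [← Prod.mk_zero_zero, ← ball_prod_same]
  exact ⟨hx, mem_ball_self (dist_nonneg.trans_lt hx)⟩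

lemma continuousOn_add_pow_smul {E : Type*} [NormedAddCommGroup E] [NormedSpace ℂ E]
    {f g : C2 → E} {U : Set C2} (hf : ContinuousOn f U) (hg : ContinuousOn g U) (n : ℕ) :
    ContinuousOn (fun q => f q + q.2 ^ n • g q) U :=
  hf.add ((continuous_snd.pow _).continuousOn.smul hg)

/-- Solving the w-component of the equation for y^d ψ shows that this product extends continuously
across the axis. For d < 0 this forces a positive power of y to divide ψ. It serves to exclude
negative d. -/
lemma eq_zero_of_neg_order {E : Type*} [NormedAddCommGroup E] [NormedSpace ℂ E] [CompleteSpace E]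
    (hρ : 0 < ρ) {d : ℤ} (hd : d < 0) {j : ℂ} {ψ χ a b : C2 → E}
    (hψ : AnalyticOnNhd ℂ ψ (ball 0 ρ)) (hχ : AnalyticOnNhd ℂ χ (ball 0 ρ))
    (hb : ContinuousOn b (ball 0 ρ))
    (h : ∀ z ∈ cover ρ, ∃ D : C2 →L[ℂ] E,
      HasFDerivAt (fun z => Complex.exp (j * z.2) • χ (expMap z)) D z ∧
      ∀ v, D v = Complex.exp (j * z.2) • (v.1 • a (expMap z) +
        v.2 • (b (expMap z) + Complex.exp (d * z.2) • ψ (expMap z))))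
    {x : ℂ} (hx : x ∈ ball (0 : ℂ) ρ) : ψ (x, 0) = 0 := by
  obtain ⟨m, hm⟩ : ∃ m : ℕ, d = -(m + 1 : ℕ) := ⟨(-d - 1).toNat, by omega⟩
  have hc : ContinuousOn (fun q : C2 => q.2 • fderiv ℂ χ q (0, 1) + j • χ q - b q) (ball 0 ρ) :=
    ((continuous_snd.continuousOn.smul
      (hχ.fderiv.continuousOn.clm_apply continuousOn_const)).add
      (continuousOn_const.smul hχ.continuousOn)).sub hb
  have key : ∀ q ∈ ball (0 : C2) ρ, ψ q = q.2 ^ (m + 1) •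
      (q.2 • fderiv ℂ χ q (0, 1) + j • χ q - b q) := by
    refine fun q hq => eqOn_of_eqOn_snd_ne_zero isOpen_ball hψ.continuousOn (g := fun q =>
      q.2 ^ (m + 1) • (q.2 • fderiv ℂ χ q (0, 1) + j • χ q - b q))
      ((continuous_snd.pow _).continuousOn.smul hc) ?_ hq
    intro q hq hq2
    have hz := log_mem_cover hρ hq2 hq
    obtain ⟨D, hD, hDv⟩ := h _ hz
    obtain ⟨D', hD', hDv'⟩ := hasFDerivAt_exp_smul (z := (q.1, Complex.log q.2)) j
      (by rw [expMap_log hq2]; exact hχ q hq)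
    have e0 := hDv (0, 1)
    rw [hD.unique hD', hDv', expMap_log hq2] at e0
    have e1 := smul_right_injective E (Complex.exp_ne_zero _) e0
    have e5 : Complex.exp (d * Complex.log q.2) = (q.2 ^ (m + 1))⁻¹ := by
      rw [Complex.exp_int_mul, Complex.exp_log hq2, hm, zpow_neg, zpow_natCast]
    simp only [e5, zero_smul, zero_add, one_smul] at e1
    rw [e1, add_sub_cancel_left, smul_inv_smul₀ (pow_ne_zero _ hq2)]
  rw [key _ (mk_zero_mem_ball hx)]
  simp

/-- A solution of `∂ψ/∂x = ψ A` on the line `y = 0` has no zero unless it vanishes identically. -/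
lemma ne_zero_on_line (hb : BoundedCoeff ρ A B) {ψ : C2 → C2 →L[ℂ] ℂ}
    (hψ : AnalyticOnNhd ℂ ψ (ball 0 ρ))
    (hψx : ∀ q ∈ ball (0 : C2) ρ, fderiv ℂ ψ q (1, 0) = ψ q ∘L A q)
    (h0 : ∃ x ∈ ball (0 : ℂ) ρ, ψ (x, 0) ≠ 0) {x : ℂ} (hx : x ∈ ball (0 : ℂ) ρ) :
    ψ (x, 0) ≠ 0 := by
  obtain ⟨K, hK⟩ := hb
  obtain ⟨x₁, hx₁, hne⟩ := h0
  intro hzero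
  apply hne
  have hseg : ∀ s ∈ Icc (0:ℝ) 1, ((x, 0) : C2) + (s : ℂ) • ((x₁, 0) - (x, 0)) ∈ ball (0 : C2) ρ :=
    fun s hs => segment_point_mem (convex_ball _ _) (mk_zero_mem_ball hx) (mk_zero_mem_ball hx₁) hs
  -- Along the axis ψ solves a linear differential equation, so by Gronwall a zero at x would
  -- propagate along the segment to x₁.
  have := norm_le_of_radial
    (f := fun s : ℝ => ψ (((x, 0) : C2) + (s : ℂ) • ((x₁, 0) - (x, 0))))
    (f' := fun s => fderiv ℂ ψ (((x, 0) : C2) + (s : ℂ) • ((x₁, 0) - (x, 0))) ((x₁, 0) - (x, 0)))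
    (K := K * ‖x₁ - x‖) (fun s hs => ?_) (fun s hs => ?_)
  · simpa [hzero] using this
  · exact (((hψ _ (hseg s hs)).differentiableAt.hasFDerivAt).restrictScalars ℝ).comp_hasDerivAt s
      (hasDerivAt_segment _ _ s)
  · have h1 : ((x₁, 0) - (x, 0) : C2) = (x₁ - x) • ((1, 0) : C2) := by simp
    rw [h1, map_smul, ← h1, hψx _ (hseg s hs), norm_smul, mul_comm K, mul_assoc]
    refine mul_le_mul_of_nonneg_left ?_ (norm_nonneg _)
    refine (ContinuousLinearMap.opNorm_comp_le _ _).trans ?_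
    rw [mul_comm]
    exact mul_le_mul_of_nonneg_right (hK _ (hseg s hs)).1 (norm_nonneg _)

lemma fderiv_apply_const {ψ : C2 → C2 →L[ℂ] ℂ} {q : C2} (hψ : AnalyticAt ℂ ψ q) (u v : C2) :
    fderiv ℂ (fun q => ψ q v) q u = fderiv ℂ ψ q u v := by
  have h1 := ((ContinuousLinearMap.apply ℂ ℂ v).hasFDerivAt).comp q
    hψ.differentiableAt.hasFDerivAt
  have h2 : fderiv ℂ (fun q => ψ q v) q = _ := h1.fderiv
  rw [h2]; rfl

lemma sub_smul_add_smul_comp (φ R S : C2 →L[ℂ] ℂ) (e w : ℂ) (v : C2) (X Y : End2)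
    (h : φ = e • R - w • S) : φ ∘L (v.1 • X + v.2 • Y) =
      e • (v.1 • (R ∘L X) + v.2 • (R ∘L Y)) - w • (S ∘L (v.1 • X + v.2 • Y)) := by
  subst h
  refine ContinuousLinearMap.ext fun u => ?_
  simp
  ring

/-- The differential equations for the components of a fundamental matrix with parabolic
monodromy. -/
lemma IsFundamental.shape_equations (hρ : 0 < ρ) (h : LogConnection Γ (ball 0 ρ) A B)
    (hF : IsFundamental F A B ρ N) {k j : ℂ} {d : ℤ} {ψ χ : C2 → C2 →L[ℂ] ℂ} (hkj : k = j + d)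
    (hψ : AnalyticOnNhd ℂ ψ (ball 0 ρ)) (hχ : AnalyticOnNhd ℂ χ (ball 0 ρ))
    (h1 : ∀ z ∈ cover ρ, (ContinuousLinearMap.fst ℂ ℂ ℂ) ∘L F z =
        Complex.exp (k * z.2) • ψ (expMap z))
    (h2 : ∀ z ∈ cover ρ, (ContinuousLinearMap.snd ℂ ℂ ℂ) ∘L F z =
        Complex.exp (j * z.2) • χ (expMap z) - z.2 • ((ContinuousLinearMap.fst ℂ ℂ ℂ) ∘L F z))
    (hψ0 : ∃ x ∈ ball (0 : ℂ) ρ, ψ (x, 0) ≠ 0) :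
    (∀ q ∈ ball (0 : C2) ρ, fderiv ℂ ψ q (1, 0) = ψ q ∘L A q ∧
      q.2 • fderiv ℂ ψ q (0, 1) + k • ψ q = ψ q ∘L B q) ∧
    0 ≤ d ∧
    (∀ q ∈ ball (0 : C2) ρ, fderiv ℂ χ q (1, 0) = χ q ∘L A q ∧
      q.2 • fderiv ℂ χ q (0, 1) + j • χ q = χ q ∘L B q + q.2 ^ d.toNat • ψ q) := by
  have hA := h.analytic_A.continuousOn
  have hB := h.analytic_B.continuousOn
  have hpart1 := descend_equations hρ (k := k) (a := fun q => ψ q ∘L A q)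
    (b := fun q => ψ q ∘L B q) hψ (hψ.continuousOn.clm_comp hA) (hψ.continuousOn.clm_comp hB)
    (fun z hz => by
      obtain ⟨D, hD, hDv⟩ := hF.hasFDerivAt_row (ContinuousLinearMap.fst ℂ ℂ ℂ) hz
      refine ⟨D, hD.congr_of_eventuallyEq ?_, fun v => ?_⟩
      · filter_upwards [isOpen_cover.mem_nhds hz] with z' hz' using (h1 z' hz').symm
      · rw [hDv, coverForm_apply, h1 z hz]
        refine ContinuousLinearMap.ext fun u => ?_
        simp
        ring)
  have hrow : ∀ z ∈ cover ρ, ∃ D : C2 →L[ℂ] C2 →L[ℂ] ℂ,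
      HasFDerivAt (fun z => Complex.exp (j * z.2) • χ (expMap z)) D z ∧
      ∀ v, D v = Complex.exp (j * z.2) • (v.1 • (χ (expMap z) ∘L A (expMap z)) +
        v.2 • (χ (expMap z) ∘L B (expMap z) + Complex.exp (d * z.2) • ψ (expMap z))) := by
    intro z hz
    obtain ⟨D₁, hD₁, hDv₁⟩ := hF.hasFDerivAt_row (ContinuousLinearMap.fst ℂ ℂ ℂ) hz
    obtain ⟨D₂, hD₂, hDv₂⟩ := hF.hasFDerivAt_row (ContinuousLinearMap.snd ℂ ℂ ℂ) hz
    -- Here e^{jw} χ = φ₂ + w φ₁. Differentiating the factor w adds φ₁ dw, the source of the term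
    -- y^d ψ in the equation for χ.
    have hs := hD₂.add ((hasFDerivAt_snd (𝕜 := ℂ) (p := z)).smul hD₁)
    refine ⟨_, hs.congr_of_eventuallyEq ?_, fun v => ?_⟩
    · filter_upwards [isOpen_cover.mem_nhds hz] with z' hz'
      refine ContinuousLinearMap.ext fun u => ?_
      have := congrArg (fun L : C2 →L[ℂ] ℂ => L u) (h2 z' hz')
      simp at this
      simp [this]
    · have e1 : Complex.exp (k * z.2) = Complex.exp (j * z.2) * Complex.exp (d * z.2) := by
        rw [← Complex.exp_add, hkj]; ring_nf
      refine ContinuousLinearMap.ext fun u => ?_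
      have e2 := congrArg (fun L : C2 →L[ℂ] ℂ => L u) (hDv₁ v)
      have e3 := congrArg (fun L : C2 →L[ℂ] ℂ => L u) (hDv₂ v)
      rw [coverForm_apply, sub_smul_add_smul_comp _ _ _ _ _ _ _ _ (h2 z hz)] at e3
      have e4 := congrArg (fun L : C2 →L[ℂ] ℂ => L u) (h1 z hz)
      rw [coverForm_apply] at e2
      simp at e2 e3 e4
      simp [e2, e3, e4, e1]
      ring
  have hd : 0 ≤ d := by
    by_contra hneg
    obtain ⟨x, hx, hx0⟩ := hψ0
    exact hx0 (eq_zero_of_neg_order (E := C2 →L[ℂ] ℂ) (a := fun q => χ q ∘L A q)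
      (b := fun q => χ q ∘L B q) hρ (not_le.1 hneg) hψ hχ
      (hχ.continuousOn.clm_comp hB) hrow hx)
  refine ⟨hpart1, hd, ?_⟩
  refine descend_equations (E := C2 →L[ℂ] ℂ) hρ (k := j) (ψ := χ) (a := fun q => χ q ∘L A q)
    (b := fun q => χ q ∘L B q + q.2 ^ d.toNat • ψ q) hχ (hχ.continuousOn.clm_comp hA)
    (continuousOn_add_pow_smul (E := C2 →L[ℂ] ℂ) (f := fun q => χ q ∘L B q) (g := ψ)
      (hχ.continuousOn.clm_comp hB) hψ.continuousOn d.toNat) fun z hz => ?_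
  obtain ⟨D, hD, hDv⟩ := hrow z hz
  refine ⟨D, hD, fun v => (hDv v).trans ?_⟩
  have : Complex.exp (d * z.2) = (expMap z).2 ^ d.toNat := by
    rw [Complex.exp_int_mul, ← zpow_natCast, Int.toNat_of_nonneg hd]; rfl
  rw [this]

/-- In dimension two, linear forms with a common nonzero kernel vector are proportional. -/
lemma exists_eq_smul_of_common_zero {ψ χ : C2 →L[ℂ] ℂ} (hψ : ψ ≠ 0) {v : C2} (hv : v ≠ 0)
    (h1 : ψ v = 0) (h2 : χ v = 0) : ∃ c : ℂ, ∀ u, χ u = c * ψ u := by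
  have hdec : ∀ (L : C2 →L[ℂ] ℂ) (u : C2), L u = u.1 * L (1, 0) + u.2 * L (0, 1) := fun L u => by
    have : u = u.1 • ((1, 0) : C2) + u.2 • ((0, 1) : C2) := by ext <;> simp
    conv_lhs => rw [this, map_add, map_smul, map_smul]
    rfl
  rw [hdec] at h1 h2
  have hdet : χ (1, 0) * ψ (0, 1) = χ (0, 1) * ψ (1, 0) := by
    by_cases hv1 : v.1 = 0
    · have hv2 : v.2 ≠ 0 := fun h => hv (Prod.ext hv1 h)
      rw [hv1] at h1 h2
      refine mul_left_cancel₀ hv2 ?_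
      linear_combination χ (1, 0) * h1 - ψ (1, 0) * h2
    · refine mul_left_cancel₀ hv1 ?_
      linear_combination ψ (0, 1) * h2 - χ (0, 1) * h1
  by_cases ha : ψ (1, 0) = 0
  · have hb : ψ (0, 1) ≠ 0 := fun hb => hψ (ContinuousLinearMap.ext fun u => by
      rw [hdec, ha, hb]; simp)
    refine ⟨χ (0, 1) / ψ (0, 1), fun u => ?_⟩
    rw [hdec χ u, hdec ψ u, ha]
    rw [ha, mul_zero] at hdet
    rw [(mul_eq_zero.1 hdet).resolve_right hb]
    field_simp
    ring
  · refine ⟨χ (1, 0) / ψ (1, 0), fun u => ?_⟩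
    rw [hdec χ u, hdec ψ u]
    field_simp
    linear_combination (-u.2) * hdet

/-- The two possible shapes of a parabolic fundamental matrix. -/
lemma IsFundamental.exists_cases (hρ : 0 < ρ) (h : LogConnection Γ (ball 0 ρ) A B)
    (hb : BoundedCoeff ρ A B) {l : ℂ} (hl : l ≠ 0) (hF : IsFundamental F A B ρ (jordan l)) :
    ∃ (k j : ℂ) (n : ℕ) (ψ χ : C2 → C2 →L[ℂ] ℂ),
      AnalyticOnNhd ℂ ψ (ball 0 ρ) ∧ AnalyticOnNhd ℂ χ (ball 0 ρ) ∧
      (∀ z ∈ cover ρ, (ContinuousLinearMap.fst ℂ ℂ ℂ) ∘L F z =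
        Complex.exp (k * z.2) • ψ (expMap z)) ∧
      (∀ z ∈ cover ρ, (ContinuousLinearMap.snd ℂ ℂ ℂ) ∘L F z =
        Complex.exp (j * z.2) • χ (expMap z) - z.2 • ((ContinuousLinearMap.fst ℂ ℂ ℂ) ∘L F z)) ∧
      (∀ q ∈ ball (0 : C2) ρ, q.2 * fderiv ℂ ψ q (1, 0) (0, 1) =
        q.2 * fderiv ℂ ψ q (0, 1) (1, 0) + k * ψ q (1, 0)) ∧
      (∀ q ∈ ball (0 : C2) ρ, q.2 * fderiv ℂ χ q (1, 0) (0, 1) =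
        q.2 * fderiv ℂ χ q (0, 1) (1, 0) + j * χ q (1, 0) - q.2 ^ n * ψ q (1, 0)) ∧
      ((k = n ∧ j = 0 ∧ (∀ x ∈ ball (0 : ℂ) ρ, ψ (x, 0) (1, 0) = 0) ∧ χ 0 (1, 0) ≠ 0 ∧
          ψ 0 (0, 1) ≠ 0) ∨
        (0 < n ∧ k = 0 ∧ j = -n ∧ (∀ x ∈ ball (0 : ℂ) ρ, χ (x, 0) (1, 0) = 0) ∧
          ψ 0 (1, 0) ≠ 0 ∧ χ 0 (0, 1) ≠ 0)) := by
  obtain ⟨k, j, d, ψ, χ, hkj, hψ, hχ, h1, h2, hψ0, hχ0⟩ := hF.exists_shape hρ hb hl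
  obtain ⟨eψ, hd, eχ⟩ := hF.shape_equations hρ h hkj hψ hχ h1 h2 hψ0
  obtain ⟨n, rfl⟩ := Int.eq_ofNat_of_zero_le hd
  rw [Int.toNat_natCast] at eχ
  have sψ : ∀ q ∈ ball (0 : C2) ρ, ∀ v, q.2 * fderiv ℂ ψ q (0, 1) v + k * ψ q v = ψ q (B q v) :=
    fun q hq v => congrArg (fun L : C2 →L[ℂ] ℂ => L v) (eψ q hq).2
  have sχ : ∀ q ∈ ball (0 : C2) ρ, ∀ v, q.2 * fderiv ℂ χ q (0, 1) v + j * χ q v =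
      χ q (B q v) + q.2 ^ n * ψ q v :=
    fun q hq v => congrArg (fun L : C2 →L[ℂ] ℂ => L v) (eχ q hq).2
  have hres : ∀ q ∈ ball (0 : C2) ρ, B q (1, 0) = q.2 • A q (0, 1) := fun q hq => h.residue_fst hq
  have hψline := fun x hx => ne_zero_on_line hb hψ (fun q hq => (eψ q hq).1) hψ0 (x := x) hx
  have hχline := fun x hx => ne_zero_on_line hb hχ (fun q hq => (eχ q hq).1) hχ0 (x := x) hx
  -- On the axis the residue kills ∂x, so evaluating the residue equations there gives k ψ(∂x) = 0
  -- and, below, j χ(∂x) = 0^n ψ(∂x).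
  have pψ : ∀ x ∈ ball (0 : ℂ) ρ, k * ψ (x, 0) (1, 0) = 0 := fun x hx => by
    have := sψ _ (mk_zero_mem_ball hx) (1, 0)
    rw [hres _ (mk_zero_mem_ball hx)] at this
    simpa using this
  have pχ : ∀ x ∈ ball (0 : ℂ) ρ, j * χ (x, 0) (1, 0) = 0 ^ n * ψ (x, 0) (1, 0) := fun x hx => by
    have := sχ _ (mk_zero_mem_ball hx) (1, 0)
    rw [hres _ (mk_zero_mem_ball hx)] at this
    simpa using this
  -- A common kernel vector at a point of the axis would give χ = cψ, and the two residue equations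
  -- would then give c n + 0^n = 0. For n = 0 this is absurd; for n > 0 it gives c = 0, against χ ≠
  -- 0.
  have hindep : ∀ x ∈ ball (0 : ℂ) ρ, ∀ v, ψ (x, 0) v = 0 → χ (x, 0) v = 0 → v = 0 := by
    intro x hx v hv1 hv2
    by_contra hv0
    obtain ⟨c, hc⟩ := exists_eq_smul_of_common_zero (hψline x hx) hv0 hv1 hv2
    have hcomb : ∀ u, (c * (j - k) - 0 ^ n) * ψ (x, 0) u = 0 := fun u => by
      have e1 := sψ _ (mk_zero_mem_ball hx) u
      have e2 := sχ _ (mk_zero_mem_ball hx) u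
      rw [hc, hc] at e2
      simp only [zero_mul, zero_add] at e1 e2
      linear_combination e2 - c * e1
    obtain ⟨u, hu⟩ : ∃ u, ψ (x, 0) u ≠ 0 := by
      by_contra! hall
      exact hψline x hx (ContinuousLinearMap.ext hall)
    have e3 := (mul_eq_zero.1 (hcomb u)).resolve_right hu
    rw [hkj] at e3
    rcases Nat.eq_zero_or_pos n with rfl | hn
    · simp at e3
    · have : c = 0 := by
        rw [zero_pow hn.ne'] at e3
        have hn' : (n : ℂ) ≠ 0 := by exact_mod_cast hn.ne'
        simpa [hn.ne'] using e3
      exact hχline x hx (ContinuousLinearMap.ext fun u => by rw [hc, this, zero_mul]; rfl)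
  have h00 : (0 : ℂ) ∈ ball (0 : ℂ) ρ := mem_ball_self hρ
  refine ⟨k, j, n, ψ, χ, hψ, hχ, h1, h2, fun q hq => ?_, fun q hq => ?_, ?_⟩
  -- These two identities express, up to a power of y, that ω_∞ and ω_0 are closed; they result from
  -- the torsion relation between A and B.
  · rw [sψ q hq, hres q hq, map_smul, (eψ q hq).1]; rfl
  · rw [sχ q hq, hres q hq, map_smul, (eχ q hq).1]
    simp
  have hne : ∀ L : C2 →L[ℂ] ℂ, L ≠ 0 → L (1, 0) = 0 → L (0, 1) ≠ 0 := by
    intro L hL h1 h2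
    apply hL
    refine ContinuousLinearMap.ext fun v => ?_
    have : v = v.1 • ((1, 0) : C2) + v.2 • ((0, 1) : C2) := by ext <;> simp
    rw [this, map_add, map_smul, map_smul, h1, h2]
    simp
  have hzz : ((0 : ℂ), (0 : ℂ)) = (0 : C2) := rfl
  -- The dichotomy between the two models: whether or not ψ annihilates the tangent direction of the
  -- divisor all along the axis.
  by_cases hcase : ∀ x ∈ ball (0 : ℂ) ρ, ψ (x, 0) (1, 0) = 0
  · left
    have hχe : χ (0, 0) (1, 0) ≠ 0 := fun hc => by
      have := hindep 0 h00 (1, 0) (hcase 0 h00) hc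
      simp at this
    have hj : j = 0 := by
      have := pχ 0 h00
      rw [hcase 0 h00, mul_zero] at this
      exact (mul_eq_zero.1 this).resolve_right hχe
    exact ⟨by rw [hkj, hj]; simp, hj, hcase, hχe, hne _ (hψline 0 h00) (hcase 0 h00)⟩
  · right
    push Not at hcase
    obtain ⟨x₁, hx₁, hx₁0⟩ := hcase
    have hk : k = 0 := (mul_eq_zero.1 (pψ x₁ hx₁)).resolve_right hx₁0
    have hjn : j = -n := by
      rw [hk] at hkj; push_cast at hkj; linear_combination -hkj
    have hn : n ≠ 0 := by
      rintro rfl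
      have := pχ x₁ hx₁
      simp [hjn] at this
      exact hx₁0 this.symm
    have hχe : ∀ x ∈ ball (0 : ℂ) ρ, χ (x, 0) (1, 0) = 0 := by
      intro x hx
      have := pχ x hx
      rw [hjn, zero_pow hn, zero_mul] at this
      exact (mul_eq_zero.1 this).resolve_left (by simpa using hn)
    refine ⟨Nat.pos_of_ne_zero hn, hk, hjn, hχe, fun hc => ?_, hne _ (hχline 0 h00) (hχe 0 h00)⟩
    have := hindep 0 h00 (1, 0) hc (hχe 0 h00)
    simp at this

end Local
end LogAffine

end

/-! ### Primitives of closed forms with zeros or poles along y = 0. -/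

noncomputable section
open Set Metric
namespace LogAffine

variable {ρ : ℝ}

lemma clm_apply_eq (L : C2 →L[ℂ] ℂ) (u : C2) : L u = u.1 * L (1, 0) + u.2 * L (0, 1) := by
  have : u = u.1 • ((1, 0) : C2) + u.2 • ((0, 1) : C2) := by ext <;> simp
  conv_lhs => rw [this, map_add, map_smul, map_smul]
  rfl

lemma snd_mul_cancel {f g : C2 → ℂ} (hf : ContinuousOn f (ball 0 ρ))
    (hg : ContinuousOn g (ball 0 ρ)) (h : ∀ q ∈ ball (0 : C2) ρ, q.2 * f q = q.2 * g q) :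
    ∀ q ∈ ball (0 : C2) ρ, f q = g q := fun _ hq =>
  eqOn_of_eqOn_snd_ne_zero isOpen_ball hf hg (fun q hq hq2 => mul_left_cancel₀ hq2 (h q hq)) hq

lemma AnalyticOnNhd.continuousOn_fderiv_apply {f : C2 → ℂ} {U : Set C2}
    (hf : AnalyticOnNhd ℂ f U) (u : C2) : ContinuousOn (fun q => fderiv ℂ f q u) U :=
  hf.fderiv.continuousOn.clm_apply continuousOn_const

lemma AnalyticOnNhd.fderiv_apply {f : C2 → ℂ} {U : Set C2}
    (hf : AnalyticOnNhd ℂ f U) (u : C2) : AnalyticOnNhd ℂ (fun q => fderiv ℂ f q u) U :=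
  fun q hq => analyticAt_clm_apply (hf.fderiv q hq) analyticAt_const

lemma fderiv_snd_mul {f : C2 → ℂ} {q : C2} (hf : AnalyticAt ℂ f q) (u : C2) :
    fderiv ℂ (fun q : C2 => q.2 * f q) q u = u.2 * f q + q.2 * fderiv ℂ f q u := by
  have h : HasFDerivAt (fun q : C2 => q.2 * f q) _ q :=
    (hasFDerivAt_snd (𝕜 := ℂ) (p := q)).mul hf.differentiableAt.hasFDerivAt
  rw [h.fderiv]
  simp
  ring

lemma fderiv_fderiv_comm {f : C2 → ℂ} {q : C2} (hf : AnalyticAt ℂ f q) (u v : C2) :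
    fderiv ℂ (fun q => fderiv ℂ f q u) q v = fderiv ℂ (fun q => fderiv ℂ f q v) q u := by
  rw [fderiv_apply_const hf.fderiv, fderiv_apply_const hf.fderiv]
  exact (hf.contDiffAt (n := ω)).isSymmSndFDerivAt (by simp) v u

/-- The Poincaré lemma for holomorphic forms on a bidisc. -/
lemma exists_primitive {p q : C2 → ℂ} (hp : AnalyticOnNhd ℂ p (ball 0 ρ))
    (hq : AnalyticOnNhd ℂ q (ball 0 ρ))
    (h : ∀ z ∈ ball (0 : C2) ρ, fderiv ℂ p z (0, 1) = fderiv ℂ q z (1, 0)) :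
    ∃ X : C2 → ℂ, AnalyticOnNhd ℂ X (ball 0 ρ) ∧ X 0 = 0 ∧
      ∀ z ∈ ball (0 : C2) ρ, fderiv ℂ X z (1, 0) = p z ∧ fderiv ℂ X z (0, 1) = q z := by
  set η : C2 → C2 →L[ℂ] ℂ := fun z => (ContinuousLinearMap.fst ℂ ℂ ℂ).smulRight (p z) +
    (ContinuousLinearMap.snd ℂ ℂ ℂ).smulRight (q z) with hη
  have hηv : ∀ z v, η z v = v.1 * p z + v.2 * q z := fun z v => by simp [hη]
  have hηa : AnalyticOnNhd ℂ η (ball 0 ρ) := fun z hz =>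
    (analyticAt_smulRight _ (hp z hz)).add (analyticAt_smulRight _ (hq z hz))
  have hd : ∀ z ∈ ball (0 : C2) ρ, ∀ u v, fderiv ℂ η z u v =
      v.1 * fderiv ℂ p z u + v.2 * fderiv ℂ q z u := by
    intro z hz u v
    rw [← fderiv_apply_const (hηa z hz)]
    simp only [hηv]
    have : HasFDerivAt (fun z => v.1 * p z + v.2 * q z) _ z :=
      ((hp z hz).differentiableAt.hasFDerivAt.const_mul v.1).add
        ((hq z hz).differentiableAt.hasFDerivAt.const_mul v.2)
    rw [this.fderiv]
    simp
  have hdr : ∀ z ∈ ball (0 : C2) ρ, ∀ u v, fderiv ℝ η z u v =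
      v.1 * fderiv ℂ p z u + v.2 * fderiv ℂ q z u := by
    intro z hz u v
    rw [← hd z hz]
    have := ((hηa z hz).differentiableAt.hasFDerivAt).restrictScalars ℝ
    rw [this.fderiv]; rfl
  obtain ⟨X, hX⟩ := (convex_ball (0 : C2) ρ).exists_forall_hasFDerivAt_of_fderiv_symmetric
    isOpen_ball (show DifferentiableOn ℝ η _ from fun z hz =>
      ((hηa z hz).differentiableAt.restrictScalars ℝ).differentiableWithinAt)
    (fun z hz u v => by
      rw [hdr z hz, hdr z hz, clm_apply_eq (fderiv ℂ p z) u, clm_apply_eq (fderiv ℂ q z) u,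
        clm_apply_eq (fderiv ℂ p z) v, clm_apply_eq (fderiv ℂ q z) v, h z hz]
      ring)
  refine ⟨fun z => X z - X 0, analyticOnNhd_of_differentiableOn isOpen_ball
    (fun z hz => ((hX z hz).sub_const _).differentiableAt.differentiableWithinAt), by simp,
    fun z hz => ?_⟩
  rw [((hX z hz).sub_const (X 0)).fderiv, hηv, hηv]
  simp

/-- A function whose derivative in `x` vanishes on `y = 0` is constant there. -/
lemma eq_of_fderiv_fst_eq_zero {f : C2 → ℂ} (hf : AnalyticOnNhd ℂ f (ball 0 ρ))
    (h : ∀ q ∈ ball (0 : C2) ρ, q.2 = 0 → fderiv ℂ f q (1, 0) = 0) :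
    ∀ q ∈ ball (0 : C2) ρ, q.2 = 0 → f q = f 0 := by
  rintro ⟨x, y⟩ hq (rfl : y = 0)
  have hmem : ∀ {x : ℂ}, x ∈ ball (0 : ℂ) ρ ↔ ((x, 0) : C2) ∈ ball (0 : C2) ρ := fun {x} => by
    simp [Prod.norm_def]
  have hd : ∀ x ∈ ball (0 : ℂ) ρ, HasDerivAt (fun x : ℂ => f (x, 0)) 0 x := by
    intro x hx
    have h1 := (hf _ (hmem.1 hx)).differentiableAt.hasFDerivAt.comp_hasDerivAt x
      ((hasDerivAt_id x).prodMk (hasDerivAt_const x (0 : ℂ)))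
    rw [h _ (hmem.1 hx) rfl] at h1
    exact h1
  have h0 : (0 : ℂ) ∈ ball (0 : ℂ) ρ := mem_ball_self (dist_nonneg.trans_lt (hmem.2 hq))
  exact (convex_ball (0 : ℂ) ρ).is_const_of_fderivWithin_eq_zero (𝕜 := ℂ)
    (fun x hx => (hd x hx).differentiableAt.differentiableWithinAt) (fun x hx => by
      rw [fderivWithin_of_isOpen isOpen_ball hx]
      ext
      simpa using (hd x hx).deriv) (hmem.2 hq) h0

/-- The primitive, up to a residue, of `p dx + q dy / y`. -/
lemma exists_primitive_residue {p q : C2 → ℂ}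
    (hp : AnalyticOnNhd ℂ p (ball 0 ρ)) (hq : AnalyticOnNhd ℂ q (ball 0 ρ))
    (h : ∀ z ∈ ball (0 : C2) ρ, z.2 * fderiv ℂ p z (0, 1) = fderiv ℂ q z (1, 0)) :
    ∃ (c : ℂ) (H : C2 → ℂ), AnalyticOnNhd ℂ H (ball 0 ρ) ∧ H 0 = 0 ∧ ∀ z ∈ ball (0 : C2) ρ,
      fderiv ℂ H z (1, 0) = p z ∧ z.2 * fderiv ℂ H z (0, 1) = q z - c := by
  -- The hypothesis gives ∂q/∂x = 0 on y = 0, so q is constant there; this constant is the residue.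
  have hc := eq_of_fderiv_fst_eq_zero hq (fun z hz hz2 => by rw [← h z hz, hz2, zero_mul])
  obtain ⟨q₁, hq₁, hqq⟩ := exists_eq_snd_smul (f := fun z => q z - q 0) isOpen_ball
    (hq.sub analyticOnNhd_const) (fun z hz hz2 => by rw [hc z hz hz2, sub_self])
  have hqd : ∀ z ∈ ball (0 : C2) ρ, fderiv ℂ q z (1, 0) = z.2 * fderiv ℂ q₁ z (1, 0) := by
    intro z hz
    have he : q =ᶠ[𝓝 z] fun z => z.2 * q₁ z + q 0 := by
      filter_upwards [isOpen_ball.mem_nhds hz] with z' hz'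
      have := hqq z' hz'
      simp only [smul_eq_mul] at this
      rw [← this]; ring
    rw [he.fderiv_eq, fderiv_add_const, fderiv_snd_mul (hq₁ z hz)]
    simp
  obtain ⟨H, hH, hH0, hHd⟩ := exists_primitive hp hq₁ (snd_mul_cancel
    (AnalyticOnNhd.continuousOn_fderiv_apply hp _) (AnalyticOnNhd.continuousOn_fderiv_apply hq₁ _)
    (fun z hz => by rw [h z hz, hqd z hz]))
  refine ⟨q 0, H, hH, hH0, fun z hz => ⟨(hHd z hz).1, ?_⟩⟩
  rw [(hHd z hz).2]
  exact (hqq z hz).symm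

/-- The primitive of `y^{n+1} p dx + y^n q dy` is divisible by `y^{n+1}`. -/
lemma exists_primitive_pos (n : ℕ) {p q : C2 → ℂ}
    (hp : AnalyticOnNhd ℂ p (ball 0 ρ)) (hq : AnalyticOnNhd ℂ q (ball 0 ρ))
    (h : ∀ z ∈ ball (0 : C2) ρ,
      (n + 1) * p z + z.2 * fderiv ℂ p z (0, 1) = fderiv ℂ q z (1, 0)) :
    ∃ H : C2 → ℂ, AnalyticOnNhd ℂ H (ball 0 ρ) ∧ ∀ z ∈ ball (0 : C2) ρ,
      fderiv ℂ H z (1, 0) = p z ∧ (n + 1) * H z + z.2 * fderiv ℂ H z (0, 1) = q z := by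
  -- Raises the exponent by one: a solution G for the data y p, y q vanishes on the axis, and G / y
  -- solves the equation for p, q.
  have key : ∀ (m : ℂ) (p q G : C2 → ℂ), AnalyticOnNhd ℂ p (ball 0 ρ) →
      AnalyticOnNhd ℂ q (ball 0 ρ) → AnalyticOnNhd ℂ G (ball 0 ρ) →
      (∀ z ∈ ball (0 : C2) ρ, z.2 = 0 → G z = 0) → (∀ z ∈ ball (0 : C2) ρ,
        fderiv ℂ G z (1, 0) = z.2 * p z ∧ m * G z + z.2 * fderiv ℂ G z (0, 1) = z.2 * q z) →
      ∃ H : C2 → ℂ, AnalyticOnNhd ℂ H (ball 0 ρ) ∧ ∀ z ∈ ball (0 : C2) ρ,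
        fderiv ℂ H z (1, 0) = p z ∧ (m + 1) * H z + z.2 * fderiv ℂ H z (0, 1) = q z := by
    intro m p q G hp hq hG hG0 hGd
    obtain ⟨H, hH, hGH⟩ := exists_eq_snd_smul isOpen_ball hG hG0
    have hd : ∀ z ∈ ball (0 : C2) ρ, ∀ u, fderiv ℂ G z u = u.2 * H z + z.2 * fderiv ℂ H z u := by
      intro z hz u
      rw [← fderiv_snd_mul (hH z hz)]
      have : G =ᶠ[𝓝 z] fun z => z.2 * H z := by
        filter_upwards [isOpen_ball.mem_nhds hz] with z' hz' using hGH z' hz'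
      rw [this.fderiv_eq]
    have h1 := snd_mul_cancel (AnalyticOnNhd.continuousOn_fderiv_apply hH (1, 0)) hp.continuousOn
      (fun z hz => by rw [← (hGd z hz).1, hd z hz]; simp)
    have h2 := snd_mul_cancel (f := fun z => (m + 1) * H z + z.2 * fderiv ℂ H z (0, 1))
      ((continuousOn_const.mul hH.continuousOn).add
        (continuous_snd.continuousOn.mul (AnalyticOnNhd.continuousOn_fderiv_apply hH (0, 1))))
      hq.continuousOn (fun z hz => by
        rw [← (hGd z hz).2, hd z hz, hGH z hz, smul_eq_mul]; ring)
    exact ⟨H, hH, fun z hz => ⟨h1 z hz, h2 z hz⟩⟩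
  have hsp : ∀ {f : C2 → ℂ}, AnalyticOnNhd ℂ f (ball 0 ρ) →
      AnalyticOnNhd ℂ (fun z : C2 => z.2 * f z) (ball 0 ρ) := fun hf z hz =>
    analyticAt_snd.mul (hf z hz)
  induction n generalizing p q with
  | zero =>
    obtain ⟨c, G, hG, hG0, hGd⟩ := exists_primitive_residue (hsp hp) (hsp hq) (fun z hz => by
      rw [fderiv_snd_mul (hp z hz), fderiv_snd_mul (hq z hz), ← h z hz]
      push_cast; ring)
    rcases le_or_gt ρ 0 with hρ | hρ
    · rw [ball_eq_empty.2 hρ]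
      exact ⟨0, fun z hz => hz.elim, fun z hz => hz.elim⟩
    have hc : c = 0 := by
      have := (hGd 0 (mem_ball_self hρ)).2
      simp only [Prod.snd_zero, zero_mul, zero_sub] at this
      exact neg_eq_zero.1 this.symm
    have := key 0 p q G hp hq hG (fun z hz hz2 => by
      rw [eq_of_fderiv_fst_eq_zero hG (fun z hz hz2 => by rw [(hGd z hz).1, hz2, zero_mul]) z hz
        hz2, hG0]) (fun z hz => ⟨(hGd z hz).1, by rw [(hGd z hz).2, hc]; ring⟩)
    simpa using this
  | succ n ih =>
    obtain ⟨G, hG, hGd⟩ := ih (hsp hp) (hsp hq) (fun z hz => by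
      rw [fderiv_snd_mul (hp z hz), fderiv_snd_mul (hq z hz)]
      have := h z hz
      push_cast at this
      linear_combination z.2 * this)
    have := key (n + 1) p q G hp hq hG (fun z hz hz2 => by
      have := (hGd z hz).2
      rw [hz2, zero_mul, zero_mul, add_zero] at this
      exact (mul_eq_zero.1 this).resolve_left (Nat.cast_add_one_ne_zero n)) hGd
    exact_mod_cast this

/-- The primitive, up to a residue, of `y^{-n} p dx + y^{-n-1} q dy`. -/
lemma exists_primitive_neg (n : ℕ) {p q : C2 → ℂ}
    (hp : AnalyticOnNhd ℂ p (ball 0 ρ)) (hq : AnalyticOnNhd ℂ q (ball 0 ρ))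
    (h : ∀ z ∈ ball (0 : C2) ρ,
      z.2 * fderiv ℂ p z (0, 1) - n * p z = fderiv ℂ q z (1, 0)) :
    ∃ (c : ℂ) (H : C2 → ℂ), AnalyticOnNhd ℂ H (ball 0 ρ) ∧ ∀ z ∈ ball (0 : C2) ρ,
      fderiv ℂ H z (1, 0) = p z ∧
        z.2 * fderiv ℂ H z (0, 1) - n * H z = q z - c * z.2 ^ n := by
  induction n generalizing p q with
  | zero =>
    obtain ⟨c, H, hH, -, hHd⟩ := exists_primitive_residue hp hq (fun z hz => by
      rw [← h z hz]; simp)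
    exact ⟨c, H, hH, by simpa using hHd⟩
  | succ n ih =>
    have hn : ((n : ℂ) + 1) ≠ 0 := Nat.cast_add_one_ne_zero n
    have hpy := AnalyticOnNhd.fderiv_apply hp (0, 1)
    have hqy := AnalyticOnNhd.fderiv_apply hq (0, 1)
    have hcm : ∀ {f : C2 → ℂ} {z : C2}, AnalyticAt ℂ f z → ∀ (a : ℂ) (u : C2),
        fderiv ℂ (fun z => a * f z) z u = a * fderiv ℂ f z u := fun hf a u => by
      rw [fderiv_const_mul hf.differentiableAt]; rfl
    -- Differentiating the equation in y lowers the exponent by one. A solution H for the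
    -- y-derivatives divided by n + 1 gives back y H - q / (n + 1) as a solution of the original
    -- system, with the same residue.
    obtain ⟨c, H, hH, hHd⟩ := ih (p := fun z => (n + 1 : ℂ)⁻¹ * fderiv ℂ p z (0, 1))
      (q := fun z => (n + 1 : ℂ)⁻¹ * fderiv ℂ q z (0, 1))
      (analyticOnNhd_const.mul hpy) (analyticOnNhd_const.mul hqy) (fun z hz => by
        rw [hcm (hpy z hz), hcm (hqy z hz), fderiv_fderiv_comm (hq z hz)]
        have he : (fun z => fderiv ℂ q z (1, 0)) =ᶠ[𝓝 z]
            fun z => z.2 * fderiv ℂ p z (0, 1) - (n + 1) * p z := by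
          filter_upwards [isOpen_ball.mem_nhds hz] with z' hz'
          rw [← h z' hz']; push_cast; ring
        have hd : HasFDerivAt (fun z => z.2 * fderiv ℂ p z (0, 1) - (n + 1) * p z) _ z :=
          ((hasFDerivAt_snd (𝕜 := ℂ) (p := z)).mul (hpy z hz).differentiableAt.hasFDerivAt).sub
            ((hp z hz).differentiableAt.hasFDerivAt.const_mul (n + 1 : ℂ))
        rw [he.fderiv_eq, hd.fderiv]
        simp
        ring)
    refine ⟨c, fun z => z.2 * H z - (n + 1 : ℂ)⁻¹ * q z, fun z hz =>
      (analyticAt_snd.mul (hH z hz)).sub (analyticAt_const.mul (hq z hz)), fun z hz => ?_⟩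
    have hd : HasFDerivAt (fun z => z.2 * H z - (n + 1 : ℂ)⁻¹ * q z) _ z :=
      ((hasFDerivAt_snd (𝕜 := ℂ) (p := z)).mul (hH z hz).differentiableAt.hasFDerivAt).sub
        ((hq z hz).differentiableAt.hasFDerivAt.const_mul (n + 1 : ℂ)⁻¹)
    have hdu : ∀ u, fderiv ℂ (fun z => z.2 * H z - (n + 1 : ℂ)⁻¹ * q z) z u =
        u.2 * H z + z.2 * fderiv ℂ H z u - (n + 1 : ℂ)⁻¹ * fderiv ℂ q z u := fun u => by
      rw [hd.fderiv]; simp; ring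
    obtain ⟨e1, e2⟩ := hHd z hz
    have e3 := h z hz
    push_cast at e3 ⊢
    rw [hdu, hdu, e1, ← e3]
    refine ⟨by field_simp; ring, ?_⟩
    have e4 : (n + 1 : ℂ) * (n + 1 : ℂ)⁻¹ = 1 := mul_inv_cancel₀ hn
    linear_combination z.2 * e2 + q z * e4

end LogAffine

end

/-! ### Normal forms of the two kinds of pencils. -/

noncomputable section
open Set Metric
namespace LogAffine

variable {ρ : ℝ}

/-- The map `(X, y e^L)`. -/
def straighten (X L : C2 → ℂ) (q : C2) : C2 := (X q, q.2 * Complex.exp (L q))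

lemma analyticAt_straighten {X L : C2 → ℂ} {q : C2} (hX : AnalyticAt ℂ X q)
    (hL : AnalyticAt ℂ L q) : AnalyticAt ℂ (straighten X L) q :=
  hX.prod (analyticAt_snd.mul hL.cexp)

lemma fderiv_straighten {X L : C2 → ℂ} {q : C2} (hX : AnalyticAt ℂ X q)
    (hL : AnalyticAt ℂ L q) (u : C2) : fderiv ℂ (straighten X L) q u =
      (fderiv ℂ X q u, Complex.exp (L q) * (u.2 + q.2 * fderiv ℂ L q u)) := by
  have h : HasFDerivAt (straighten X L) _ q := (hX.differentiableAt.hasFDerivAt).prodMk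
    ((hasFDerivAt_snd (𝕜 := ℂ) (p := q)).mul hL.differentiableAt.hasFDerivAt.cexp)
  rw [h.fderiv]
  ext
  · simp
  · simp; ring

/-- The derivative at the origin is triangular, with diagonal entries ∂X/∂x and e^L. -/
lemma exists_equiv_straighten {X L : C2 → ℂ} (hX : AnalyticAt ℂ X 0) (hL : AnalyticAt ℂ L 0)
    (h : fderiv ℂ X 0 (1, 0) ≠ 0) :
    ∃ e : C2 ≃L[ℂ] C2, HasFDerivAt (straighten X L) (e : C2 →L[ℂ] C2) 0 := by
  set T := fderiv ℂ (straighten X L) 0 with hT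
  have hTu : ∀ u, T u = (fderiv ℂ X 0 u, Complex.exp (L 0) * u.2) := fun u => by
    rw [hT, fderiv_straighten hX hL]; simp
  have hinj : Function.Injective (T : C2 →ₗ[ℂ] C2) := by
    rw [← LinearMap.ker_eq_bot, LinearMap.ker_eq_bot']
    intro u hu
    have hu' : T u = 0 := hu
    rw [hTu] at hu'
    have h2 : u.2 = 0 := by
      have := congrArg Prod.snd hu'
      simpa using this
    have h1 := congrArg Prod.fst hu'
    simp only [Prod.fst_zero] at h1
    rw [clm_apply_eq, h2, zero_mul, add_zero] at h1
    exact Prod.ext ((mul_eq_zero.1 h1).resolve_right h) h2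
  refine ⟨(LinearEquiv.ofInjectiveEndo (T : C2 →ₗ[ℂ] C2) hinj).toContinuousLinearEquiv, ?_⟩
  have := (analyticAt_straighten hX hL).differentiableAt.hasFDerivAt
  exact this

lemma modelOne_apply (n : ℕ) (m t : ℂ) (q u : C2) :
    modelOne n (fun _ => m) t q u = u.1 - q.2 ^ n * m * u.2 + t * q.2 ^ n * u.2 := by
  simp [modelOne]

lemma modelTwo_apply (n : ℕ) (c m t : ℂ) (q u : C2) :
    modelTwo n c (fun _ => m) t q u =
      -(m * u.1) + 1 / q.2 ^ n * u.2 + (c - q.1) / q.2 * u.2 + t * u.1 := by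
  simp [modelTwo]

/-- Normal form of a pencil of the first kind. -/
lemma exists_normal_form_one (hρ : 0 < ρ) (n : ℕ) {ψ χ : C2 → C2 →L[ℂ] ℂ}
    (hψ : AnalyticOnNhd ℂ ψ (ball 0 ρ)) (hχ : AnalyticOnNhd ℂ χ (ball 0 ρ))
    (dψ : ∀ q ∈ ball (0 : C2) ρ, q.2 * fderiv ℂ ψ q (1, 0) (0, 1) =
        q.2 * fderiv ℂ ψ q (0, 1) (1, 0) + n * ψ q (1, 0))
    (dχ : ∀ q ∈ ball (0 : C2) ρ, q.2 * fderiv ℂ χ q (1, 0) (0, 1) =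
        q.2 * fderiv ℂ χ q (0, 1) (1, 0) - q.2 ^ n * ψ q (1, 0))
    (hψ0 : ∀ x ∈ ball (0 : ℂ) ρ, ψ (x, 0) (1, 0) = 0) (hχ1 : χ 0 (1, 0) ≠ 0)
    (hψ1 : ψ 0 (0, 1) ≠ 0) :
    ∃ X L : C2 → ℂ, AnalyticAt ℂ X 0 ∧ AnalyticAt ℂ L 0 ∧ X 0 = 0 ∧ fderiv ℂ X 0 (1, 0) ≠ 0 ∧
      ∀ᶠ q in 𝓝 (0 : C2), q.2 ≠ 0 → ∀ w, Complex.exp w = q.2 → ∀ t u,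
        modelOne n (fun _ => w + L q) t (straighten X L q) (fderiv ℂ (straighten X L) q u) =
          χ q u - w * (q.2 ^ n * ψ q u) + t * (q.2 ^ n * ψ q u) := by
  have happ : ∀ {φ : C2 → C2 →L[ℂ] ℂ} (v : C2), AnalyticOnNhd ℂ φ (ball 0 ρ) →
      AnalyticOnNhd ℂ (fun q => φ q v) (ball 0 ρ) := fun v h q hq =>
    analyticAt_clm_apply (h q hq) analyticAt_const
  have h0 : (0 : C2) ∈ ball (0 : C2) ρ := mem_ball_self hρ
  obtain ⟨α, hα, hαψ⟩ := exists_eq_snd_smul isOpen_ball (happ (1, 0) hψ) (fun q hq hq2 => by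
    rw [show q = (q.1, 0) from Prod.ext rfl hq2]
    exact hψ0 q.1 (by rw [mem_ball_zero_iff] at hq ⊢; exact (norm_fst_le q).trans_lt hq))
  have hαd : ∀ q ∈ ball (0 : C2) ρ, ∀ u, fderiv ℂ ψ q u (1, 0) =
      u.2 * α q + q.2 * fderiv ℂ α q u := by
    intro q hq u
    rw [← fderiv_snd_mul (hα q hq), ← fderiv_apply_const (hψ q hq)]
    have : (fun q => ψ q (1, 0)) =ᶠ[𝓝 q] fun q => q.2 * α q := by
      filter_upwards [isOpen_ball.mem_nhds hq] with q' hq' using hαψ q' hq'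
    rw [this.fderiv_eq]
  -- The form ω_∞ = y^n ψ is closed with ψ(∂x) = y α, hence ω_∞ = d(y^{n+1} v).
  obtain ⟨v, hv, hvd⟩ := exists_primitive_pos n hα (happ (0, 1) hψ) (snd_mul_cancel
    ((continuousOn_const.mul hα.continuousOn).add (continuous_snd.continuousOn.mul
      (AnalyticOnNhd.continuousOn_fderiv_apply hα (0, 1))))
    (AnalyticOnNhd.continuousOn_fderiv_apply (happ (0, 1) hψ) (1, 0)) (fun q hq => by
      have e1 := dψ q hq
      have e2 := hαψ q hq
      simp only [smul_eq_mul] at e2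
      rw [hαd q hq, e2] at e1
      rw [fderiv_apply_const (hψ q hq), e1]
      simp; ring))
  have hn : ((n : ℂ) + 1) ≠ 0 := Nat.cast_add_one_ne_zero n
  have hv0 : v 0 ≠ 0 := by
    have := (hvd 0 h0).2
    simp only [Prod.snd_zero, zero_mul, add_zero] at this
    intro hv0
    rw [hv0, mul_zero] at this
    exact hψ1 this.symm
  -- Chosen so that e^{(n+1)L} = (n+1) v, that is Y^{n+1} / (n+1) = y^{n+1} v and Y^n dY = ω_∞ for Y
  -- = y e^L. Dividing by v 0 keeps the argument of the variable logarithm near 1.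
  set L : C2 → ℂ := fun q =>
    (n + 1 : ℂ)⁻¹ * (Complex.log (v q / v 0) + Complex.log ((n + 1) * v 0)) with hL
  have hUn : ∀ᶠ q in 𝓝 (0 : C2), q ∈ ball (0 : C2) ρ ∧ v q / v 0 ∈ Complex.slitPlane := by
    refine Filter.eventually_and.2 ⟨isOpen_ball.mem_nhds h0, ?_⟩
    have : ContinuousAt (fun q => v q / v 0) 0 := (hv 0 h0).continuousAt.div_const _
    exact this.eventually_mem (Complex.isOpen_slitPlane.mem_nhds (by simp [hv0]))
  have hLa : ∀ q ∈ ball (0 : C2) ρ, v q / v 0 ∈ Complex.slitPlane → AnalyticAt ℂ L q :=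
    fun q hq hs => analyticAt_const.mul
      ((((hv q hq).div analyticAt_const hv0).clog hs).add analyticAt_const)
  have hLe : ∀ q, v q / v 0 ∈ Complex.slitPlane → Complex.exp (L q) ^ (n + 1) = (n + 1) * v q := by
    intro q hs
    have : ((n + 1 : ℕ) : ℂ) * L q = Complex.log (v q / v 0) + Complex.log ((n + 1) * v 0) := by
      rw [hL]; push_cast; field_simp
    rw [← Complex.exp_nat_mul, this, Complex.exp_add, Complex.exp_log (Complex.slitPlane_ne_zero hs),
      Complex.exp_log (mul_ne_zero hn hv0)]
    field_simp
  have hLd : ∀ q ∈ ball (0 : C2) ρ, v q / v 0 ∈ Complex.slitPlane → ∀ u,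
      (n + 1) * v q * fderiv ℂ L q u = fderiv ℂ v q u := by
    intro q hq hs u
    have hd : HasFDerivAt L _ q := ((((hv q hq).div analyticAt_const
      hv0).differentiableAt.hasFDerivAt.clog hs).add_const _).const_mul (n + 1 : ℂ)⁻¹
    have hd2 : fderiv ℂ (fun q => v q / v 0) q u = fderiv ℂ v q u / v 0 := by
      simp only [div_eq_mul_inv]
      rw [fderiv_mul_const (hv q hq).differentiableAt]
      simp [mul_comm]
    have hvq : v q ≠ 0 := fun h => by simp [h] at hs
    rw [hd.fderiv]
    change (n + 1) * v q * ((n + 1 : ℂ)⁻¹ * ((v q / v 0)⁻¹ * fderiv ℂ (fun q => v q / v 0) q u)) = _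
    rw [hd2]
    field_simp
  obtain ⟨r, hr, hrU⟩ := Metric.eventually_nhds_iff_ball.1 hUn
  have hball : ball (0 : C2) r ⊆ ball 0 ρ := fun q hq => (hrU q hq).1
  have hLr : AnalyticOnNhd ℂ L (ball 0 r) := fun q hq => hLa q (hrU q hq).1 (hrU q hq).2
  have hvu : ∀ q ∈ ball (0 : C2) ρ, ∀ u, ψ q u = (n + 1) * v q * u.2 + q.2 * fderiv ℂ v q u := by
    intro q hq u
    obtain ⟨e1, e2⟩ := hvd q hq
    have e3 := hαψ q hq
    simp only [smul_eq_mul] at e3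
    rw [clm_apply_eq (ψ q), clm_apply_eq (fderiv ℂ v q), e1, e3, ← e2]
    ring
  have hpow : AnalyticOnNhd ℂ (fun q : C2 => q.2 ^ n) (ball 0 r) := fun q _ => analyticAt_snd.pow n
  have hterm : ∀ w : C2, AnalyticOnNhd ℂ (fun q : C2 => L q * q.2 ^ n * ψ q w) (ball 0 r) :=
    fun w => (hLr.mul hpow).mul ((happ w hψ).mono hball)
  have hterm' : ∀ q ∈ ball (0 : C2) r, q.2 ≠ 0 → ∀ u w,
      fderiv ℂ (fun q : C2 => L q * q.2 ^ n * ψ q w) q u =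
      fderiv ℂ L q u * q.2 ^ n * ψ q w + L q * (n * q.2 ^ n / q.2 * u.2) * ψ q w +
        L q * q.2 ^ n * fderiv ℂ ψ q u w := by
    intro q hq hq2 u w
    have hd : HasFDerivAt (fun q : C2 => L q * q.2 ^ n * ψ q w) _ q :=
      ((hLr q hq).differentiableAt.hasFDerivAt.mul
        ((hasFDerivAt_snd (𝕜 := ℂ) (p := q)).pow n)).mul
        (happ w hψ q (hball hq)).differentiableAt.hasFDerivAt
    rw [hd.fderiv, ← fderiv_apply_const (hψ q (hball hq))]
    have : (n : ℂ) * q.2 ^ n / q.2 = n * q.2 ^ (n - 1) := by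
      rcases n with _ | n
      · simp
      · rw [pow_succ]; field_simp; simp
    rw [this]
    simp
    ring
  -- Since ln Y = w + L, the single-valued form χ + L y^n ψ equals ω_0 + Y^n ln Y dY, which is what
  -- dX must be.
  obtain ⟨X, hX, hX0, hXd⟩ := exists_primitive (ρ := r)
    (p := fun q => χ q (1, 0) + L q * q.2 ^ n * ψ q (1, 0))
    (q := fun q => χ q (0, 1) + L q * q.2 ^ n * ψ q (0, 1))
    (((happ _ hχ).mono hball).add (hterm _)) (((happ _ hχ).mono hball).add (hterm _)) (by
      refine fun z hz => eqOn_of_eqOn_snd_ne_zero isOpen_ball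
        (AnalyticOnNhd.continuousOn_fderiv_apply (((happ _ hχ).mono hball).add (hterm _)) _)
        (AnalyticOnNhd.continuousOn_fderiv_apply (((happ _ hχ).mono hball).add (hterm _)) _)
        (fun q hq hq2 => ?_) hz
      have hadd : ∀ u w, fderiv ℂ (fun q => χ q w + L q * q.2 ^ n * ψ q w) q u =
          fderiv ℂ χ q u w + fderiv ℂ (fun q : C2 => L q * q.2 ^ n * ψ q w) q u := fun u w => by
        rw [fderiv_fun_add (happ w hχ q (hball hq)).differentiableAt
          (hterm w q hq).differentiableAt, ← fderiv_apply_const (hχ q (hball hq))]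
        rfl
      change fderiv ℂ (fun q => χ q (1, 0) + L q * q.2 ^ n * ψ q (1, 0)) q (0, 1) =
        fderiv ℂ (fun q => χ q (0, 1) + L q * q.2 ^ n * ψ q (0, 1)) q (1, 0)
      rw [hadd, hadd, hterm' q hq hq2, hterm' q hq hq2]
      have e1 := dψ q (hball hq)
      have e2 := dχ q (hball hq)
      have e3 := hLd q (hball hq) (hrU q hq).2
      have e4 := hvu q (hball hq)
      have hvq : (n + 1) * v q ≠ 0 := mul_ne_zero hn fun h => by
        have := (hrU q hq).2
        simp [h] at this
      -- Multiplication by (n+1) v y clears denominators, because dL = dv / ((n+1) v).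
      refine mul_left_cancel₀ (mul_ne_zero hvq hq2) ?_
      have hdiv : (n : ℂ) * q.2 ^ n / q.2 * q.2 = n * q.2 ^ n := by field_simp
      simp only [mul_one, mul_zero, zero_mul, add_zero]
      have e3x := e3 (1, 0)
      have e3y := e3 (0, 1)
      have e4x := e4 (1, 0)
      have e4y := e4 (0, 1)
      simp only [mul_one, mul_zero, zero_add] at e4x e4y
      linear_combination (exp := 1) (-(n + 1) * v q) * e2 + (-(n + 1) * v q) * L q * q.2 ^ n * e1 +
        (n + 1) * v q * L q * ψ q (1, 0) * hdiv + q.2 ^ (n + 1) * ψ q (1, 0) * e3y -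
        q.2 ^ (n + 1) * ψ q (0, 1) * e3x + q.2 ^ n * ((n + 1) * v q + q.2 * fderiv ℂ v q (0, 1)) * e4x
        - q.2 ^ n * q.2 * fderiv ℂ v q (1, 0) * e4y)
  have h0r : (0 : C2) ∈ ball (0 : C2) r := mem_ball_self hr
  refine ⟨X, L, hX 0 h0r, hLr 0 h0r, hX0, ?_, ?_⟩
  · rw [(hXd 0 h0r).1]
    have : ψ 0 (1, 0) = 0 := hψ0 0 (mem_ball_self hρ)
    rw [this]
    simpa using hχ1
  filter_upwards [isOpen_ball.mem_nhds h0r] with q hq hq2 w hw t u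
  have e3 := hLd q (hball hq) (hrU q hq).2 u
  have e4 := hvu q (hball hq) u
  have e5 := hLe q (hrU q hq).2
  have e6 : fderiv ℂ X q u = χ q u + L q * q.2 ^ n * ψ q u := by
    rw [clm_apply_eq (fderiv ℂ X q), (hXd q hq).1, (hXd q hq).2, clm_apply_eq (χ q) u,
      clm_apply_eq (ψ q) u]
    ring
  rw [modelOne_apply, fderiv_straighten (hX q hq) (hLr q hq)]
  simp only [straighten]
  have e7 : (q.2 * Complex.exp (L q)) ^ n * (Complex.exp (L q) * (u.2 + q.2 * fderiv ℂ L q u)) =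
      q.2 ^ n * ψ q u := by
    rw [e4, ← e3, mul_pow]
    rw [pow_succ] at e5
    linear_combination q.2 ^ n * (u.2 + q.2 * fderiv ℂ L q u) * e5
  rw [e6]
  linear_combination (t - (w + L q)) * e7

/-- The logarithm of the unit `e^L`, solution of an implicit equation. -/
lemma exists_implicit {H P : C2 → ℂ} (hH : AnalyticAt ℂ H 0) (hP : AnalyticAt ℂ P 0) (m : ℕ)
    (hm : m ≠ 0) (hH0 : H 0 ≠ 0) (hP0 : P 0 = 0) :
    ∃ L : C2 → ℂ, AnalyticAt ℂ L 0 ∧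
      ∀ᶠ q in 𝓝 (0 : C2), H q + Complex.exp (-(m * L q)) / m - P q * L q = 0 := by
  have hm' : (m : ℂ) ≠ 0 := by exact_mod_cast hm
  set f : C2 × ℂ → ℂ := fun p => H p.1 + Complex.exp (-(m * p.2)) / m - P p.1 * p.2 with hf
  -- At the origin P vanishes and the equation reduces to e^{-m l} = -m H(0), solvable because H(0)
  -- ≠ 0. Its derivative in l is m H(0), so the implicit function theorem applies.
  set l₀ : ℂ := -(Complex.log (-(m * H 0)) / m) with hl₀
  have hl : Complex.exp (-(m * l₀)) = -(m * H 0) := by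
    rw [hl₀, mul_neg, neg_neg, mul_div_cancel₀ _ hm',
      Complex.exp_log (neg_ne_zero.2 (mul_ne_zero hm' hH0))]
  have hfa : AnalyticAt ℂ f (0, l₀) := by
    have h1 : AnalyticAt ℂ (fun p : C2 × ℂ => H p.1) (0, l₀) :=
      AnalyticAt.comp (g := H) (f := Prod.fst) hH analyticAt_fst
    have h2 : AnalyticAt ℂ (fun p : C2 × ℂ => P p.1) (0, l₀) :=
      AnalyticAt.comp (g := P) (f := Prod.fst) hP analyticAt_fst
    exact (h1.add ((analyticAt_const.mul analyticAt_snd).neg.cexp.div analyticAt_const hm')).sub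
      (h2.mul analyticAt_snd)
  have hder : ∀ t : ℂ, fderiv ℂ f (0, l₀) (0, t) = m * H 0 * t := by
    intro t
    have h1 : HasDerivAt (fun s : ℂ => f (0, s)) (m * H 0) l₀ := by
      have h2 : HasDerivAt (fun s : ℂ => H 0 + Complex.exp (-(m * s)) / m - P 0 * s)
          (Complex.exp (-(m * l₀)) * (-(m * 1)) / m - P 0 * 1) l₀ :=
        ((((((hasDerivAt_id l₀).const_mul (m : ℂ)).neg).cexp.div_const (m : ℂ)).const_add
          (H 0))).sub ((hasDerivAt_id l₀).const_mul (P 0))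
      convert h2 using 1
      rw [hl, hP0]
      field_simp
      ring
    have h3 := hfa.differentiableAt.hasFDerivAt.comp_hasDerivAt l₀
      ((hasDerivAt_const l₀ (0 : C2)).prodMk (hasDerivAt_id l₀))
    have h4 : fderiv ℂ f (0, l₀) (0, 1) = m * H 0 := h3.unique h1
    have h5 : ((0 : C2), t) = t • ((0 : C2), (1 : ℂ)) := by simp
    rw [h5, map_smul, h4, smul_eq_mul, mul_comm]
  have hinv : (fderiv ℂ f (0, l₀) ∘L .inr ℂ C2 ℂ).IsInvertible := by
    refine ⟨ContinuousLinearEquiv.unitsEquivAut ℂ (Units.mk0 (m * H 0) (mul_ne_zero hm' hH0)), ?_⟩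
    ext
    simp [hder]
  have hcd : ContDiffAt ℂ ω f (0, l₀) := hfa.contDiffAt
  refine ⟨hcd.implicitFunction (by simp) hinv,
    (hcd.contDiffAt_implicitFunction (by simp) hinv).analyticAt, ?_⟩
  filter_upwards [hcd.eventually_apply_implicitFunction (by simp) hinv] with q hq
  have : f (0, l₀) = 0 := by
    simp only [hf]
    rw [hl, hP0]
    field_simp
    ring
  rw [this] at hq
  exact hq

/-- Normal form of a pencil of the second kind. -/
lemma exists_normal_form_two (hρ : 0 < ρ) (m : ℕ) {ψ χ : C2 → C2 →L[ℂ] ℂ}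
    (hψ : AnalyticOnNhd ℂ ψ (ball 0 ρ)) (hχ : AnalyticOnNhd ℂ χ (ball 0 ρ))
    (dψ : ∀ q ∈ ball (0 : C2) ρ, q.2 * fderiv ℂ ψ q (1, 0) (0, 1) =
        q.2 * fderiv ℂ ψ q (0, 1) (1, 0))
    (dχ : ∀ q ∈ ball (0 : C2) ρ, q.2 * fderiv ℂ χ q (1, 0) (0, 1) =
        q.2 * fderiv ℂ χ q (0, 1) (1, 0) - (m + 1) * χ q (1, 0) - q.2 ^ (m + 1) * ψ q (1, 0))
    (hχ0 : ∀ x ∈ ball (0 : ℂ) ρ, χ (x, 0) (1, 0) = 0) (hψ1 : ψ 0 (1, 0) ≠ 0)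
    (hχ1 : χ 0 (0, 1) ≠ 0) :
    ∃ (c s : ℂ) (X L : C2 → ℂ), (c = 0 ∨ c = 1) ∧ s ≠ 0 ∧
      AnalyticAt ℂ X 0 ∧ AnalyticAt ℂ L 0 ∧ X 0 = 0 ∧ fderiv ℂ X 0 (1, 0) ≠ 0 ∧
      ∀ᶠ q in 𝓝 (0 : C2), q.2 ≠ 0 → ∀ w, Complex.exp w = q.2 → ∀ t u,
        modelTwo (m + 1) c (fun _ => w + L q) t (straighten X L q)
            (fderiv ℂ (straighten X L) q u) =
          s * ((q.2 ^ (m + 1))⁻¹ * χ q u - w * ψ q u + t * ψ q u) := by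
  have happ : ∀ {φ : C2 → C2 →L[ℂ] ℂ} (v : C2), AnalyticOnNhd ℂ φ (ball 0 ρ) →
      AnalyticOnNhd ℂ (fun q => φ q v) (ball 0 ρ) := fun v h q hq =>
    analyticAt_clm_apply (h q hq) analyticAt_const
  have h0 : (0 : C2) ∈ ball (0 : C2) ρ := mem_ball_self hρ
  obtain ⟨p, hp, hpχ⟩ := exists_eq_snd_smul isOpen_ball (happ (1, 0) hχ) (fun q hq hq2 => by
    rw [show q = (q.1, 0) from Prod.ext rfl hq2]
    exact hχ0 q.1 (by rw [mem_ball_zero_iff] at hq ⊢; exact (norm_fst_le q).trans_lt hq))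
  simp only [smul_eq_mul] at hpχ
  have hpd : ∀ q ∈ ball (0 : C2) ρ, ∀ u, fderiv ℂ χ q u (1, 0) =
      u.2 * p q + q.2 * fderiv ℂ p q u := by
    intro q hq u
    rw [← fderiv_snd_mul (hp q hq), ← fderiv_apply_const (hχ q hq)]
    have : (fun q => χ q (1, 0)) =ᶠ[𝓝 q] fun q => q.2 * p q := by
      filter_upwards [isOpen_ball.mem_nhds hq] with q' hq' using hpχ q' hq'
    rw [this.fderiv_eq]
  -- In this case ω_∞ = ψ is holomorphic and closed, so ω_∞ = dX₀.
  obtain ⟨X₀, hX₀, hX₀0, hX₀d⟩ := exists_primitive (happ (1, 0) hψ) (happ (0, 1) hψ)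
    (snd_mul_cancel (AnalyticOnNhd.continuousOn_fderiv_apply (happ (1, 0) hψ) (0, 1))
      (AnalyticOnNhd.continuousOn_fderiv_apply (happ (0, 1) hψ) (1, 0)) fun q hq => by
        rw [fderiv_apply_const (hψ q hq), fderiv_apply_const (hψ q hq), dψ q hq])
  have hX₀u : ∀ q ∈ ball (0 : C2) ρ, ∀ u, fderiv ℂ X₀ q u = ψ q u := fun q hq u => by
    rw [clm_apply_eq (ψ q), clm_apply_eq (fderiv ℂ X₀ q), (hX₀d q hq).1, (hX₀d q hq).2]
  have hpow : AnalyticOnNhd ℂ (fun q : C2 => q.2 ^ m) (ball 0 ρ) := fun q _ => analyticAt_snd.pow m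
  have hqa : AnalyticOnNhd ℂ (fun q : C2 => χ q (0, 1) + q.2 ^ m * X₀ q) (ball 0 ρ) :=
    fun q hq => (happ (0, 1) hχ q hq).add ((hpow q hq).mul (hX₀ q hq))
  -- The form ω_0 + d(w X₀) = y^{-(m+1)} χ + X₀ dy / y is single-valued and closed. It equals
  -- d(y^{-m} H) + c dy / y.
  obtain ⟨c, H, hH, hHd⟩ := exists_primitive_neg m hp hqa (snd_mul_cancel
    ((continuous_snd.continuousOn.mul (AnalyticOnNhd.continuousOn_fderiv_apply hp (0, 1))).sub
      (continuousOn_const.mul hp.continuousOn))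
    (AnalyticOnNhd.continuousOn_fderiv_apply hqa (1, 0)) fun q hq => by
      have e1 := dχ q hq
      have e2 := hpχ q hq
      rw [hpd q hq, e2] at e1
      have hd : HasFDerivAt (fun q : C2 => χ q (0, 1) + q.2 ^ m * X₀ q) _ q :=
        (happ (0, 1) hχ q hq).differentiableAt.hasFDerivAt.add
          (((hasFDerivAt_snd (𝕜 := ℂ) (p := q)).pow m).mul
            (hX₀ q hq).differentiableAt.hasFDerivAt)
      have hdu : fderiv ℂ (fun q : C2 => χ q (0, 1) + q.2 ^ m * X₀ q) q (1, 0) =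
          fderiv ℂ χ q (1, 0) (0, 1) + q.2 ^ m * ψ q (1, 0) := by
        rw [hd.fderiv, ← fderiv_apply_const (hχ q hq), ← hX₀u q hq]
        simp
      rw [hdu]
      linear_combination -e1)
  have hHu : ∀ q ∈ ball (0 : C2) ρ, ∀ u, q.2 * fderiv ℂ H q u =
      χ q u + u.2 * (m * H q + q.2 ^ m * (X₀ q - c)) := by
    intro q hq u
    obtain ⟨e1, e2⟩ := hHd q hq
    rw [clm_apply_eq (fderiv ℂ H q), e1, clm_apply_eq (χ q), hpχ q hq]
    linear_combination u.2 * e2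
  -- Rescaling the pencil by s, together with X = s X₀, normalises the residue to 0 or 1.
  obtain ⟨s, c', hs, hc', hcs⟩ : ∃ s c' : ℂ, s ≠ 0 ∧ (c' = 0 ∨ c' = 1) ∧ c' = s * c := by
    by_cases hc : c = 0
    · exact ⟨1, 0, one_ne_zero, Or.inl rfl, by simp [hc]⟩
    · exact ⟨c⁻¹, 1, inv_ne_zero hc, Or.inr rfl, (inv_mul_cancel₀ hc).symm⟩
  have hXa : AnalyticOnNhd ℂ (fun q => s * X₀ q) (ball 0 ρ) := analyticOnNhd_const.mul hX₀
  have hXu : ∀ q ∈ ball (0 : C2) ρ, ∀ u, fderiv ℂ (fun q => s * X₀ q) q u = s * ψ q u := by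
    intro q hq u
    rw [fderiv_const_mul (hX₀ q hq).differentiableAt, ← hX₀u q hq]; rfl
  have hXx : fderiv ℂ (fun q => s * X₀ q) 0 (1, 0) ≠ 0 := by
    rw [hXu 0 h0]; exact mul_ne_zero hs hψ1
  -- When n = m + 1 = 1, the term dY / Y^n of the model is itself logarithmic and raises the residue
  -- by one. The residue is nonzero because χ(∂y) ≠ 0 at the origin, so it is normalised to 1 and
  -- the model has constant 0. The equation for L is then linear: (1 - X) L = s H.
  rcases Nat.eq_zero_or_pos m with rfl | hm
  · have hc : c ≠ 0 := by
      intro hc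
      have := hHu 0 h0 (0, 1)
      simp [hc, hX₀0] at this
      exact hχ1 this.symm
    have hc1 : c' = 1 := hc'.resolve_left (by rw [hcs]; exact mul_ne_zero hs hc)
    have hne : ∀ᶠ q in 𝓝 (0 : C2), q ∈ ball (0 : C2) ρ ∧ 1 - s * X₀ q ≠ 0 := by
      refine Filter.eventually_and.2 ⟨isOpen_ball.mem_nhds h0, ?_⟩
      have : ContinuousAt (fun q => 1 - s * X₀ q) 0 :=
        continuousAt_const.sub (hXa 0 h0).continuousAt
      exact this.eventually_ne (by simp [hX₀0])
    have hLa : ∀ q ∈ ball (0 : C2) ρ, 1 - s * X₀ q ≠ 0 →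
        AnalyticAt ℂ (fun q => s * H q / (1 - s * X₀ q)) q := fun q hq hq1 =>
      (analyticAt_const.mul (hH q hq)).div (analyticAt_const.sub (hXa q hq)) hq1
    refine ⟨0, s, fun q => s * X₀ q, fun q => s * H q / (1 - s * X₀ q), Or.inl rfl, hs, hXa 0 h0,
      hLa 0 h0 (by simp [hX₀0]), by simp [hX₀0], hXx, ?_⟩
    filter_upwards [hne, hne.eventually_nhds] with q ⟨hq, hq1⟩ hev hq2 w hw t u
    have hid : (fun q => (s * H q / (1 - s * X₀ q)) * (1 - s * X₀ q)) =ᶠ[𝓝 q] fun q => s * H q := by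
      filter_upwards [hev] with q' hq'
      rw [div_mul_cancel₀ _ hq'.2]
    set L : C2 → ℂ := fun q => s * H q / (1 - s * X₀ q)
    have hLq : AnalyticAt ℂ L q := hLa q hq hq1
    have hd : HasFDerivAt (fun q => L q * (1 - s * X₀ q)) _ q :=
      hLq.differentiableAt.hasFDerivAt.mul
        ((hXa q hq).differentiableAt.hasFDerivAt.const_sub (1 : ℂ))
    have e1 : fderiv ℂ L q u * (1 - s * X₀ q) - L q * (s * ψ q u) = s * fderiv ℂ H q u := by
      have h1 := hid.fderiv_eq (𝕜 := ℂ)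
      rw [fderiv_const_mul (hH q hq).differentiableAt] at h1
      have h2 := congrArg (fun T : C2 →L[ℂ] ℂ => T u) (hd.fderiv.symm.trans h1)
      simp only [add_apply, smul_apply, neg_apply, smul_eq_mul, hXu q hq] at h2
      linear_combination h2
    have e2 := hHu q hq u
    rw [modelTwo_apply, fderiv_straighten (hXa q hq) hLq, hXu q hq]
    simp only [straighten]
    have he := Complex.exp_ne_zero (L q)
    rw [hc1] at hcs
    have k2 : ∀ a b, b / (q.2 * Complex.exp (L q)) * (Complex.exp (L q) * a) = b * a / q.2 :=
      fun a b => by field_simp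
    simp only [CharP.cast_eq_zero, zero_mul, zero_add, pow_zero, pow_one, one_mul] at e2 ⊢
    rw [k2, k2]
    have k3 : q.2 * q.2⁻¹ = 1 := mul_inv_cancel₀ hq2
    have k4 : ∀ a, q.2 * (a / q.2) = a := fun a => by field_simp
    refine mul_left_cancel₀ hq2 ?_
    have k5 := k4 ((0 - s * X₀ q) * (u.2 + q.2 * fderiv ℂ L q u))
    have k6 := k4 (1 * (u.2 + q.2 * fderiv ℂ L q u))
    linear_combination q.2 * e1 + s * e2 + u.2 * hcs + k5 + k6 - s * χ q u * k3
  -- For m > 0, the terms -L dX + (c' - X) dL arising from ln Y = w + L combine into d((c' - X) L).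
  -- Equating primitives and multiplying by y^m gives s H + e^{-mL} / m - (c' - X) y^m L = 0.
  · obtain ⟨L, hL, hLe⟩ := exists_implicit (H := fun q => s * H q)
      (P := fun q => (c' - s * X₀ q) * q.2 ^ m) (analyticAt_const.mul (hH 0 h0))
      ((analyticAt_const.sub (hXa 0 h0)).mul (analyticAt_snd.pow m)) m hm.ne' (by
        refine mul_ne_zero hs fun hH0 => hχ1 ?_
        have := hHu 0 h0 (0, 1)
        simp [hH0, hm.ne'] at this
        exact this.symm) (by simp [hm.ne'])
    refine ⟨c', s, fun q => s * X₀ q, L, hc', hs, hXa 0 h0, hL, by simp [hX₀0], hXx, ?_⟩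
    filter_upwards [isOpen_ball.mem_nhds h0, hLe, hLe.eventually_nhds, hL.eventually_analyticAt]
      with q hq e0 hev hLq hq2 w hw t u
    have hd : HasFDerivAt (fun q => s * H q + Complex.exp (-(m * L q)) * (m : ℂ)⁻¹ -
        (c' - s * X₀ q) * q.2 ^ m * L q) _ q :=
      (((hH q hq).differentiableAt.hasFDerivAt.const_mul s).add
        ((hLq.differentiableAt.hasFDerivAt.const_mul (m : ℂ)).fun_neg.cexp.mul_const
          (m : ℂ)⁻¹)).sub
        (((((hXa q hq).differentiableAt.hasFDerivAt).const_sub c').mul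
          ((hasFDerivAt_snd (𝕜 := ℂ) (p := q)).pow m)).mul hLq.differentiableAt.hasFDerivAt)
    have hm' : (m : ℂ) ≠ 0 := by exact_mod_cast hm.ne'
    have e1 : s * fderiv ℂ H q u - Complex.exp (-(m * L q)) * fderiv ℂ L q u +
        s * ψ q u * q.2 ^ m * L q - (c' - s * X₀ q) * (m * q.2 ^ m / q.2 * u.2 * L q +
          q.2 ^ m * fderiv ℂ L q u) = 0 := by
      have h1 : fderiv ℂ (fun q => s * H q + Complex.exp (-(m * L q)) * (m : ℂ)⁻¹ -
        (c' - s * X₀ q) * q.2 ^ m * L q) q = 0 := by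
        have : (fun q => s * H q + Complex.exp (-(m * L q)) * (m : ℂ)⁻¹ -
          (c' - s * X₀ q) * q.2 ^ m * L q) =ᶠ[𝓝 q] fun _ => 0 := hev
        rw [this.fderiv_eq]; simp
      have h2 := congrArg (fun T : C2 →L[ℂ] ℂ => T u) (hd.fderiv.symm.trans h1)
      have h3 : (m : ℂ) * q.2 ^ m / q.2 = m * q.2 ^ (m - 1) := by
        obtain ⟨k, rfl⟩ := Nat.exists_eq_succ_of_ne_zero hm.ne'
        rw [Nat.succ_eq_add_one, pow_succ]; field_simp; simp
      rw [h3]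
      simp only [sub_apply, add_apply, smul_apply, neg_apply, smul_eq_mul, hXu q hq,
        ContinuousLinearMap.coe_snd'] at h2
      simp at h2
      field_simp at h2
      linear_combination h2
    have e2 := hHu q hq u
    rw [modelTwo_apply, fderiv_straighten (hXa q hq) hLq, hXu q hq]
    simp only [straighten]
    have he := Complex.exp_ne_zero (L q)
    have hee : Complex.exp (-(m * L q)) = (Complex.exp (L q) ^ m)⁻¹ := by
      rw [Complex.exp_neg, Complex.exp_nat_mul]
    have hdiv : (m : ℂ) * q.2 ^ m / q.2 * q.2 = m * q.2 ^ m := by field_simp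
    have hD : Complex.exp (-(m * L q)) / m * m = Complex.exp (-(m * L q)) := by field_simp
    have k1 : ∀ a, 1 / (q.2 * Complex.exp (L q)) ^ (m + 1) * (Complex.exp (L q) * a) =
        (q.2 ^ (m + 1))⁻¹ * Complex.exp (-(m * L q)) * a := fun a => by
      rw [hee]; field_simp; ring
    have k2 : ∀ a b, b / (q.2 * Complex.exp (L q)) * (Complex.exp (L q) * a) = b * a / q.2 :=
      fun a b => by field_simp
    rw [k1, k2]
    have hy : q.2 ^ (m + 1) ≠ 0 := pow_ne_zero _ hq2
    have k3 : (q.2 ^ (m + 1)) * (q.2 ^ (m + 1))⁻¹ = 1 := mul_inv_cancel₀ hy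
    have k4 : ∀ a, q.2 ^ (m + 1) * (a / q.2) = q.2 ^ m * a := fun a => by
      field_simp; ring
    refine mul_left_cancel₀ hy ?_
    have k5 := k4 ((c' - s * X₀ q) * (u.2 + q.2 * fderiv ℂ L q u))
    linear_combination (-q.2) * e1 + s * e2 + u.2 * m * e0 + u.2 * q.2 ^ m * hcs - u.2 * hD -
      (c' - s * X₀ q) * u.2 * L q * hdiv + k5 +
      (Complex.exp (-(m * L q)) * (u.2 + q.2 * fderiv ℂ L q u) - s * χ q u) * k3

/-- Near a point of the polar divisor with parabolic monodromy, suitable coordinates `(X, y e^L)`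
transform one of the models into a pencil of parallel forms. -/
theorem exists_normal_form {Γ : ConnForm} {A B : C2 → End2} {F : C2 → End2} {l : ℂ} (hρ : 0 < ρ)
    (h : LogConnection Γ (ball 0 ρ) A B) (hb : BoundedCoeff ρ A B) (hl : l ≠ 0)
    (hF : IsFundamental F A B ρ (jordan l)) :
    ∃ (s : ℂ) (X L : C2 → ℂ) (η : (ℂ → ℂ) → ℂ → OneForm), s ≠ 0 ∧ AnalyticAt ℂ X 0 ∧
      AnalyticAt ℂ L 0 ∧ X 0 = 0 ∧ fderiv ℂ X 0 (1, 0) ≠ 0 ∧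
      ((∃ n : ℕ, η = modelOne n) ∨
        ∃ n : ℕ, 0 < n ∧ ∃ c : ℂ, (c = 0 ∨ c = 1) ∧ η = modelTwo n c) ∧
      ∀ᶠ q in 𝓝 (0 : C2), ∀ w, Complex.exp w = q.2 → ∀ t u,
        η (fun _ => w + L q) t (straighten X L q) (fderiv ℂ (straighten X L) q u) =
          s * ((F (q.1, w) u).2 + t * (F (q.1, w) u).1) := by
  obtain ⟨k, j, n, ψ, χ, hψ, hχ, h1, h2, dψ, dχ, hcase⟩ := hF.exists_cases hρ h hb hl
  have h1' : ∀ q ∈ ball (0 : C2) ρ, ∀ w, Complex.exp w = q.2 → ∀ u,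
      (F (q.1, w) u).1 = Complex.exp (k * w) * ψ q u ∧
      (F (q.1, w) u).2 = Complex.exp (j * w) * χ q u - w * (Complex.exp (k * w) * ψ q u) := by
    intro q hq w hw u
    have hz : expMap (q.1, w) = q := Prod.ext rfl hw
    have hzc : (q.1, w) ∈ cover ρ := (expMap_mem_ball_iff hρ).1 (by rw [hz]; exact hq)
    have e1 := congrArg (fun T : C2 →L[ℂ] ℂ => T u) (h1 _ hzc)
    have e2 := congrArg (fun T : C2 →L[ℂ] ℂ => T u) (h2 _ hzc)
    simp [hz] at e1 e2
    exact ⟨e1, by rw [e2, e1]⟩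
  have h0 : (0 : C2) ∈ ball (0 : C2) ρ := mem_ball_self hρ
  rcases hcase with ⟨rfl, rfl, hψ0, hχ1, hψ1⟩ | ⟨hn, rfl, rfl, hχ0, hψ1, hχ1⟩
  · obtain ⟨X, L, hX, hL, hX0, hXx, hev⟩ := exists_normal_form_one hρ n hψ hχ dψ
      (by simpa using dχ) hψ0 hχ1 hψ1
    refine ⟨1, X, L, modelOne n, one_ne_zero, hX, hL, hX0, hXx, Or.inl ⟨n, rfl⟩, ?_⟩
    filter_upwards [hev, isOpen_ball.mem_nhds h0] with q hq hqb w hw t u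
    obtain ⟨e1, e2⟩ := h1' q hqb w hw u
    rw [hq (hw ▸ Complex.exp_ne_zero w) w hw, e1, e2, Complex.exp_nat_mul, hw]
    simp
  · obtain ⟨m, rfl⟩ : ∃ m, n = m + 1 := ⟨n - 1, by omega⟩
    obtain ⟨c, s, X, L, hc, hs, hX, hL, hX0, hXx, hev⟩ := exists_normal_form_two hρ m hψ hχ
      (by simpa using dψ) (fun q hq => by rw [dχ q hq]; push_cast; ring) hχ0 hψ1 hχ1
    refine ⟨s, X, L, modelTwo (m + 1) c, hs, hX, hL, hX0, hXx,
      Or.inr ⟨m + 1, hn, c, hc, rfl⟩, ?_⟩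
    filter_upwards [hev, isOpen_ball.mem_nhds h0] with q hq hqb w hw t u
    obtain ⟨e1, e2⟩ := h1' q hqb w hw u
    rw [hq (hw ▸ Complex.exp_ne_zero w) w hw, e1, e2, neg_mul, Complex.exp_neg,
      Complex.exp_nat_mul, hw]
    simp

end LogAffine

end

/-! ### Changes of coordinates on the surface and parallel forms. -/

noncomputable section
open Set Metric
namespace LogAffine

section Charts

variable {S : Type*} [TopologicalSpace S] [ChartedSpace C2 S]

lemma mem_contDiffGroupoid_of_analytic {g : OpenPartialHomeomorph C2 C2}
    (h1 : AnalyticOnNhd ℂ g g.source) (h2 : AnalyticOnNhd ℂ g.symm g.target) :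
    g ∈ contDiffGroupoid ω 𝓘(ℂ, C2) := by
  rw [contDiffGroupoid, mem_groupoid_of_pregroupoid]
  constructor
  · simpa [contDiffPregroupoid] using h1.contDiffOn (n := ω) g.open_source.uniqueDiffOn
  · simpa [contDiffPregroupoid] using h2.contDiffOn (n := ω) g.open_target.uniqueDiffOn

lemma analyticOnNhd_of_mem_contDiffGroupoid {g : OpenPartialHomeomorph C2 C2}
    (h : g ∈ contDiffGroupoid ω 𝓘(ℂ, C2)) : AnalyticOnNhd ℂ g g.source := by
  rw [contDiffGroupoid, mem_groupoid_of_pregroupoid] at h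
  have h1 : ContDiffOn ℂ ω g g.source := by simpa [contDiffPregroupoid] using h.1
  exact fun q hq => (h1.contDiffAt (g.open_source.mem_nhds hq)).analyticAt

variable [IsManifold 𝓘(ℂ, C2) ω S]

lemma IsCoord.analyticAt_transition {e e' : OpenPartialHomeomorph S C2} (he : IsCoord e)
    (he' : IsCoord e') {q : C2} (hq : q ∈ e.target) (hq' : e.symm q ∈ e'.source) :
    AnalyticAt ℂ (e' ∘ e.symm) q :=
  analyticOnNhd_of_mem_contDiffGroupoid
    (StructureGroupoid.compatible_of_mem_maximalAtlas he he') q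
    (by rw [OpenPartialHomeomorph.trans_source]; exact ⟨hq, hq'⟩)

lemma IsCoord.trans {e : OpenPartialHomeomorph S C2} (he : IsCoord e)
    {g : OpenPartialHomeomorph C2 C2} (hg : g ∈ contDiffGroupoid ω 𝓘(ℂ, C2)) :
    IsCoord (e.trans g) := by
  intro e' he'
  obtain ⟨h1, h2⟩ := he e' he'
  constructor
  · rw [OpenPartialHomeomorph.trans_symm_eq_symm_trans_symm, OpenPartialHomeomorph.trans_assoc]
    exact (contDiffGroupoid ω 𝓘(ℂ, C2)).trans ((contDiffGroupoid ω 𝓘(ℂ, C2)).symm hg) h1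
  · rw [← OpenPartialHomeomorph.trans_assoc]
    exact (contDiffGroupoid ω 𝓘(ℂ, C2)).trans h2 hg

lemma IsCoord.fderiv_transition_comp {e e' : OpenPartialHomeomorph S C2} (he : IsCoord e)
    (he' : IsCoord e') {q : C2} (hq : q ∈ e.target) (hq' : e.symm q ∈ e'.source) (v : C2) :
    fderiv ℂ (e ∘ e'.symm) (e' (e.symm q)) (fderiv ℂ (e' ∘ e.symm) q v) = v := by
  have h1 := (he.analyticAt_transition he' hq hq').differentiableAt.hasFDerivAt
  have hq2 : e'.symm (e' (e.symm q)) = e.symm q := e'.left_inv hq'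
  have h2 := (he'.analyticAt_transition he (e'.map_source hq')
    (by rw [hq2]; exact e.map_target hq)).differentiableAt.hasFDerivAt
  have h3 := h2.comp q h1
  have h4 : (e ∘ e'.symm) ∘ e' ∘ e.symm =ᶠ[𝓝 q] id := by
    have : ∀ᶠ q in 𝓝 q, q ∈ e.target ∧ e.symm q ∈ e'.source :=
      Filter.eventually_and.2 ⟨e.open_target.mem_nhds hq,
        (e.continuousAt_symm hq).eventually_mem (e'.open_source.mem_nhds hq')⟩
    filter_upwards [this] with q' ⟨h5, h6⟩
    simp [e'.left_inv h6, e.right_inv h5]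
  have h5 := (h3.congr_of_eventuallyEq h4.symm).unique (hasFDerivAt_id q)
  exact congrArg (fun T : C2 →L[ℂ] C2 => T v) h5

/-- New coordinates from a local biholomorphism. -/
lemma IsCoord.exists_trans {e : OpenPartialHomeomorph S C2} (he : IsCoord e) {x : S}
    (hx : x ∈ e.source) {Ψ : C2 → C2} (hΨ : AnalyticAt ℂ Ψ (e x))
    {T : C2 ≃L[ℂ] C2} (hT : HasFDerivAt Ψ (T : C2 →L[ℂ] C2) (e x)) {P : C2 → Prop}
    (hP : ∀ᶠ q in 𝓝 (e x), P q) :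
    ∃ e' : OpenPartialHomeomorph S C2, IsCoord e' ∧ x ∈ e'.source ∧
      ∀ y ∈ e'.source, y ∈ e.source ∧ e' y = Ψ (e y) ∧ P (e y) := by
  have hc : ContDiffAt ℂ ω Ψ (e x) := hΨ.contDiffAt
  set g := hc.toOpenPartialHomeomorph Ψ hT (by simp) with hg
  have hgx : e x ∈ g.source := hc.mem_toOpenPartialHomeomorph_source hT (by simp)
  have hgc : (g : C2 → C2) = Ψ := rfl
  have hinv : AnalyticAt ℂ g.symm (Ψ (e x)) := (hc.to_localInverse hT (by simp)).analyticAt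
  obtain ⟨U, hU, hUo, hxU⟩ := _root_.eventually_nhds_iff.1 (hP.and hΨ.eventually_analyticAt)
  obtain ⟨V, hV, hVo, hxV⟩ := _root_.eventually_nhds_iff.1 hinv.eventually_analyticAt
  -- The inverse-function chart is shrunk until it and its inverse are analytic and P holds
  -- throughout.
  set W : Set C2 := U ∩ (g.source ∩ g ⁻¹' V) with hW
  have hWo : IsOpen W := hUo.inter (g.isOpen_inter_preimage hVo)
  have hgm : g.restr W ∈ contDiffGroupoid ω 𝓘(ℂ, C2) := by
    refine mem_contDiffGroupoid_of_analytic (fun q hq => ?_) (fun q hq => ?_)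
    · rw [g.restr_source' W hWo] at hq
      exact (hU q hq.2.1).2
    · have h1 := (g.restr W).map_target hq
      rw [g.restr_source' W hWo] at h1
      have h2 : (g.restr W) ((g.restr W).symm q) = q := (g.restr W).right_inv hq
      have h3 : g ((g.restr W).symm q) = q := h2
      have h4 := h1.2.2.2
      rw [mem_preimage, h3] at h4
      exact hV q h4
  refine ⟨e.trans (g.restr W), he.trans hgm, ?_, fun y hy => ?_⟩
  · rw [OpenPartialHomeomorph.trans_source, g.restr_source' W hWo]
    exact ⟨hx, hgx, hxU, hgx, hxV⟩
  · rw [OpenPartialHomeomorph.trans_source, g.restr_source' W hWo] at hy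
    exact ⟨hy.1, rfl, (hU _ hy.2.2.1).1⟩

end Charts

section Parallel

variable {S : Type*} [TopologicalSpace S] [ChartedSpace C2 S] [IsManifold 𝓘(ℂ, C2) ω S]
variable (A : MeromorphicAffineStructure S)

/-- A form whose pullback by a change of coordinates is parallel is parallel. -/
lemma MeromorphicAffineStructure.isParallelAt_of_pullback {e e' : OpenPartialHomeomorph S C2}
    (he : IsCoord e) (he' : IsCoord e') {q : C2} (hq : q ∈ e.target)
    (hq' : e.symm q ∈ e'.source) (hpol : e.symm q ∉ A.polar) {η η' : OneForm}
    (hη : IsParallelAt (A.christoffel e) η q) (hη' : DifferentiableAt ℂ η' (e' (e.symm q)))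
    (h : ∀ᶠ p in 𝓝 q, η p = η' ((e' ∘ e.symm) p) ∘L fderiv ℂ (e' ∘ e.symm) p) :
    IsParallelAt (A.christoffel e') η' (e' (e.symm q)) := by
  refine ⟨hη', fun v w => ?_⟩
  set φ := e' ∘ e.symm with hφ
  have hφa : AnalyticAt ℂ φ q := he.analyticAt_transition he' hq hq'
  have hsurj : ∀ v, ∃ v', fderiv ℂ φ q v' = v := fun v => by
    refine ⟨fderiv ℂ (e ∘ e'.symm) (e' (e.symm q)) v, ?_⟩
    have := he'.fderiv_transition_comp he (q := e' (e.symm q)) (e'.map_source hq')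
      (by rw [e'.left_inv hq']; exact e.map_target hq) v
    rwa [e'.left_inv hq', e.right_inv hq] at this
  obtain ⟨v, rfl⟩ := hsurj v
  obtain ⟨w, rfl⟩ := hsurj w
  have hη'' : HasFDerivAt η' (fderiv ℂ η' (φ q)) (φ q) := hη'.hasFDerivAt
  have h1 := hasFDerivAt_clm_comp_apply (hη''.comp q hφa.differentiableAt.hasFDerivAt)
    hφa.fderiv.differentiableAt.hasFDerivAt h v w
  have h2 := hη.2 v w
  have h4 : fderiv ℂ φ q (A.christoffel e q v w) = _ := A.change e e' he he' q hq hq' hpol v w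
  have h5 : (η' (φ q) ∘L fderiv ℂ φ q) (A.christoffel e q v w) =
    η' (φ q) (fderiv ℂ φ q (A.christoffel e q v w)) := rfl
  -- The second derivative of the change of coordinates appears both in the derivative of the
  -- pullback and in the transformation rule of the Christoffel symbols, and cancels.
  rw [h1, h.self_of_nhds, h5, h4, map_add] at h2
  have h3 : fderiv ℂ η' (φ q) (fderiv ℂ φ q v) (fderiv ℂ φ q w) +
      η' (φ q) (fderiv ℂ (fderiv ℂ φ) q v w) = _ := h2
  rw [add_comm] at h3
  exact add_left_cancel h3

end Parallel

end LogAffine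

end

/-! ### A logarithmic structure has a simple pole A dx + B dy / y in adapted coordinates. -/

noncomputable section
open Set Metric
namespace LogAffine

lemma eventually_forall_mem_of_isCompact {K : Set ℂ} (hK : IsCompact K) {x₀ : ℂ} {p : C2 → Prop}
    (h : ∀ y ∈ K, ∀ᶠ q in 𝓝 ((x₀, y) : C2), p q) : ∀ᶠ x in 𝓝 x₀, ∀ y ∈ K, p (x, y) :=
  hK.eventually_forall_of_forall_eventually fun y hy => h y hy

lemma AnalyticAt.snd_slice {f : C2 → ℂ} {x y : ℂ} (hf : AnalyticAt ℂ f (x, y)) :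
    AnalyticAt ℂ (fun y => f (x, y)) y :=
  AnalyticAt.comp (g := f) (f := fun y => ((x, y) : C2)) hf (analyticAt_const.prod analyticAt_id)

/-- Persistence of the zeros of an analytic function of `y` depending on the parameter `x`. -/
lemma eventually_exists_zero {f : C2 → ℂ} {x₀ y₀ : ℂ} {δ : ℝ} (hδ : 0 < δ)
    (hf : ∀ y ∈ closedBall y₀ δ, AnalyticAt ℂ f (x₀, y)) (h0 : f (x₀, y₀) = 0)
    (hs : ∀ y ∈ sphere y₀ δ, f (x₀, y) ≠ 0) :
    ∀ᶠ x in 𝓝 x₀, ∃ y ∈ ball y₀ δ, f (x, y) = 0 := by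
  have hcs : IsCompact (sphere y₀ δ) := isCompact_sphere _ _
  have hsub : sphere y₀ δ ⊆ closedBall y₀ δ := sphere_subset_closedBall
  obtain ⟨m, hm, hmle⟩ : ∃ m > 0, ∀ y ∈ sphere y₀ δ, m ≤ ‖f (x₀, y)‖ := by
    have hcont : ContinuousOn (fun y => ‖f (x₀, y)‖) (sphere y₀ δ) := fun y hy =>
      (AnalyticAt.snd_slice (hf y (hsub hy))).continuousAt.norm.continuousWithinAt
    obtain ⟨y₁, hy₁, hmin⟩ := hcs.exists_isMinOn (NormedSpace.sphere_nonempty.2 hδ.le) hcont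
    exact ⟨_, norm_pos_iff.2 (hs y₁ hy₁), fun y hy => hmin hy⟩
  have e1 : ∀ᶠ x in 𝓝 x₀, ∀ y ∈ sphere y₀ δ, m / 2 < ‖f (x, y)‖ := by
    refine eventually_forall_mem_of_isCompact (p := fun q => m / 2 < ‖f q‖) hcs fun y hy => ?_
    exact (hf y (hsub hy)).continuousAt.norm.eventually_const_lt
      (by have := hmle y hy; linarith)
  have e2 : ∀ᶠ x in 𝓝 x₀, ∀ y ∈ closedBall y₀ δ, AnalyticAt ℂ f (x, y) :=
    eventually_forall_mem_of_isCompact (isCompact_closedBall _ _) fun y hy =>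
      (hf y hy).eventually_analyticAt
  have e3 : ∀ᶠ x in 𝓝 x₀, ‖f (x, y₀)‖ < m / 2 := by
    have h1 : ContinuousAt (fun x => ‖f (x, y₀)‖) x₀ :=
      ((hf y₀ (mem_closedBall_self hδ.le)).continuousAt.comp (f := fun x => ((x, y₀) : C2))
        (by fun_prop)).norm
    refine h1.eventually_lt_const ?_
    simp only [h0, norm_zero]
    positivity
  filter_upwards [e1, e2, e3] with x hx1 hx2 hx3
  -- Without zeros in the disc, 1 / f(x, ·) would be holomorphic there, and the maximum principle
  -- would bound it at y₀ by 2/m, against |f(x, y₀)| < m/2.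
  by_contra! hne
  have hne' : ∀ y ∈ closedBall y₀ δ, f (x, y) ≠ 0 := by
    intro y hy
    rcases (mem_closedBall.1 hy).lt_or_eq with h | h
    · exact hne y h
    · intro h'
      have := hx1 y h
      rw [h', norm_zero] at this
      linarith
  have hd : DiffContOnCl ℂ (fun y => (f (x, y))⁻¹) (ball y₀ δ) := by
    refine DifferentiableOn.diffContOnCl fun y hy => ?_
    rw [closure_ball _ hδ.ne'] at hy
    exact ((AnalyticAt.snd_slice (hx2 y hy)).inv
      (hne' y hy)).differentiableAt.differentiableWithinAt
  have hle := Complex.norm_le_of_forall_mem_frontier_norm_le isBounded_ball hd (C := (m / 2)⁻¹)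
    (fun y hy => by
      rw [frontier_ball _ hδ.ne'] at hy
      rw [norm_inv]
      exact inv_anti₀ (by positivity) (hx1 y hy).le)
    (subset_closure (mem_ball_self hδ))
  rw [norm_inv] at hle
  have hpos : 0 < ‖f (x, y₀)‖ := norm_pos_iff.2 (hne' y₀ (mem_closedBall_self hδ.le))
  have := (inv_le_inv₀ hpos (by positivity)).1 hle
  linarith

/-- A reduced equation of `y = 0` is the product of `y` and a unit. -/
lemma exists_eq_snd_mul_unit {g : C2 → ℂ} {q₀ : C2} (hg : AnalyticAt ℂ g q₀) (hq₀ : q₀.2 = 0)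
    (hz : ∀ᶠ q in 𝓝 q₀, g q = 0 ↔ q.2 = 0)
    (hred : ∃ᶠ q in 𝓝 q₀, g q = 0 ∧ fderiv ℂ g q ≠ 0) :
    ∃ U : C2 → ℂ, AnalyticAt ℂ U q₀ ∧ U q₀ ≠ 0 ∧ ∀ᶠ q in 𝓝 q₀, g q = q.2 * U q := by
  obtain ⟨ρ, hρ, hb⟩ := Metric.eventually_nhds_iff_ball.1 (hg.eventually_analyticAt.and hz)
  obtain ⟨U, hU, hgU⟩ := exists_eq_snd_smul (f := g) isOpen_ball (fun q hq => (hb q hq).1)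
    (fun q hq hq2 => (hb q hq).2.2 hq2)
  have hq0b : q₀ ∈ ball q₀ ρ := mem_ball_self hρ
  refine ⟨U, hU q₀ hq0b, fun hU0 => ?_, ?_⟩
  swap
  · filter_upwards [isOpen_ball.mem_nhds hq0b] with q hq using hgU q hq
  have hq0 : q₀ = (q₀.1, 0) := Prod.ext rfl hq₀
  have hmem : ∀ y ∈ closedBall (0 : ℂ) (ρ / 2), ((q₀.1, y) : C2) ∈ ball q₀ ρ := by
    intro y hy
    rw [hq0, mem_ball, Prod.dist_eq]
    rw [mem_closedBall] at hy
    simp only [dist_self, sup_lt_iff]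
    exact ⟨hρ, by linarith⟩
  -- If U vanished at q₀, it would have zeros on all nearby vertical lines. Zeros of g lie only on y
  -- = 0, so U would vanish along the axis, and dg with it, contradicting reducedness.
  have hev := eventually_exists_zero (f := U) (half_pos hρ) (fun y hy => hU _ (hmem y hy))
    (by rw [← hq0]; exact hU0) (fun y hy h => by
      have h1 := hmem y (sphere_subset_closedBall hy)
      have h2 := hgU _ h1
      rw [h, smul_zero, (hb _ h1).2] at h2
      have h3 : y = 0 := h2
      rw [h3, mem_sphere, dist_self] at hy
      linarith)
  have hev2 : ∀ᶠ q in 𝓝 q₀, ∃ y ∈ ball (0 : ℂ) (ρ / 2), U (q.1, y) = 0 :=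
    (continuous_fst.tendsto q₀).eventually hev
  refine hred ?_
  filter_upwards [hev2, ball_mem_nhds q₀ (half_pos hρ)] with q ⟨y, hy, hUy⟩ hqb ⟨h1, h2⟩
  apply h2
  have hqb' : q ∈ ball q₀ ρ := ball_subset_ball (by linarith) hqb
  have hq2 : q.2 = 0 := (hb q hqb').2.1 h1
  have hqy : ((q.1, y) : C2) ∈ ball q₀ ρ := by
    rw [hq0, mem_ball, Prod.dist_eq]
    rw [hq0, mem_ball, Prod.dist_eq] at hqb
    rw [mem_ball] at hy
    have := (le_max_left _ _).trans_lt hqb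
    exact max_lt (by simpa using this.trans (by linarith)) (by simpa using hy.trans (by linarith))
  have hy0 : y = 0 := by
    have := hgU _ hqy
    rw [hUy, smul_zero] at this
    exact (hb _ hqy).2.1 this
  have hUq : U q = 0 := by
    rw [show q = (q.1, y) from Prod.ext rfl (hq2.trans hy0.symm)]; exact hUy
  have heq : g =ᶠ[𝓝 q] fun q => q.2 * U q := by
    filter_upwards [isOpen_ball.mem_nhds hqb'] with q' hq' using hgU q' hq'
  refine ContinuousLinearMap.ext fun u => ?_
  rw [heq.fderiv_eq, fderiv_snd_mul (hU q hqb'), hUq, hq2]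
  simp

/-- A 2-form on ℂ² is determined by its value on the standard frame. This is needed because the
logarithmic condition controls f dθ on fixed vectors, whereas a change of coordinates produces
variable ones. -/
lemma extD_eq (Γ : ConnForm) (q a b : C2) :
    extD Γ q a b = (a.1 * b.2 - a.2 * b.1) • extD Γ q (1, 0) (0, 1) := by
  have hdec : ∀ a : C2, a = a.1 • ((1, 0) : C2) + a.2 • ((0, 1) : C2) := fun a => by ext <;> simp
  have hexp : ∀ (M : C2 →L[ℂ] C2 →L[ℂ] C2 →L[ℂ] C2), M a b - M b a =
      (a.1 * b.2 - a.2 * b.1) • (M (1, 0) (0, 1) - M (0, 1) (1, 0)) := by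
    intro M
    have h1 : M a b = a.1 • b.1 • M (1, 0) (1, 0) + a.1 • b.2 • M (1, 0) (0, 1) +
        (a.2 • b.1 • M (0, 1) (1, 0) + a.2 • b.2 • M (0, 1) (0, 1)) := by
      conv_lhs => rw [hdec a, hdec b]
      simp only [map_add, map_smul, add_apply, smul_apply]
      refine ContinuousLinearMap.ext fun u => ?_
      simp only [add_apply, smul_apply]
      module
    have h2 : M b a = b.1 • a.1 • M (1, 0) (1, 0) + b.1 • a.2 • M (1, 0) (0, 1) +
        (b.2 • a.1 • M (0, 1) (1, 0) + b.2 • a.2 • M (0, 1) (0, 1)) := by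
      conv_lhs => rw [hdec a, hdec b]
      simp only [map_add, map_smul, add_apply, smul_apply]
      refine ContinuousLinearMap.ext fun u => ?_
      simp only [add_apply, smul_apply]
      module
    rw [h1, h2]
    refine ContinuousLinearMap.ext fun u => ?_
    simp only [add_apply, smul_apply, sub_apply]
    module
  exact hexp _

lemma fderiv_of_smul_eq {E : Type*} [NormedAddCommGroup E] [NormedSpace ℂ E] {f : C2 → ℂ}
    {Γ G : C2 → E} {r : C2} (hf : DifferentiableAt ℂ f r)
    (hΓ : DifferentiableAt ℂ Γ r) (h : ∀ᶠ q in 𝓝 r, f q • Γ q = G q) (v : C2) :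
    fderiv ℂ G r v = f r • fderiv ℂ Γ r v + fderiv ℂ f r v • Γ r := by
  rw [((hf.hasFDerivAt.smul hΓ.hasFDerivAt).congr_of_eventuallyEq
      (h.mono fun q hq => hq.symm)).fderiv]
  rfl

/-- The identity df ∧ θ = d(fθ) - f dθ. Through it the condition on dθ makes df ∧ θ holomorphic,
which removes the pole from the dx-coefficient. -/
lemma smul_sub_smul_eq_extD {f : C2 → ℂ} {Γ G : ConnForm} {r : C2} (hf : DifferentiableAt ℂ f r)
    (hΓ : DifferentiableAt ℂ Γ r) (h : ∀ᶠ q in 𝓝 r, f q • Γ q = G q) (a b u : C2) :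
    fderiv ℂ f r a • Γ r b u - fderiv ℂ f r b • Γ r a u =
      extD G r a b u - f r • extD Γ r a b u := by
  have h1 : ∀ v w : C2, fderiv ℂ G r v w u =
      f r • fderiv ℂ Γ r v w u + fderiv ℂ f r v • Γ r w u := fun v w =>
    congrArg (fun M : C2 →L[ℂ] C2 →L[ℂ] C2 => M w u)
      (fderiv_of_smul_eq (E := C2 →L[ℂ] C2 →L[ℂ] C2) hf hΓ h v)
  simp only [extD, sub_apply]
  rw [h1, h1]
  module

lemma continuousAt_fderiv_apply {E : Type*} [NormedAddCommGroup E] [NormedSpace ℂ E]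
    [CompleteSpace E] {G : C2 → E} {φ a : C2 → C2} {q : C2} (hG : AnalyticAt ℂ G (φ q))
    (hφ : ContinuousAt φ q) (ha : ContinuousAt a q) :
    ContinuousAt (fun q => fderiv ℂ G (φ q) (a q)) q :=
  (ContinuousAt.comp (g := fderiv ℂ G) (f := φ) hG.fderiv.continuousAt hφ).clm_apply ha

section Adapted

variable {S : Type*} [TopologicalSpace S] [ChartedSpace C2 S] [IsManifold 𝓘(ℂ, C2) ω S]
variable {A : MeromorphicAffineStructure S}

lemma MeromorphicAffineStructure.isOpen_regular_target (e : OpenPartialHomeomorph S C2) :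
    IsOpen {q | q ∈ e.target ∧ e.symm q ∉ A.polar} :=
  e.symm.isOpen_inter_preimage A.isClosed_polar.isOpen_compl

lemma MeromorphicAffineStructure.christoffel_eq {e e' : OpenPartialHomeomorph S C2}
    (he : IsCoord e) (he' : IsCoord e') {q : C2} (hq : q ∈ e.target)
    (hq' : e.symm q ∈ e'.source) (hpol : e.symm q ∉ A.polar) (v w : C2) :
    A.christoffel e q v w = fderiv ℂ (e ∘ e'.symm) (e' (e.symm q))
      (fderiv ℂ (fderiv ℂ (e' ∘ e.symm)) q v w + A.christoffel e' (e' (e.symm q))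
            (fderiv ℂ (e' ∘ e.symm) q v) (fderiv ℂ (e' ∘ e.symm) q w)) := by
  rw [← A.change e e' he he' q hq hq' hpol, he.fderiv_transition_comp he' hq hq']

/-- The reduced equation of the polar divisor in adapted coordinates. -/
lemma exists_unit_of_reduced {e e₁ : OpenPartialHomeomorph S C2} (he : IsCoord e)
    (he₁ : IsCoord e₁) (hdiv : ∀ x ∈ e.source, x ∈ A.polar ↔ (e x).2 = 0) {f : C2 → ℂ}
    (hf : AnalyticOnNhd ℂ f e₁.target) (hz : ∀ q ∈ e₁.target, e₁.symm q ∈ A.polar ↔ f q = 0)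
    {q₀ : C2} (hq₀ : q₀ ∈ e.target) (hq₁ : e.symm q₀ ∈ e₁.source) (h0 : q₀.2 = 0)
    (hred : e₁ (e.symm q₀) ∈ closure {q' | q' ∈ e₁.target ∧ f q' = 0 ∧ fderiv ℂ f q' ≠ 0}) :
    ∃ U : C2 → ℂ, AnalyticAt ℂ U q₀ ∧ U q₀ ≠ 0 ∧
      ∀ᶠ q in 𝓝 q₀, f ((e₁ ∘ e.symm) q) = q.2 * U q := by
  have hφ := he.analyticAt_transition he₁ hq₀ hq₁
  have hq₀' : e.symm (e.symm.symm (e.symm q₀)) = e.symm q₀ := by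
    rw [e.symm_symm, e.right_inv hq₀]
  have hψ : AnalyticAt ℂ (e ∘ e₁.symm) (e₁ (e.symm q₀)) :=
    he₁.analyticAt_transition he (e₁.map_source hq₁)
      (by rw [e₁.left_inv hq₁]; exact e.map_target hq₀)
  refine exists_eq_snd_mul_unit (g := f ∘ (e₁ ∘ e.symm))
    (AnalyticAt.comp (hf _ (e₁.map_source hq₁)) hφ) h0 ?_ ?_
  · filter_upwards [e.open_target.mem_nhds hq₀,
      (e.continuousAt_symm hq₀).eventually_mem (e₁.open_source.mem_nhds hq₁)] with q hq hq'
    rw [Function.comp_apply, Function.comp_apply, ← hz _ (e₁.map_source hq'), e₁.left_inv hq',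
      hdiv _ (e.map_target hq), e.right_inv hq]
  · have ht : Filter.Tendsto (e ∘ e₁.symm) (𝓝 (e₁ (e.symm q₀))) (𝓝 q₀) := by
      have := hψ.continuousAt.tendsto
      rwa [Function.comp_apply, e₁.left_inv hq₁, e.right_inv hq₀] at this
    have hev : ∀ᶠ r in 𝓝 (e₁ (e.symm q₀)), r ∈ e₁.target ∧ e₁.symm r ∈ e.source := by
      refine Filter.eventually_and.2 ⟨e₁.open_target.mem_nhds (e₁.map_source hq₁),
        (e₁.continuousAt_symm (e₁.map_source hq₁)).eventually_mem (e.open_source.mem_nhds ?_)⟩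
      rw [e₁.left_inv hq₁]; exact e.map_target hq₀
    refine ht.frequently ((Filter.Frequently.and_eventually
      (mem_closure_iff_frequently.1 hred) hev).mono ?_)
    rintro r ⟨⟨hr, hr0, hdr⟩, -, hr'⟩
    have hrr : (e₁ ∘ e.symm) ((e ∘ e₁.symm) r) = r := by
      simp [e.left_inv hr', e₁.right_inv hr]
    refine ⟨by rw [Function.comp_apply, hrr, hr0], fun hd => hdr ?_⟩
    have hq : (e ∘ e₁.symm) r ∈ e.target := e.map_source hr'
    have hqs : e.symm ((e ∘ e₁.symm) r) ∈ e₁.source := by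
      rw [Function.comp_apply, e.left_inv hr']; exact e₁.map_target hr
    have hφ' := (he.analyticAt_transition he₁ hq hqs).differentiableAt.hasFDerivAt
    have hf' : HasFDerivAt f (fderiv ℂ f r) ((e₁ ∘ e.symm) ((e ∘ e₁.symm) r)) := by
      rw [hrr]; exact (hf r hr).differentiableAt.hasFDerivAt
    have hc := (hf'.comp _ hφ').fderiv
    rw [hd] at hc
    refine ContinuousLinearMap.ext fun v => ?_
    have h1 := he₁.fderiv_transition_comp he hr hr' v
    have h2 := congrArg (fun T : C2 →L[ℂ] ℂ => T (fderiv ℂ (e ∘ e₁.symm) r v)) hc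
    change 0 = fderiv ℂ f r (fderiv ℂ (e₁ ∘ e.symm) (e (e₁.symm r))
      (fderiv ℂ (e ∘ e₁.symm) r v)) at h2
    rw [h1] at h2
    exact h2.symm

/-- The Christoffel symbols of a logarithmic structure in adapted coordinates. -/
lemma exists_continuousAt_christoffel (hlog : A.IsLogarithmic) {e : OpenPartialHomeomorph S C2}
    (he : IsCoord e) (hdiv : ∀ x ∈ e.source, x ∈ A.polar ↔ (e x).2 = 0) {q₀ : C2}
    (hq₀ : q₀ ∈ e.target) (h0 : q₀.2 = 0) (u : C2) :
    ∃ C₁ C₂ : C2 → C2, ContinuousAt C₁ q₀ ∧ ContinuousAt C₂ q₀ ∧ ∀ᶠ q in 𝓝 q₀, q.2 ≠ 0 →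
      A.christoffel e q (1, 0) u = C₁ q ∧ q.2 • A.christoffel e q (0, 1) u = C₂ q := by
  have hp : e.symm q₀ ∈ A.polar := by
    rw [hdiv _ (e.map_target hq₀), e.right_inv hq₀, h0]
  obtain ⟨e₁, f, G, K, he₁, hpe, hf, hG, hK, hz, hred, hfG, hfK⟩ := hlog _ hp
  have hfa := analyticOnNhd_of_differentiableOn e₁.open_target hf
  have hGa := analyticOnNhd_of_differentiableOn (E := C2 →L[ℂ] C2 →L[ℂ] C2)
    e₁.open_target hG
  set φ : C2 → C2 := e₁ ∘ e.symm with hφdef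
  have hφ : AnalyticAt ℂ φ q₀ := he.analyticAt_transition he₁ hq₀ hpe
  have hr₀ : φ q₀ ∈ e₁.target := e₁.map_source hpe
  have hfr₀ : f (φ q₀) = 0 := (hz _ hr₀).1 (by
    rw [hφdef, Function.comp_apply, e₁.left_inv hpe]; exact hp)
  obtain ⟨U, hU, hU0, hUeq⟩ := exists_unit_of_reduced he he₁ hdiv hfa hz hq₀ hpe h0
    (hred _ hr₀ hfr₀)
  have hψ : AnalyticAt ℂ (e ∘ e₁.symm) (φ q₀) :=
    he₁.analyticAt_transition he hr₀ (by
      rw [hφdef, Function.comp_apply, e₁.left_inv hpe]; exact e.map_target hq₀)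
  set T : C2 → C2 →L[ℂ] C2 := fun q => fderiv ℂ (e ∘ e₁.symm) (φ q) with hT
  have hTc : ContinuousAt T q₀ :=
    ContinuousAt.comp (g := fderiv ℂ (e ∘ e₁.symm)) (f := φ) hψ.fderiv.continuousAt
      hφ.continuousAt
  have hφ1 : ∀ v : C2, ContinuousAt (fun q => fderiv ℂ φ q v) q₀ := fun v =>
    hφ.fderiv.continuousAt.clm_apply continuousAt_const
  have hφ2 : ∀ v w : C2, ContinuousAt (fun q => fderiv ℂ (fderiv ℂ φ) q v w) q₀ := fun v w =>
    (hφ.fderiv.fderiv.continuousAt.clm_apply continuousAt_const).clm_apply continuousAt_const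
  have hGc : ContinuousAt (fun q => G (φ q)) q₀ :=
    ContinuousAt.comp (g := G) (f := φ) (hGa _ hr₀).continuousAt hφ.continuousAt
  have hdGc : ∀ a : C2 → C2, ContinuousAt a q₀ →
      ContinuousAt (fun q => fderiv ℂ G (φ q) (a q)) q₀ := fun a ha =>
    continuousAt_fderiv_apply (E := C2 →L[ℂ] C2 →L[ℂ] C2) (hGa _ hr₀) hφ.continuousAt ha
  have hdfc : ContinuousAt (fun q => fderiv ℂ f (φ q)) q₀ :=
    ContinuousAt.comp (g := fderiv ℂ f) (f := φ) (hfa.fderiv _ hr₀).continuousAt hφ.continuousAt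
  have hfc : ContinuousAt (fun q => f (φ q)) q₀ :=
    ContinuousAt.comp (g := f) (f := φ) (hfa _ hr₀).continuousAt hφ.continuousAt
  have hKc : ContinuousAt (fun q => K (φ q) (1, 0) (0, 1)) q₀ :=
    ContinuousAt.comp (g := fun r => K r (1, 0) (0, 1)) (f := φ)
      ((hK (1, 0) (0, 1)).differentiableAt (e₁.open_target.mem_nhds hr₀)).continuousAt
      hφ.continuousAt
  set a : C2 → C2 := fun q => fderiv ℂ φ q (1, 0) with ha
  set b : C2 → C2 := fun q => fderiv ℂ φ q (0, 1) with hb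
  set Cg : C2 → C2 → C2 := fun v q => T q (f (φ q) • fderiv ℂ (fderiv ℂ φ) q v u +
    G (φ q) (fderiv ℂ φ q v) (fderiv ℂ φ q u)) with hCg
  -- The value of df ∧ θ on the pair (∂y, ∂x) in adapted coordinates, including the inhomogeneous
  -- terms of the change of coordinates.
  set C₃ : C2 → C2 := fun q => T q (fderiv ℂ f (φ q) (b q) • fderiv ℂ (fderiv ℂ φ) q (1, 0) u -
    fderiv ℂ f (φ q) (a q) • fderiv ℂ (fderiv ℂ φ) q (0, 1) u +
    (fderiv ℂ G (φ q) (b q) (a q) (fderiv ℂ φ q u) - fderiv ℂ G (φ q) (a q) (b q) (fderiv ℂ φ q u) -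
      ((b q).1 * (a q).2 - (b q).2 * (a q).1) • K (φ q) (1, 0) (0, 1) (fderiv ℂ φ q u))) with hC₃
  have hCgc : ∀ v, ContinuousAt (Cg v) q₀ := fun v => hTc.clm_apply
    ((hfc.smul (hφ2 v u)).add ((hGc.clm_apply (hφ1 v)).clm_apply (hφ1 u)))
  have hac : ContinuousAt a q₀ := hφ1 _
  have hbc : ContinuousAt b q₀ := hφ1 _
  have hC₃c : ContinuousAt C₃ q₀ := by
    have hdet : ContinuousAt (fun q => (b q).1 * (a q).2 - (b q).2 * (a q).1) q₀ :=
      (hbc.fst.mul hac.snd).sub (hbc.snd.mul hac.fst)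
    exact hTc.clm_apply ((((hdfc.clm_apply hbc).smul (hφ2 _ u)).sub
      ((hdfc.clm_apply hac).smul (hφ2 _ u))).add
      (((((hdGc b hbc).clm_apply hac).clm_apply (hφ1 u)).sub
        (((hdGc a hac).clm_apply hbc).clm_apply (hφ1 u))).sub
        (hdet.smul (hKc.clm_apply (hφ1 u)))))
  have hUc : ContinuousAt (fun q => (U q)⁻¹) q₀ := hU.continuousAt.inv₀ hU0
  have hdU : ∀ v : C2, ContinuousAt (fun q => fderiv ℂ U q v) q₀ := fun v =>
    hU.fderiv.continuousAt.clm_apply continuousAt_const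
  -- For f = yU the relation f_y Γ_x - f_x Γ_y = C₃ becomes U Γ_x = C₃ + U_x (yΓ_y) - U_y (yΓ_x).
  -- The right-hand side is continuous because each yΓ_v is, and U is a unit.
  refine ⟨fun q => (U q)⁻¹ • (C₃ q + fderiv ℂ U q (1, 0) • (U q)⁻¹ • Cg (0, 1) q -
    fderiv ℂ U q (0, 1) • (U q)⁻¹ • Cg (1, 0) q), fun q => (U q)⁻¹ • Cg (0, 1) q,
    hUc.smul ((hC₃c.add ((hdU _).smul (hUc.smul (hCgc _)))).sub
      ((hdU _).smul (hUc.smul (hCgc _)))), hUc.smul (hCgc _), ?_⟩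
  filter_upwards [e.open_target.mem_nhds hq₀,
    (e.continuousAt_symm hq₀).eventually_mem (e₁.open_source.mem_nhds hpe),
    hUeq, hUeq.eventually_nhds, hU.eventually_analyticAt, hφ.eventually_analyticAt,
    hU.continuousAt.eventually_ne hU0] with q hq hq' hUq hUq' hUa hφa hUne hq2
  have hpol : e.symm q ∉ A.polar := by rwa [hdiv _ (e.map_target hq), e.right_inv hq]
  have hr : φ q ∈ e₁.target := e₁.map_source hq'
  have hrs : e₁.symm (φ q) = e.symm q := e₁.left_inv hq'
  have hfr : f (φ q) ≠ 0 := fun h => hpol (by rw [← hrs]; exact (hz _ hr).2 h)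
  have hch : ∀ v w : C2, A.christoffel e q v w = T q (fderiv ℂ (fderiv ℂ φ) q v w +
      A.christoffel e₁ (φ q) (fderiv ℂ φ q v) (fderiv ℂ φ q w)) := fun v w =>
    A.christoffel_eq he he₁ hq hq' hpol v w
  have hg : ∀ v, f (φ q) • A.christoffel e q v u = Cg v q := by
    intro v
    rw [hch, hCg]
    simp only
    rw [← hfG _ hr hfr, ← map_smul, smul_add]
    rfl
  have hΓ₁ : DifferentiableAt ℂ (A.christoffel e₁) (φ q) :=
    (A.holomorphic e₁ he₁).differentiableAt
      ((A.isOpen_regular_target e₁).mem_nhds ⟨hr, by rwa [hrs]⟩)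
  have hfΓ : ∀ᶠ r in 𝓝 (φ q), f r • A.christoffel e₁ r = G r := by
    filter_upwards [(hfa _ hr).continuousAt.eventually_ne hfr, e₁.open_target.mem_nhds hr]
      with r h1 h2 using hfG r h2 h1
  have hkey := smul_sub_smul_eq_extD (hfa _ hr).differentiableAt hΓ₁ hfΓ (b q) (a q)
    (fderiv ℂ φ q u)
  have hKq : f (φ q) • extD (A.christoffel e₁) (φ q) (b q) (a q) (fderiv ℂ φ q u) =
      ((b q).1 * (a q).2 - (b q).2 * (a q).1) • K (φ q) (1, 0) (0, 1) (fderiv ℂ φ q u) := by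
    rw [extD_eq, ← hfK _ hr hfr, smul_apply, smul_apply, smul_comm]
  have h3 : fderiv ℂ f (φ q) (b q) • A.christoffel e q (1, 0) u -
      fderiv ℂ f (φ q) (a q) • A.christoffel e q (0, 1) u = C₃ q := by
    rw [hch, hch, hC₃, ← map_smul, ← map_smul, ← map_sub]
    simp only
    rw [← hKq]
    congr 1
    have hext : extD G (φ q) (b q) (a q) (fderiv ℂ φ q u) =
      fderiv ℂ G (φ q) (b q) (a q) (fderiv ℂ φ q u) -
        fderiv ℂ G (φ q) (a q) (b q) (fderiv ℂ φ q u) := rfl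
    rw [← hext, ← hkey]
    simp only [smul_add]
    abel
  have hdg : ∀ v, fderiv ℂ f (φ q) (fderiv ℂ φ q v) = v.2 * U q + q.2 * fderiv ℂ U q v := by
    intro v
    rw [← fderiv_snd_mul hUa]
    have h1 : (fun q => f (φ q)) =ᶠ[𝓝 q] fun q => q.2 * U q := hUq'
    rw [← h1.fderiv_eq]
    exact congrArg (fun T : C2 →L[ℂ] ℂ => T v) ((hfa _ hr).differentiableAt.hasFDerivAt.comp q
      hφa.differentiableAt.hasFDerivAt).fderiv.symm
  have hy : ∀ v, q.2 • A.christoffel e q v u = (U q)⁻¹ • Cg v q := by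
    intro v
    have hUq2 : f (φ q) = q.2 * U q := hUq
    rw [← hg, hUq2, smul_smul, mul_comm q.2, inv_mul_cancel_left₀ hUne]
  refine ⟨?_, hy _⟩
  rw [← hy, ← hy, ← h3, hdg, hdg]
  have h4 : ∀ (y U U₁ U₂ : ℂ) (X Y : C2), U ≠ 0 → X = U⁻¹ • ((1 * U + y * U₂) • X -
      (0 * U + y * U₁) • Y + U₁ • y • Y - U₂ • y • X) := by
    intro y U U₁ U₂ X Y hU
    have : (1 * U + y * U₂) • X - (0 * U + y * U₁) • Y + U₁ • y • Y - U₂ • y • X = U • X := by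
      module
    rw [this, inv_smul_smul₀ hU]
  exact h4 _ _ _ _ _ _ hUne

/-- In adapted coordinates, a logarithmic structure has a simple pole along `y = 0`. -/
theorem exists_logConnection (hlog : A.IsLogarithmic) {e : OpenPartialHomeomorph S C2}
    (he : IsCoord e) (hdiv : ∀ x ∈ e.source, x ∈ A.polar ↔ (e x).2 = 0) :
    ∃ A' B' : C2 → End2, LogConnection (A.christoffel e) e.target A' B' := by
  have hreg : ∀ q, q ∈ e.target ∧ q.2 ≠ 0 → q ∈ {q | q ∈ e.target ∧ e.symm q ∉ A.polar} := by
    rintro q ⟨hq, hq2⟩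
    exact ⟨hq, by rwa [hdiv _ (e.map_target hq), e.right_inv hq]⟩
  have hd : ∀ v u : C2, DifferentiableOn ℂ (fun q => A.christoffel e q v u)
      {q | q ∈ e.target ∧ q.2 ≠ 0} := fun v u q hq =>
    ((((A.holomorphic e he).differentiableAt ((A.isOpen_regular_target e).mem_nhds
      (hreg q hq))).clm_apply (differentiableAt_const v)).clm_apply
      (differentiableAt_const u)).differentiableWithinAt
  have hbdd : ∀ (C g : C2 → C2) (q : C2), ContinuousAt C q →
      (∀ᶠ q' in 𝓝 q, q'.2 ≠ 0 → g q' = C q') → ∃ M : ℝ, ∀ᶠ q' in 𝓝 q, q'.2 ≠ 0 → ‖g q'‖ ≤ M := by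
    intro C g q hC h
    refine ⟨‖C q‖ + 1, ?_⟩
    filter_upwards [h, hC.norm.eventually_lt_const (lt_add_one _)] with q' h1 h2 h3
    rw [h1 h3]
    exact h2.le
  have hA : ∀ u : C2, ∃ g : C2 → C2, AnalyticOnNhd ℂ g e.target ∧
      ∀ q, q.2 ≠ 0 → g q = A.christoffel e q (1, 0) u := fun u =>
    exists_analytic_extension e.open_target (hd _ u) fun q hq hq2 => by
      obtain ⟨C₁, C₂, h1, h2, h3⟩ := exists_continuousAt_christoffel hlog he hdiv hq hq2 u
      exact hbdd C₁ _ q h1 (h3.mono fun q' h hq' => (h hq').1)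
  have hB : ∀ u : C2, ∃ g : C2 → C2, AnalyticOnNhd ℂ g e.target ∧
      ∀ q, q.2 ≠ 0 → g q = q.2 • A.christoffel e q (0, 1) u := fun u =>
    exists_analytic_extension (g := fun q => q.2 • A.christoffel e q (0, 1) u) e.open_target
      (differentiable_snd.differentiableOn.smul (hd _ u)) fun q hq hq2 => by
      obtain ⟨C₁, C₂, h1, h2, h3⟩ := exists_continuousAt_christoffel hlog he hdiv hq hq2 u
      exact hbdd C₂ _ q h2 (h3.mono fun q' h hq' => (h hq').2)
  obtain ⟨a₁, ha₁, ha₁e⟩ := hA (1, 0)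
  obtain ⟨a₂, ha₂, ha₂e⟩ := hA (0, 1)
  obtain ⟨b₁, hb₁, hb₁e⟩ := hB (1, 0)
  obtain ⟨b₂, hb₂, hb₂e⟩ := hB (0, 1)
  have hdec : ∀ u : C2, u = u.1 • ((1, 0) : C2) + u.2 • ((0, 1) : C2) := fun a => by ext <;> simp
  refine ⟨fun q => (ContinuousLinearMap.fst ℂ ℂ ℂ).smulRight (a₁ q) +
      (ContinuousLinearMap.snd ℂ ℂ ℂ).smulRight (a₂ q),
    fun q => (ContinuousLinearMap.fst ℂ ℂ ℂ).smulRight (b₁ q) +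
      (ContinuousLinearMap.snd ℂ ℂ ℂ).smulRight (b₂ q), fun q hq => ?_, fun q hq => ?_,
    fun q hq hq2 v => ?_, fun q hq hq2 => A.torsion_eq_zero e he q hq (hreg q ⟨hq, hq2⟩).2,
    fun q hq hq2 => A.curvature_eq_zero e he q hq (hreg q ⟨hq, hq2⟩).2⟩
  · exact (analyticAt_smulRight _ (ha₁ q hq)).add (analyticAt_smulRight _ (ha₂ q hq))
  · exact (analyticAt_smulRight _ (hb₁ q hq)).add (analyticAt_smulRight _ (hb₂ q hq))
  · refine ContinuousLinearMap.ext fun u => ?_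
    have h1 : A.christoffel e q v u = v.1 • (u.1 • A.christoffel e q (1, 0) (1, 0) +
        u.2 • A.christoffel e q (1, 0) (0, 1)) + v.2 • (u.1 • A.christoffel e q (0, 1) (1, 0) +
        u.2 • A.christoffel e q (0, 1) (0, 1)) := by
      conv_lhs => rw [hdec v, hdec u]
      simp only [map_add, map_smul, add_apply, smul_apply]
      module
    simp only [add_apply, smul_apply, ContinuousLinearMap.smulRight_apply,
      ContinuousLinearMap.coe_fst', ContinuousLinearMap.coe_snd']
    rw [h1, ha₁e q hq2, ha₂e q hq2, hb₁e q hq2, hb₂e q hq2]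
    simp only [smul_add, smul_smul]
    have h5 : ∀ t : ℂ, v.2 / q.2 * (t * q.2) = v.2 * t := fun t => by field_simp
    rw [h5, h5]

end Adapted

end LogAffine

end

/-! ### Independence of the monodromy from the coordinates, up to conjugacy. -/

noncomputable section
open Set Metric
namespace LogAffine

lemma cover_mono {ε ρ : ℝ} (hε : 0 < ε) (h : ε ≤ ρ) : cover ε ⊆ cover ρ := fun _ hz =>
  ⟨ball_subset_ball h hz.1, hz.2.trans_le (Real.log_le_log hε h)⟩

lemma IsFundamental.mono {F A B : C2 → End2} {ε ρ : ℝ} {N : End2} (hF : IsFundamental F A B ρ N)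
    (hε : 0 < ε) (h : ε ≤ ρ) : IsFundamental F A B ε N where
  parallel z hz := hF.parallel z (cover_mono hε h hz)
  isUnit z hz := hF.isUnit z (cover_mono hε h hz)
  deck z hz := hF.deck z (cover_mono hε h hz)

lemma BoundedCoeff.mono {A B : C2 → End2} {ε ρ : ℝ} (hb : BoundedCoeff ρ A B) (h : ε ≤ ρ) :
    BoundedCoeff ε A B := by
  obtain ⟨K, hK⟩ := hb
  exact ⟨K, fun q hq => hK q (ball_subset_ball h hq)⟩

lemma HasJordanForm.of_conj {N N' M : End2} (h : HasJordanForm N) (hM : IsUnit M)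
    (hc : N * M = M * N') : HasJordanForm N' := by
  obtain ⟨P, hP, l, hl, hPN⟩ := h
  exact ⟨P * M, hP.mul hM, l, hl, by rw [mul_assoc, ← hc, ← mul_assoc, hPN, mul_assoc]⟩

/-- Monodromies in two systems of coordinates are conjugate. -/
lemma exists_conj_of_change {Γ Γ' : ConnForm} {A B A' B' F F' : C2 → End2} {ρ ε : ℝ} {N N' : End2}
    (hρ : 0 < ρ) (hε : 0 < ε) (h : LogConnection Γ (ball 0 ρ) A B)
    (h' : LogConnection Γ' (ball 0 ε) A' B') (hb' : BoundedCoeff ε A' B')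
    (hF : IsFundamental F A B ρ N) (hF' : IsFundamental F' A' B' ε N') {φ : C2 → C2} {L : C2 → ℂ}
    (hφ : AnalyticOnNhd ℂ φ (ball 0 ε)) (hL : AnalyticOnNhd ℂ L (ball 0 ε))
    (hmaps : ∀ q ∈ ball (0 : C2) ε, φ q ∈ ball (0 : C2) ρ)
    (h2 : ∀ q ∈ ball (0 : C2) ε, (φ q).2 = q.2 * Complex.exp (L q))
    (hu : ∀ q ∈ ball (0 : C2) ε, IsUnit (fderiv ℂ φ q))
    (hch : ∀ q ∈ ball (0 : C2) ε, q.2 ≠ 0 → ∀ v w, fderiv ℂ φ q (Γ' q v w) =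
      fderiv ℂ (fderiv ℂ φ) q v w + Γ (φ q) (fderiv ℂ φ q v) (fderiv ℂ φ q w)) :
    ∃ M : End2, IsUnit M ∧ N * M = M * N' := by
  -- The lift of φ to the covers: φ₂ = y e^L lifts to w + L, and the lift commutes with the deck
  -- transformations.
  set T : C2 → C2 := fun z => ((φ (expMap z)).1, z.2 + L (expMap z)) with hT
  have hTe : ∀ z ∈ cover ε, expMap (T z) = φ (expMap z) := fun z hz => by
    refine Prod.ext rfl ?_
    rw [h2 _ (expMap_mem_ball hε hz)]
    simp [hT, expMap, Complex.exp_add]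
  have hTc : ∀ z ∈ cover ε, T z ∈ cover ρ := fun z hz => by
    rw [← expMap_mem_ball_iff hρ, hTe z hz]
    exact hmaps _ (expMap_mem_ball hε hz)
  have hTd : ∀ z, T (LogAffine.deck z) = LogAffine.deck (T z) := fun z => by
    refine Prod.ext ?_ ?_
    · simp [hT, expMap_deck]; simp [LogAffine.deck]
    · simp [hT, expMap_deck]; simp [LogAffine.deck]; ring
  have hφe : ∀ z ∈ cover ε, HasFDerivAt (fun z => φ (expMap z))
      (fderiv ℂ φ (expMap z) ∘L expMapDeriv z) z := fun z hz =>
    ((hφ _ (expMap_mem_ball hε hz)).differentiableAt.hasFDerivAt).comp z (hasFDerivAt_expMap z)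
  have hTdiff : ∀ z ∈ cover ε, ∃ T' : C2 →L[ℂ] C2, HasFDerivAt T T' z ∧
      ∀ v, expMapDeriv (T z) (T' v) = fderiv ℂ φ (expMap z) (expMapDeriv z v) := fun z hz => by
    have h1 := hφe z hz
    have h3 := ((hL _ (expMap_mem_ball hε hz)).differentiableAt.hasFDerivAt).comp z
      (hasFDerivAt_expMap z)
    have h4 := h1.fst.prodMk ((hasFDerivAt_snd (𝕜 := ℂ) (p := z)).add h3)
    refine ⟨_, h4, fun v => ?_⟩
    have h5 := (hasFDerivAt_expMap (T z)).comp z h4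
    have h6 := h5.congr_of_eventuallyEq (f₁ := fun z => φ (expMap z))
      (Filter.eventuallyEq_of_mem (isOpen_cover.mem_nhds hz) fun z hz => (hTe z hz).symm)
    exact congrArg (fun T : C2 →L[ℂ] C2 => T v) (h6.unique h1)
  -- The fundamental matrix transported by φ is parallel for the second connection, hence equals M
  -- F' for a constant M. Applying the deck transformation to both expressions gives N M = M N'.
  set F₂ : C2 → End2 := fun z => F (T z) ∘L fderiv ℂ φ (expMap z) with hF₂
  have hpar : IsParallel F₂ (coverForm A' B') (cover ε) := by
    intro z hz
    obtain ⟨T', hT', hTv⟩ := hTdiff z hz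
    have h1 := (hF.parallel _ (hTc z hz)).comp z hT'
    have h3 := ((hφ _ (expMap_mem_ball hε hz)).fderiv.differentiableAt.hasFDerivAt).comp z
      (hasFDerivAt_expMap z)
    refine (h1.clm_comp h3).congr_fderiv ?_
    refine ContinuousLinearMap.ext fun v => ContinuousLinearMap.ext fun u => ?_
    have h4 : coverForm A B (T z) (T' v) (fderiv ℂ φ (expMap z) u) =
        Γ (φ (expMap z)) (fderiv ℂ φ (expMap z) (expMapDeriv z v)) (fderiv ℂ φ (expMap z) u) := by
      rw [coverForm_eq h hρ (hTc z hz), ContinuousLinearMap.comp_apply, hTv, hTe z hz]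
    have h5 : coverForm A' B' z v u = Γ' (expMap z) (expMapDeriv z v) u := by
      rw [coverForm_eq h' hε hz, ContinuousLinearMap.comp_apply]
    have h6 := hch _ (expMap_mem_ball hε hz) (expMap_snd_ne_zero z) (expMapDeriv z v) u
    change F (T z) (fderiv ℂ (fderiv ℂ φ) (expMap z) (expMapDeriv z v) u) +
      F (T z) (coverForm A B (T z) (T' v) (fderiv ℂ φ (expMap z) u)) =
      F (T z) (fderiv ℂ φ (expMap z) (coverForm A' B' z v u))
    rw [h4, h5, h6, map_add]
  obtain ⟨K, hK0, -, hK⟩ := hb'.exists_coverForm_le hε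
  set z₁ : C2 := (0, Real.log ε - 1)
  have hz₁ : z₁ ∈ cover ε := cover_nonempty hε
  obtain ⟨u, hu₁⟩ := hF'.isUnit z₁ hz₁
  set M : End2 := F₂ z₁ * ↑u⁻¹ with hM
  have hMu : IsUnit M :=
    ((hF.isUnit _ (hTc z₁ hz₁)).mul (hu _ (expMap_mem_ball hε hz₁))).mul (u⁻¹).isUnit
  have heq : EqOn F₂ (fun z => M * F' z) (cover ε) :=
    hpar.eqOn (hF'.parallel.const_mul M) convex_cover hK hz₁ (by
      rw [hM, ← hu₁, mul_assoc, Units.inv_mul, mul_one])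
  refine ⟨M, hMu, ?_⟩
  have h7 : F₂ (LogAffine.deck z₁) = N * F₂ z₁ := by
    rw [hF₂]
    simp only
    rw [hTd, expMap_deck, hF.deck _ (hTc z₁ hz₁)]
    rfl
  rw [heq (deck_mem_cover hz₁), heq hz₁] at h7
  simp only at h7
  rw [hF'.deck _ hz₁, ← mul_assoc, ← mul_assoc] at h7
  exact ((hF'.isUnit z₁ hz₁).mul_right_cancel h7).symm

section Surface

variable {S : Type*} [TopologicalSpace S] [ChartedSpace C2 S] [IsManifold 𝓘(ℂ, C2) ω S]
variable {A : MeromorphicAffineStructure S}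

variable (A) in
/-- `N` is the monodromy, around the axis `y = 0`, of a fundamental matrix in the coordinates `e`
over the ball of radius `ρ`. -/
def IsLocalMonodromy (e : OpenPartialHomeomorph S C2) (ρ : ℝ) (N : End2) : Prop :=
  ball (0 : C2) ρ ⊆ e.target ∧ ∃ A' B' F : C2 → End2,
    LogConnection (A.christoffel e) (ball 0 ρ) A' B' ∧ BoundedCoeff ρ A' B' ∧
      IsFundamental F A' B' ρ N

/-- Including the closed ball in the chart gives bounded coefficients by compactness. -/
lemma exists_isLocalMonodromy (hlog : A.IsLogarithmic) {e : OpenPartialHomeomorph S C2}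
    (he : IsCoord e) (hdiv : ∀ x ∈ e.source, x ∈ A.polar ↔ (e x).2 = 0) {ρ : ℝ} (hρ : 0 < ρ)
    (hsub : closedBall (0 : C2) ρ ⊆ e.target) : ∃ N, IsLocalMonodromy A e ρ N := by
  obtain ⟨A', B', h⟩ := exists_logConnection hlog he hdiv
  have hb : BoundedCoeff ρ A' B' := by
    have hK : IsCompact (closedBall (0 : C2) ρ) := isCompact_closedBall _ _
    obtain ⟨K₁, h₁⟩ := hK.exists_bound_of_continuousOn (h.analytic_A.mono hsub).continuousOn
    obtain ⟨K₂, h₂⟩ := hK.exists_bound_of_continuousOn (h.analytic_B.mono hsub).continuousOn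
    exact ⟨max K₁ K₂, fun q hq => ⟨(h₁ q (ball_subset_closedBall hq)).trans (le_max_left _ _),
      (h₂ q (ball_subset_closedBall hq)).trans (le_max_right _ _)⟩⟩
  have h' := h.mono (ball_subset_closedBall.trans hsub)
  obtain ⟨F, N, hF⟩ := exists_isFundamental h' hρ hb
  exact ⟨N, ball_subset_closedBall.trans hsub, A', B', F, h', hb, hF⟩

/-- Two systems of coordinates in which the polar divisor is `y = 0` differ by a unit. -/
lemma exists_exp_factor {φ : C2 → C2} (hφ : AnalyticAt ℂ φ 0)
    (h0 : ∀ᶠ q in 𝓝 (0 : C2), q.2 = 0 → (φ q).2 = 0)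
    (hsurj : ∀ v, ∃ u, fderiv ℂ φ 0 u = v) :
    ∃ L : C2 → ℂ, AnalyticAt ℂ L 0 ∧
      ∀ᶠ q in 𝓝 (0 : C2), (φ q).2 = q.2 * Complex.exp (L q) := by
  have hφ2 : AnalyticAt ℂ (fun q => (φ q).2) 0 := analyticAt_snd.comp hφ
  obtain ⟨U, hU, hUo, hU0⟩ := _root_.eventually_nhds_iff.1 (h0.and hφ2.eventually_analyticAt)
  obtain ⟨V, hV, hVeq⟩ := exists_eq_snd_smul hUo (f := fun q => (φ q).2) (fun q hq => (hU q hq).2)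
    (fun q hq hq2 => (hU q hq).1 hq2)
  -- If V vanished at the origin, the differential of φ₂ = y V would vanish there, against
  -- surjectivity.
  have hV0 : V 0 ≠ 0 := by
    intro hV0
    obtain ⟨u, hu⟩ := hsurj (0, 1)
    have h1 : HasFDerivAt (fun q => (φ q).2)
        (ContinuousLinearMap.snd ℂ ℂ ℂ ∘L fderiv ℂ φ 0) 0 :=
      hφ.differentiableAt.hasFDerivAt.snd
    have h2 := ((hasFDerivAt_snd (𝕜 := ℂ) (p := (0 : C2))).smul
      (hV 0 hU0).differentiableAt.hasFDerivAt).congr_of_eventuallyEq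
      (Filter.eventuallyEq_of_mem (hUo.mem_nhds hU0) hVeq)
    have h3 := congrArg (fun T : C2 →L[ℂ] ℂ => T u) (h1.unique h2)
    simp [hu, hV0] at h3
  refine ⟨fun q => Complex.log (V q / V 0) + Complex.log (V 0), ?_, ?_⟩
  · exact (((hV 0 hU0).div_const).clog (by simp [div_self hV0])).add analyticAt_const
  · filter_upwards [hUo.mem_nhds hU0, (hV 0 hU0).continuousAt.eventually_ne hV0] with q hq hq2
    rw [Complex.exp_add, Complex.exp_log (div_ne_zero hq2 hV0), Complex.exp_log hV0,
      div_mul_cancel₀ _ hV0]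
    exact hVeq q hq

lemma isUnit_of_surjective {T : End2} (h : ∀ v, ∃ u, T u = v) : IsUnit T := by
  have h1 : Function.Bijective T :=
    ⟨(LinearMap.injective_iff_surjective (f := (T : C2 →ₗ[ℂ] C2))).2 h, h⟩
  set f := (LinearEquiv.ofBijective (T : C2 →ₗ[ℂ] C2) h1).toContinuousLinearEquiv with hf
  refine ⟨⟨T, f.symm, ?_, ?_⟩, rfl⟩
  · exact ContinuousLinearMap.ext fun v => f.apply_symm_apply v
  · exact ContinuousLinearMap.ext fun v => f.symm_apply_apply v

/-- The chart e need not be centred at p. One monodromy computed in e thus governs all smooth points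
of the divisor inside its ball, which makes parabolicity locally constant. -/
lemma IsLocalMonodromy.exists_conj {e e₁ : OpenPartialHomeomorph S C2} {ρ ρ₁ : ℝ} {N N₁ : End2}
    {p : S} (hρ : 0 < ρ) (hρ₁ : 0 < ρ₁) (hN : IsLocalMonodromy A e ρ N)
    (hN₁ : IsLocalMonodromy A e₁ ρ₁ N₁) (he : IsCoord e)
    (hdiv : ∀ x ∈ e.source, x ∈ A.polar ↔ (e x).2 = 0) (he₁ : IsAdapted A.polar e₁ p)
    (hp : p ∈ e.source) (hpρ : e p ∈ ball (0 : C2) ρ) :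
    ∃ M : End2, IsUnit M ∧ N * M = M * N₁ := by
  obtain ⟨hsub, A', B', F, h, hb, hF⟩ := hN
  obtain ⟨hsub₁, A₁, B₁, F₁, h₁, hb₁, hF₁⟩ := hN₁
  have h0t : (0 : C2) ∈ e₁.target := hsub₁ (mem_ball_self hρ₁)
  have hps : e₁.symm 0 = p := by rw [← he₁.centred, e₁.left_inv he₁.mem]
  set φ : C2 → C2 := e ∘ e₁.symm with hφdef
  have hφ : AnalyticAt ℂ φ 0 := he₁.isCoord.analyticAt_transition he h0t (by rwa [hps])
  have hφ0 : φ 0 = e p := by rw [hφdef, Function.comp_apply, hps]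
  have hnear : ∀ᶠ q in 𝓝 (0 : C2), q ∈ e₁.target ∧ e₁.symm q ∈ e.source :=
    Filter.eventually_and.2 ⟨e₁.open_target.mem_nhds h0t,
      (e₁.continuousAt_symm h0t).eventually_mem (e.open_source.mem_nhds (by rwa [hps]))⟩
  have hsurj : ∀ q, q ∈ e₁.target ∧ e₁.symm q ∈ e.source → ∀ v, ∃ u, fderiv ℂ φ q u = v := by
    rintro q ⟨hq, hqs⟩ v
    refine ⟨fderiv ℂ (e₁ ∘ e.symm) (φ q) v, ?_⟩
    have h1 := he.fderiv_transition_comp he₁.isCoord (q := φ q) (e.map_source hqs)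
      (by rw [hφdef, Function.comp_apply, e.left_inv hqs]; exact e₁.map_target hq) v
    have h2 : e₁ (e.symm (φ q)) = q := by
      rw [hφdef, Function.comp_apply, e.left_inv hqs, e₁.right_inv hq]
    rwa [h2] at h1
  have hpolar : ∀ q, q ∈ e₁.target ∧ e₁.symm q ∈ e.source → (e₁.symm q ∈ A.polar ↔ q.2 = 0) := by
    rintro q ⟨hq, -⟩
    rw [he₁.divisor _ (e₁.map_target hq), e₁.right_inv hq]
  obtain ⟨L, hL, hφL⟩ := exists_exp_factor hφ (by
    filter_upwards [hnear] with q hq hq2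
    exact (hdiv _ hq.2).1 ((hpolar q hq).2 hq2)) (hsurj 0 hnear.self_of_nhds)
  have hmaps : ∀ᶠ q in 𝓝 (0 : C2), φ q ∈ ball (0 : C2) ρ :=
    hφ.continuousAt.eventually_mem (isOpen_ball.mem_nhds (by rwa [hφ0]))
  obtain ⟨ε, hε, hε'⟩ := Metric.eventually_nhds_iff_ball.1 (hnear.and (hφL.and (hmaps.and
    (hφ.eventually_analyticAt.and hL.eventually_analyticAt))))
  set δ := min ε ρ₁
  have hδ : 0 < δ := lt_min hε hρ₁
  have hδε : ∀ q ∈ ball (0 : C2) δ, _ := fun q hq =>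
    hε' q (ball_subset_ball (min_le_left _ _) hq)
  exact exists_conj_of_change hρ hδ h (h₁.mono (ball_subset_ball (min_le_right _ _)))
    (hb₁.mono (min_le_right _ _)) hF (hF₁.mono hδ (min_le_right _ _)) (φ := φ) (L := L)
    (fun q hq => (hδε q hq).2.2.2.1) (fun q hq => (hδε q hq).2.2.2.2)
    (fun q hq => (hδε q hq).2.2.1) (fun q hq => (hδε q hq).2.1)
    (fun q hq => isUnit_of_surjective (hsurj q (hδε q hq).1))
    (fun q hq hq2 v w => A.change e₁ e he₁.isCoord he q (hδε q hq).1.1 (hδε q hq).1.2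
      (fun h => hq2 ((hpolar q (hδε q hq).1).1 h)) v w)

end Surface

end LogAffine

end

/-! ### Parabolic transport, Jordan forms, and propagation along a branch. -/

noncomputable section
open Set Metric
namespace LogAffine

/-- A linear map with a single invariant line has a Jordan form. -/
lemma hasJordanForm_of_eigenvector {T : End2} {u : C2} {l : ℂ} (hl : l ≠ 0) (hu : u ≠ 0)
    (hT : T u = l • u) (h : ∀ (w : C2) (μ : ℂ), w ≠ 0 → T w = μ • w → ∃ c : ℂ, w = c • u) :
    HasJordanForm T := by
  obtain ⟨w, hw⟩ : ∃ w : C2, u.1 * w.2 - u.2 * w.1 ≠ 0 := by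
    by_cases h1 : u.1 = 0
    · exact ⟨(1, 0), fun h2 => hu (Prod.ext h1 (by simpa [h1] using h2))⟩
    · exact ⟨(0, 1), by simpa using h1⟩
  set D := u.1 * w.2 - u.2 * w.1 with hD
  have hw0 : ∀ c : ℂ, w ≠ c • u := by
    rintro c rfl
    exact hw (by rw [hD]; simp; ring)
  set α : C2 →L[ℂ] ℂ := D⁻¹ • (w.2 • dx - w.1 • dy) with hα
  set β : C2 →L[ℂ] ℂ := D⁻¹ • (u.1 • dy - u.2 • dx) with hβ
  have hαu : α u = 1 := by
    simp only [hα, smul_apply, sub_apply, ContinuousLinearMap.coe_fst', ContinuousLinearMap.coe_snd',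
      smul_eq_mul]
    rw [inv_mul_eq_one₀ hw, hD]; ring
  have hαw : α w = 0 := by simp [hα]; right; ring
  have hβu : β u = 0 := by simp [hβ]; right; ring
  have hβw : β w = 1 := by
    simp only [hβ, smul_apply, sub_apply, ContinuousLinearMap.coe_fst', ContinuousLinearMap.coe_snd',
      smul_eq_mul]
    rw [inv_mul_eq_one₀ hw, hD]
  have hdec : ∀ v, v = α v • u + β v • w := by
    intro v
    ext
    · simp [hα, hβ]; field_simp; rw [hD]; ring
    · simp [hα, hβ]; field_simp; rw [hD]; ring
  set b := α (T w)
  set μ := β (T w)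
  have hTw : T w = b • u + μ • w := hdec _
  -- A second eigenvalue would give an eigenvector outside the line of u. Likewise, b = 0 below
  -- would make w an eigenvector.
  have hμ : μ = l := by
    by_contra hμ
    have hne : μ - l ≠ 0 := sub_ne_zero.2 hμ
    obtain ⟨c, hc⟩ := h (w + (b / (μ - l)) • u) μ (fun h0 => by
        refine hw0 (-(b / (μ - l))) ?_
        rw [neg_smul]; exact eq_neg_of_add_eq_zero_left h0) (by
      rw [map_add, map_smul, hTw, hT]
      have : μ * (b / (μ - l)) = b + b / (μ - l) * l := by field_simp; ring
      rw [smul_add, smul_smul, smul_smul, this]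
      module)
    exact hw0 (c - b / (μ - l)) (by rw [sub_smul, ← hc, add_sub_cancel_right])
  rw [hμ] at hTw
  have hb : b ≠ 0 := by
    intro hb
    rw [hb, zero_smul, zero_add] at hTw
    obtain ⟨c, hc⟩ := h w l (fun h0 => hw0 0 (by rw [h0, zero_smul])) hTw
    exact hw0 c hc
  have hpi : (2 * Real.pi * Complex.I : ℂ) ≠ 0 := Complex.two_pi_I_ne_zero
  -- Scaling β by c turns the off-diagonal entry b into -2πi l.
  set c : ℂ := -b / (2 * Real.pi * Complex.I * l) with hc
  have hc0 : c ≠ 0 := div_ne_zero (neg_ne_zero.2 hb) (mul_ne_zero hpi hl)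
  refine ⟨(c • β).prod α, isUnit_of_surjective fun v => ⟨v.2 • u + (v.1 / c) • w, ?_⟩, l, hl, ?_⟩
  · ext
    · simp [hβu, hβw]; field_simp
    · simp [hαu, hαw]
  · refine ContinuousLinearMap.ext fun v => ?_
    have hTv : T v = (α v * l + β v * b) • u + (β v * l) • w := by
      conv_lhs => rw [hdec v]
      rw [map_add, map_smul, map_smul, hT, hTw]; module
    have h1 : α (T v) = α v * l + β v * b := by rw [hTv]; simp [hαu, hαw]
    have h2 : β (T v) = β v * l := by rw [hTv]; simp [hβu, hβw]
    have h3 : c * (2 * Real.pi * Complex.I * l) = -b := by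
      rw [hc, div_mul_cancel₀ _ (mul_ne_zero hpi hl)]
    ext
    · simp [jordan, h2]; ring
    · simp [jordan, h1]; linear_combination (β v) * h3

/-- T is the inverse of M, so both have the same invariant lines. The inverse occurs because the
monodromy of F is conjugate to the inverse of parallel transport. -/
lemma IsParabolic.hasJordanForm {M : C2 ≃ₗ[ℂ] C2} (hM : IsParabolic M) {T : End2}
    (hT : ∀ v, T (M v) = v) : HasJordanForm T := by
  obtain ⟨Λ, ⟨hΛ1, hΛ2⟩, huniq⟩ := hM
  have hinj : ∀ v, M (T v) = v := fun v => by
    obtain ⟨v, rfl⟩ := M.surjective v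
    rw [hT]
  obtain ⟨⟨u, huΛ⟩, hu0, hspan⟩ := finrank_eq_one_iff'.1 hΛ1
  have hu : u ≠ 0 := fun h => hu0 (Subtype.ext h)
  have hmem : ∀ v ∈ Λ, ∃ c : ℂ, v = c • u := fun v hv => by
    obtain ⟨c, hc⟩ := hspan ⟨v, hv⟩
    exact ⟨c, (congrArg Subtype.val hc).symm⟩
  have hTu : T u ∈ Λ := by
    rw [← hΛ2] at huΛ
    obtain ⟨v, hv, hvu⟩ := huΛ
    rw [← hvu]
    change T (M v) ∈ Λ
    rw [hT]; exact hv
  obtain ⟨l, hl⟩ := hmem _ hTu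
  have hne : ∀ (w : C2) (μ : ℂ), w ≠ 0 → T w = μ • w → μ ≠ 0 := by
    rintro w μ hw hTw rfl
    apply hw
    rw [← hinj w, hTw, zero_smul, map_zero]
  refine hasJordanForm_of_eigenvector (hne u l hu hl) hu hl fun w μ hw hTw => ?_
  have hμ := hne w μ hw hTw
  have hMw : M w = μ⁻¹ • w := by
    have h1 := hinj w
    rw [hTw, map_smul] at h1
    rw [eq_inv_smul_iff₀ hμ]; exact h1
  refine hmem w ?_
  have h1 := huniq (Submodule.span ℂ {w}) ⟨finrank_span_singleton hw, ?_⟩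
  · rw [← h1]; exact Submodule.mem_span_singleton_self w
  · rw [Submodule.map_span, image_singleton]
    change Submodule.span ℂ {M w} = _
    rw [hMw]
    exact Submodule.span_singleton_smul_eq (IsUnit.mk0 _ (inv_ne_zero hμ)) w

/-- Parallel transport along the meridian is inverse to the monodromy of a fundamental matrix. -/
lemma IsFundamental.transport {Γ : ConnForm} {A B F : C2 → End2} {ρ r : ℝ} {N : End2}
    (hF : IsFundamental F A B ρ N) (h : LogConnection Γ (ball 0 ρ) A B) (hr : 0 < r) (hrρ : r < ρ)
    {v w : C2} (hvw : IsTransport Γ (meridian r) v w) :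
    N (F (0, (Real.log r : ℂ)) w) = F (0, (Real.log r : ℂ)) v := by
  obtain ⟨Z, hZ0, hZ1, hZ⟩ := hvw
  have hρ : 0 < ρ := hr.trans hrρ
  set k : ℂ := 2 * Real.pi * Complex.I with hk
  -- The meridian lifted to the cover: a segment joining a point to its image under the deck
  -- transformation.
  set z : ℝ → C2 := fun s => (0, (Real.log r : ℂ) + k * s) with hz
  have hzc : ∀ s, z s ∈ cover ρ := fun s => by
    refine ⟨by simpa [hz] using hρ, ?_⟩
    simpa [hz, hk] using Real.log_lt_log hr hrρ
  have hzm : ∀ s, expMap (z s) = meridian r s := fun s => by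
    simp only [hz, expMap, meridian, Complex.exp_add, hk]
    rw [← Complex.ofReal_exp, Real.exp_log hr]
  have hz' : ∀ s, HasDerivAt z (0, k) s := fun s => by
    have h1 : HasDerivAt (fun s : ℝ => k * (s : ℂ)) (k * 1) s :=
      (Complex.ofRealCLM.hasDerivAt (x := s)).const_mul k
    rw [mul_one] at h1
    exact (hasDerivAt_const s (0 : ℂ)).prodMk (h1.const_add _)
  have hm' : ∀ s, deriv (meridian r) s = expMapDeriv (z s) (0, k) := fun s => by
    have h1 := ((hasFDerivAt_expMap (z s)).restrictScalars ℝ).comp_hasDerivAt s (hz' s)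
    have h2 : expMap ∘ z = meridian r := funext hzm
    rw [h2] at h1
    exact h1.deriv
  -- F Z is constant along the path: dF = F Θ and Z' = -Θ Z cancel.
  have hW : ∀ s ∈ Icc (0 : ℝ) 1, HasDerivWithinAt (fun s => F (z s) (Z s)) 0 (Icc 0 1) s := by
    intro s hs
    have h1 := (((hF.parallel _ (hzc s)).restrictScalars ℝ).comp_hasDerivAt s
      (hz' s)).hasDerivWithinAt (s := Icc 0 1)
    have h2 := hZ s hs
    have h3 : HasDerivWithinAt (fun s => F (z s) (Z s)) _ (Icc 0 1) s :=
      HasDerivWithinAt.clm_apply (𝕜 := ℝ)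
        (c := fun s => (ContinuousLinearMap.restrictScalarsL ℂ C2 C2 ℝ ℝ) (F (z s)))
        ((ContinuousLinearMap.restrictScalarsL ℂ C2 C2 ℝ ℝ).hasFDerivAt.comp_hasDerivWithinAt s h1)
        h2
    refine h3.congr_deriv ?_
    change F (z s) (coverForm A B (z s) (0, k) (Z s)) +
      F (z s) (-(Γ (meridian r s) (deriv (meridian r) s) (Z s))) = 0
    rw [coverForm_eq h hρ (hzc s), hzm, hm', map_neg]
    exact add_neg_cancel _
  have hconst := (convex_Icc (0 : ℝ) 1).norm_image_sub_le_of_norm_hasDerivWithin_le (C := 0)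
    (f := fun s => F (z s) (Z s)) (f' := fun _ => 0) hW (by simp)
    (left_mem_Icc.2 zero_le_one) (right_mem_Icc.2 zero_le_one)
  rw [zero_mul, norm_le_zero_iff, sub_eq_zero] at hconst
  have hz1 : z 1 = LogAffine.deck (z 0) := by simp [hz, LogAffine.deck, hk]
  have hz0 : z 0 = (0, (Real.log r : ℂ)) := by simp [hz]
  have h4 : F (z 1) w = F (z 0) v := by simpa [hZ0, hZ1] using hconst
  rw [hz1, hF.deck _ (hzc 0), hz0] at h4
  exact h4

section Surface

variable {S : Type*} [TopologicalSpace S] [ChartedSpace C2 S] [IsManifold 𝓘(ℂ, C2) ω S]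
variable {A : MeromorphicAffineStructure S}

lemma exists_closedBall_subset_target {e : OpenPartialHomeomorph S C2} (h : (0 : C2) ∈ e.target) :
    ∃ ρ > 0, closedBall (0 : C2) ρ ⊆ e.target :=
  Metric.nhds_basis_closedBall.mem_iff.1 (e.open_target.mem_nhds h)

lemma IsAdapted.zero_mem_target {D : Set S} {e : OpenPartialHomeomorph S C2} {p : S}
    (h : IsAdapted D e p) : (0 : C2) ∈ e.target := by
  rw [← h.centred]; exact e.map_source h.mem

variable (A) in
/-- A smooth point of the polar divisor around which the monodromy is parabolic. -/
def IsParabolicPoint (p : S) : Prop :=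
  ∃ e ρ N, 0 < ρ ∧ IsAdapted A.polar e p ∧ IsLocalMonodromy A e ρ N ∧ HasJordanForm N

/-- The ball is enlarged a little inside the chart so that the meridian of radius r lies in the open
ball carrying F. The value of F at the base point then conjugates N to the inverse of the transport.
-/
lemma isParabolicPoint_of_transport (hlog : A.IsLogarithmic) {p : S}
    {e : OpenPartialHomeomorph S C2} (he : IsAdapted A.polar e p) {r : ℝ} (hr : 0 < r)
    (hsub : closedBall (0 : C2) r ⊆ e.target) {M : C2 ≃ₗ[ℂ] C2}
    (hM : ∀ v, IsTransport (A.christoffel e) (meridian r) v (M v)) (hpar : IsParabolic M) :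
    IsParabolicPoint A p := by
  obtain ⟨δ, hδ, hsubδ⟩ := (isCompact_closedBall (0 : C2) r).exists_cthickening_subset_open
    e.open_target hsub
  rw [cthickening_closedBall hδ.le hr.le] at hsubδ
  have hρ : 0 < δ + r := by positivity
  obtain ⟨N, hN⟩ := exists_isLocalMonodromy hlog he.isCoord he.divisor hρ hsubδ
  refine ⟨e, δ + r, N, hρ, he, hN, ?_⟩
  obtain ⟨-, A', B', F, h, -, hF⟩ := hN
  have hrρ : r < δ + r := by linarith
  have hz : ((0, (Real.log r : ℂ)) : C2) ∈ cover (δ + r) := by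
    refine ⟨by simpa using hρ, by simpa using Real.log_lt_log hr hrρ⟩
  obtain ⟨u, hu⟩ := hF.isUnit _ hz
  set T : End2 := (M.symm.toContinuousLinearEquiv : C2 →L[ℂ] C2) with hT
  have hTM : ∀ v, T (M v) = v := fun v => M.symm_apply_apply v
  refine (hpar.hasJordanForm hTM).of_conj (M := ↑u⁻¹) (u⁻¹).isUnit ?_
  have h1 : N * (u : End2) = u * T := by
    refine ContinuousLinearMap.ext fun v => ?_
    obtain ⟨v, rfl⟩ := M.surjective v
    change N ((u : End2) (M v)) = (u : End2) (T (M v))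
    rw [hTM, hu]
    exact hF.transport h hr hrρ (hM v)
  rw [Units.eq_inv_mul_iff_mul_eq, ← mul_assoc, ← h1, mul_assoc, Units.mul_inv, mul_one]

/-- Parabolicity is locally constant along the smooth part of the divisor. -/
lemma IsLocalMonodromy.isParabolicPoint_iff (hlog : A.IsLogarithmic)
    {e : OpenPartialHomeomorph S C2} {ρ : ℝ} {N : End2} {p : S} (hρ : 0 < ρ)
    (hN : IsLocalMonodromy A e ρ N) (he : IsCoord e)
    (hdiv : ∀ x ∈ e.source, x ∈ A.polar ↔ (e x).2 = 0) (hreg : p ∈ regularPart A.polar)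
    (hp : p ∈ e.source) (hpρ : e p ∈ ball (0 : C2) ρ) :
    IsParabolicPoint A p ↔ HasJordanForm N := by
  constructor
  · rintro ⟨e₁, ρ₁, N₁, hρ₁, he₁, hN₁, hJ⟩
    obtain ⟨M, hM, hc⟩ := hN.exists_conj hρ hρ₁ hN₁ he hdiv he₁ hp hpρ
    obtain ⟨u, rfl⟩ := hM
    refine hJ.of_conj (M := ↑u⁻¹) (u⁻¹).isUnit ?_
    rw [Units.eq_inv_mul_iff_mul_eq, ← mul_assoc, ← hc, mul_assoc, Units.mul_inv, mul_one]
  · intro hJ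
    obtain ⟨e₁, he₁⟩ := hreg
    obtain ⟨ρ₁, hρ₁, hsub⟩ := exists_closedBall_subset_target he₁.zero_mem_target
    obtain ⟨N₁, hN₁⟩ := exists_isLocalMonodromy hlog he₁.isCoord he₁.divisor hρ₁ hsub
    obtain ⟨M, hM, hc⟩ := hN.exists_conj hρ hρ₁ hN₁ he hdiv he₁ hp hpρ
    exact ⟨e₁, ρ₁, N₁, hρ₁, he₁, hN₁, hJ.of_conj hM hc⟩

/-- Adding limit points to a connected set keeps it connected. Hence the smooth points of the
divisor on a branch all belong to the component that defines it. -/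
lemma closure_connectedComponentIn_inter_subset {X : Type*} [TopologicalSpace X] (R : Set X)
    {x : X} (hx : x ∈ R) :
    closure (connectedComponentIn R x) ∩ R ⊆ connectedComponentIn R x := by
  refine IsPreconnected.subset_connectedComponentIn ?_
    ⟨subset_closure (mem_connectedComponentIn hx), hx⟩ inter_subset_right
  exact isPreconnected_connectedComponentIn.subset_closure
    (subset_inter subset_closure (connectedComponentIn_subset R x)) inter_subset_left

/-- If the local monodromy around a branch is parabolic, it is so at all smooth points. -/
theorem isParabolicPoint_of_mem_branch (hlog : A.IsLogarithmic) {D₀ : Set S}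
    (hD₀ : IsBranch A.polar D₀) (hpar : A.HasParabolicLocalMonodromy D₀) {p : S} (hp : p ∈ D₀)
    (hreg : p ∈ regularPart A.polar) : IsParabolicPoint A p := by
  obtain ⟨p₀, hp₀, rfl⟩ := hD₀
  obtain ⟨p₁, hp₁, e, he, r, hr, hsub, M, hM, hMpar⟩ := hpar
  have h1 := isParabolicPoint_of_transport hlog he hr hsub hM hMpar
  set C := connectedComponentIn (regularPart A.polar) p₀
  have hC : ∀ x ∈ closure C, x ∈ regularPart A.polar → x ∈ C := fun x hx hxr =>
    closure_connectedComponentIn_inter_subset _ hp₀ ⟨hx, hxr⟩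
  have hCR : C ⊆ regularPart A.polar := connectedComponentIn_subset _ _
  -- Near each point of C, parabolicity at all smooth points is decided by a single matrix, so it is
  -- locally constant on the connected set C.
  refine (isPreconnected_connectedComponentIn.induction₂
    (fun x y => IsParabolicPoint A x ↔ IsParabolicPoint A y) ?_ ?_ ?_
    (hC p₁ hp₁ ⟨e, he⟩) (hC p hp hreg)).1 h1
  · intro x hx
    obtain ⟨e₁, he₁⟩ := hCR hx
    obtain ⟨ρ₁, hρ₁, hsub₁⟩ := exists_closedBall_subset_target he₁.zero_mem_target
    obtain ⟨N₁, hN₁⟩ := exists_isLocalMonodromy hlog he₁.isCoord he₁.divisor hρ₁ hsub₁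
    have hx0 : e₁ x ∈ ball (0 : C2) ρ₁ := by rw [he₁.centred]; exact mem_ball_self hρ₁
    filter_upwards [self_mem_nhdsWithin,
      mem_nhdsWithin_of_mem_nhds (e₁.open_source.mem_nhds he₁.mem),
      mem_nhdsWithin_of_mem_nhds ((e₁.continuousAt he₁.mem).eventually_mem
        (isOpen_ball.mem_nhds hx0))] with y hy hys hyρ
    rw [hN₁.isParabolicPoint_iff hlog hρ₁ he₁.isCoord he₁.divisor (hCR hx) he₁.mem hx0,
      hN₁.isParabolicPoint_iff hlog hρ₁ he₁.isCoord he₁.divisor (hCR hy) hys hyρ]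
  · exact fun x y z _ _ _ h h' => h.trans h'
  · exact fun x y _ _ h => h.symm

end Surface

end LogAffine

end

/-! ### From the normal form to coordinates in which the structure is a model. -/

noncomputable section
open Set Metric
namespace LogAffine

/-- The combinations of the rows of a fundamental matrix are parallel forms. -/
lemma IsFundamental.isParallelAt_row {Γ : ConnForm} {A B F : C2 → End2} {ρ : ℝ} {N : End2}
    (hF : IsFundamental F A B ρ N) (hρ : 0 < ρ) (h : LogConnection Γ (ball 0 ρ) A B)
    (κ : C2 →L[ℂ] ℂ) {lift : C2 → C2} {q : C2} (hq : q ∈ ball (0 : C2) ρ)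
    (hlift : DifferentiableAt ℂ lift q) (he : ∀ᶠ r in 𝓝 q, expMap (lift r) = r) :
    IsParallelAt Γ (fun r => κ ∘L F (lift r)) q := by
  have hqe : expMap (lift q) = q := he.self_of_nhds
  have hc : lift q ∈ cover ρ := (expMap_mem_ball_iff hρ).1 (by rwa [hqe])
  obtain ⟨D, hD, hDv⟩ := hF.hasFDerivAt_row κ hc
  have h1 := hD.comp q hlift.hasFDerivAt
  have h1' : HasFDerivAt (fun r => κ ∘L F (lift r)) (D ∘L fderiv ℂ lift q) q := h1
  refine ⟨h1'.differentiableAt, fun v w => ?_⟩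
  have h2 := (hasFDerivAt_expMap (lift q)).comp q hlift.hasFDerivAt
  have h3 := congrArg (fun T : C2 →L[ℂ] C2 => T v)
    ((h2.congr_of_eventuallyEq (f₁ := id) (he.mono fun r hr => hr.symm)).unique (hasFDerivAt_id q))
  have h4 : expMapDeriv (lift q) (fderiv ℂ lift q v) = v := h3
  rw [h1'.fderiv, ContinuousLinearMap.comp_apply, hDv, coverForm_eq h hρ hc, hqe]
  change κ (F (lift q) (Γ q (expMapDeriv (lift q) (fderiv ℂ lift q v)) w)) = _
  rw [h4]
  rfl

lemma differentiableAt_modelOne (n : ℕ) {ℓ : ℂ → ℂ} (t : ℂ) {q : C2}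
    (hℓ : AnalyticAt ℂ ℓ q.2) : DifferentiableAt ℂ (modelOne n ℓ t) q := by
  have h1 : DifferentiableAt ℂ (fun q : C2 => ℓ q.2) q :=
    hℓ.differentiableAt.comp q differentiableAt_snd
  have h2 : DifferentiableAt ℂ (fun q : C2 => q.2 ^ n) q := differentiableAt_snd.pow n
  exact ((differentiableAt_const _).sub ((h2.mul h1).smul_const _)).add
    ((h2.const_mul t).smul_const _)

lemma differentiableAt_modelTwo (n : ℕ) (c : ℂ) {ℓ : ℂ → ℂ} (t : ℂ) {q : C2} (hq : q.2 ≠ 0)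
    (hℓ : AnalyticAt ℂ ℓ q.2) : DifferentiableAt ℂ (modelTwo n c ℓ t) q := by
  have h1 : DifferentiableAt ℂ (fun q : C2 => ℓ q.2) q :=
    hℓ.differentiableAt.comp q differentiableAt_snd
  have h2 : AnalyticAt ℂ (fun q : C2 => 1 / q.2 ^ n) q :=
    (analyticAt_const (v := (1 : ℂ))).fun_div (analyticAt_snd.fun_pow n) (pow_ne_zero n hq)
  have h3 : AnalyticAt ℂ (fun q : C2 => (c - q.1) / q.2) q :=
    ((analyticAt_const (v := c)).fun_sub analyticAt_fst).fun_div analyticAt_snd hq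
  exact ((((h1.smul_const _).neg).add (h2.differentiableAt.smul_const _)).add
    (h3.differentiableAt.smul_const _)).add (differentiableAt_const _)

section Surface

variable {S : Type*} [TopologicalSpace S] [ChartedSpace C2 S] [IsManifold 𝓘(ℂ, C2) ω S]
variable {A : MeromorphicAffineStructure S}

/-- At a smooth point of the divisor with parabolic monodromy, the structure is given by one of
the models. -/
theorem IsParabolicPoint.exists_model {p : S} (hp : IsParabolicPoint A p) :
    ∃ e : OpenPartialHomeomorph S C2, IsAdapted A.polar e p ∧
      ((∃ n : ℕ, A.IsGivenBy e (modelOne n)) ∨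
        ∃ n : ℕ, 0 < n ∧ ∃ c : ℂ, (c = 0 ∨ c = 1) ∧ A.IsGivenBy e (modelTwo n c)) := by
  obtain ⟨e, ρ, N, hρ, he, ⟨hsub, A', B', F₀, h, hb, hF₀⟩, P, hP, l, hl, hPN⟩ := hp
  -- Changing the basis of parallel forms by P puts the monodromy in Jordan form.
  have hF := hF₀.const_mul hP hPN
  set F : C2 → End2 := fun z => P * F₀ z with hFdef
  obtain ⟨s, X, L, η, hs, hX, hL, hX0, hX1, hη, hev⟩ := exists_normal_form hρ h hb hl hF
  obtain ⟨T, hT⟩ := exists_equiv_straighten hX hL hX1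
  set Ψ := straighten X L with hΨ
  have hcen := he.centred
  obtain ⟨e', he', hpe', hy⟩ := he.isCoord.exists_trans he.mem (Ψ := Ψ) (T := T)
    (by rw [hcen]; exact analyticAt_straighten hX hL) (by rw [hcen]; exact hT)
    (P := fun q => q ∈ ball (0 : C2) ρ ∧ (AnalyticAt ℂ X q ∧ AnalyticAt ℂ L q) ∧
      ∀ w, Complex.exp w = q.2 → ∀ t u, η (fun _ => w + L q) t (Ψ q) (fderiv ℂ Ψ q u) =
          s * ((F (q.1, w) u).2 + t * (F (q.1, w) u).1))
    (by
      rw [hcen]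
      exact Filter.eventually_and.2 ⟨isOpen_ball.mem_nhds (mem_ball_self hρ),
        (hX.eventually_analyticAt.and hL.eventually_analyticAt).and hev⟩)
  have had : IsAdapted A.polar e' p := by
    refine ⟨he', hpe', ?_, fun x hx => ?_⟩
    · rw [(hy p hpe').2.1, hcen]
      exact Prod.ext hX0 (by simp [hΨ, straighten])
    · rw [he.divisor x (hy x hx).1, (hy x hx).2.1]
      simp [hΨ, straighten]
  have hηloc : ∀ (ℓ : ℂ → ℂ) t q, η ℓ t q = η (fun _ => ℓ q.2) t q := by
    rcases hη with ⟨n, rfl⟩ | ⟨n, -, c, -, rfl⟩ <;> exact fun _ _ _ => rfl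
  have hηdiff : ∀ (ℓ : ℂ → ℂ) t (q : C2), q.2 ≠ 0 → AnalyticAt ℂ ℓ q.2 →
      DifferentiableAt ℂ (η ℓ t) q := by
    rcases hη with ⟨n, rfl⟩ | ⟨n, -, c, -, rfl⟩
    · exact fun ℓ t q _ hℓ => differentiableAt_modelOne n t hℓ
    · exact fun ℓ t q hq hℓ => differentiableAt_modelTwo n c t hq hℓ
  suffices hgiven : A.IsGivenBy e' η by
    refine ⟨e', had, ?_⟩
    rcases hη with ⟨n, rfl⟩ | ⟨n, hn, c, hc, rfl⟩
    · exact Or.inl ⟨n, hgiven⟩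
    · exact Or.inr ⟨n, hn, c, hc, hgiven⟩
  intro q' hq' hq'2 ℓ hℓ hexp
  set x := e'.symm q' with hx
  have hxs : x ∈ e'.source := e'.map_target hq'
  obtain ⟨hxe, hxΨ, hqρ, ⟨hXq, hLq⟩, -⟩ := hy x hxs
  set q := e x with hq
  have hqt : q ∈ e.target := e.map_source hxe
  have hqx : e.symm q = x := e.left_inv hxe
  have hΨq : Ψ q = q' := by rw [← hxΨ, hx, e'.right_inv hq']
  have hq2 : q.2 ≠ 0 := by
    intro h0
    apply hq'2
    rw [← hΨq]; simp [hΨ, straighten, h0]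
  have hpol : e.symm q ∉ A.polar := by
    rwa [hqx, he.divisor x hxe]
  have hqs' : e.symm q ∈ e'.source := by rwa [hqx]
  have he'q : e' (e.symm q) = q' := by rw [hqx, hxΨ, hΨq]
  have hΨa : AnalyticAt ℂ Ψ q := analyticAt_straighten hXq hLq
  have hnear : ∀ᶠ r in 𝓝 q, r ∈ e.target ∧ e.symm r ∈ e'.source :=
    Filter.eventually_and.2 ⟨e.open_target.mem_nhds hqt,
      (e.continuousAt_symm hqt).eventually_mem (e'.open_source.mem_nhds hqs')⟩
  -- As Y = y e^L, a branch ℓ of ln Y determines the branch ℓ - L of ln y at which F is evaluated.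
  set w : C2 → ℂ := fun r => ℓ (Ψ r).2 - L r with hw
  have hwexp : ∀ᶠ r in 𝓝 q, Complex.exp (w r) = r.2 := by
    have h1 : Filter.Tendsto (fun r => (Ψ r).2) (𝓝 q) (𝓝 q'.2) := by
      rw [← hΨq]; exact hΨa.continuousAt.snd
    filter_upwards [h1.eventually hexp] with r hr
    rw [hw]
    simp only
    rw [Complex.exp_sub, hr, hΨ]
    simp [straighten, Complex.exp_ne_zero]
  have hkey : ∀ᶠ r in 𝓝 q, ∀ t u, η ℓ t (Ψ r) (fderiv ℂ Ψ r u) =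
      s * ((F (r.1, w r) u).2 + t * (F (r.1, w r) u).1) := by
    filter_upwards [hnear, hwexp] with r hr hr2 t u
    have h1 := (hy _ hr.2).2.2.2.2
    rw [e.right_inv hr.1] at h1
    rw [hηloc, ← h1 (w r) hr2 t u, hw]
    simp
  have hwd : DifferentiableAt ℂ w q := by
    refine DifferentiableAt.sub ?_ hLq.differentiableAt
    exact (DifferentiableAt.comp (g := ℓ) (f := fun r => (Ψ r).2) q
      (by rw [hΨq]; exact hℓ.differentiableAt) hΨa.differentiableAt.snd)
  refine ⟨fun t => ?_, ?_⟩
  · have hpar := hF.isParallelAt_row hρ h (s • (dy + t • dx)) hqρ (lift := fun r => (r.1, w r))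
      (differentiableAt_fst.prodMk hwd) (hwexp.mono fun r hr => Prod.ext rfl hr)
    rw [← he'q]
    refine A.isParallelAt_of_pullback he.isCoord he' hqt hqs' hpol hpar
      (by rw [he'q]; exact hηdiff ℓ t q' hq'2 hℓ) ?_
    filter_upwards [hnear.eventually_nhds, hkey] with r hr hk
    have h1 : e' ∘ e.symm =ᶠ[𝓝 r] Ψ := hr.mono fun r' hr' => by
      rw [Function.comp_apply, (hy _ hr'.2).2.1, e.right_inv hr'.1]
    rw [h1.fderiv_eq, h1.self_of_nhds]
    refine ContinuousLinearMap.ext fun u => ?_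
    rw [ContinuousLinearMap.comp_apply (η ℓ t (Ψ r)), hk t u]
    simp
    ring
  · rw [LinearIndependent.pair_iff]
    intro a b hab
    have hc : (q.1, w q) ∈ cover ρ := by
      rw [← expMap_mem_ball_iff hρ,
        show expMap (q.1, w q) = q from Prod.ext rfl hwexp.self_of_nhds]
      exact hqρ
    -- Up to the factor s, the forms at t = 0 and t = 1 pull back to φ₂ and φ₂ + φ₁, so a relation
    -- a, b between them is b φ₁ + (a + b) φ₂ = 0.
    obtain ⟨h1, h2⟩ := hF.row_comb_ne_zero hc (a := b) (b := a + b) (by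
      refine ContinuousLinearMap.ext fun u => ?_
      have h3 := congrArg (fun T : C2 →L[ℂ] ℂ => T (fderiv ℂ Ψ q u)) hab
      simp only [add_apply, smul_apply, smul_eq_mul, zero_apply] at h3
      rw [← hΨq, hkey.self_of_nhds, hkey.self_of_nhds] at h3
      refine (mul_eq_zero.1 (?_ : s * _ = 0)).resolve_left hs
      simp only [add_apply, smul_apply, smul_eq_mul, ContinuousLinearMap.comp_apply,
        ContinuousLinearMap.coe_fst', ContinuousLinearMap.coe_snd']
      linear_combination h3)
    exact ⟨by simpa [h1] using h2, h1⟩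

end Surface

end LogAffine

end

/-! ### Zeros of a holomorphic function of one variable: residue formula and Hankel determinants. -/

noncomputable section
open Set Metric
namespace LogAffine

section OneVariable

/-- Extraction of a zero of an analytic function. -/
lemma exists_eq_pow_mul {f : ℂ → ℂ} {a : ℂ} {U : Set ℂ} (hf : AnalyticOnNhd ℂ f U) (ha : a ∈ U)
    (h0 : f a = 0) (hne : ¬ ∀ᶠ y in 𝓝 a, f y = 0) :
    ∃ (k : ℕ) (g : ℂ → ℂ), 0 < k ∧ AnalyticOnNhd ℂ g U ∧ g a ≠ 0 ∧
      ∀ y, y ≠ a → f y = (y - a) ^ k * g y := by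
  have hord : analyticOrderAt f a ≠ ⊤ := fun h => hne (analyticOrderAt_eq_top.1 h)
  obtain ⟨k, hk⟩ := ENat.ne_top_iff_exists.1 hord
  obtain ⟨h, hh, hha, hfh⟩ := ((hf a ha).analyticOrderAt_eq_natCast).1 hk.symm
  have hk0 : 0 < k := by
    rcases Nat.eq_zero_or_pos k with rfl | hk0
    · have := hfh.self_of_nhds
      simp [h0] at this
      exact absurd this.symm hha
    · exact hk0
  classical
  set g : ℂ → ℂ := fun y => if y = a then h a else f y / (y - a) ^ k with hg
  have hga : g =ᶠ[𝓝 a] h := by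
    filter_upwards [hfh] with y hy
    by_cases hya : y = a
    · simp [hg, hya]
    · have : (y - a) ^ k ≠ 0 := pow_ne_zero _ (sub_ne_zero.2 hya)
      simp [hg, hya, hy, this]
  refine ⟨k, g, hk0, fun y hy => ?_, by simpa [hg] using hha, fun y hy => ?_⟩
  · by_cases hya : y = a
    · rw [hya]; exact hh.congr hga.symm
    · refine AnalyticAt.congr (f := fun y => f y / (y - a) ^ k) ?_ ?_
      · exact (hf y hy).fun_div ((analyticAt_id.fun_sub analyticAt_const).fun_pow k)
          (pow_ne_zero _ (sub_ne_zero.2 hya))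
      · filter_upwards [isOpen_ne.mem_nhds hya] with z hz
        simp [hg, show z ≠ a from hz]
  · have : (y - a) ^ k ≠ 0 := pow_ne_zero _ (sub_ne_zero.2 hy)
    simp only [hg, if_neg hy]
    field_simp

/-- The residue formula for `P f' / f`. -/
lemma exists_circleIntegral_logDeriv {c : ℂ} {R : ℝ} (hR : 0 < R) (Z : Finset ℂ) :
    ∀ f : ℂ → ℂ, AnalyticOnNhd ℂ f (closedBall c R) →
    (∀ y ∈ closedBall c R, f y = 0 ↔ y ∈ Z) → (Z : Set ℂ) ⊆ ball c R →
    ∃ m : ℂ → ℕ, (∀ a ∈ Z, 0 < m a) ∧ ∀ P : ℂ → ℂ, Differentiable ℂ P →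
      (∮ y in C(c, R), P y * (deriv f y / f y)) =
        2 * Real.pi * Complex.I * ∑ a ∈ Z, m a * P a := by
  classical
  induction Z using Finset.induction_on with
  | empty =>
    intro f hf hz _
    refine ⟨fun _ => 0, by simp, fun P hP => ?_⟩
    rw [Finset.sum_empty, mul_zero]
    have h1 : DifferentiableOn ℂ (fun y => P y * (deriv f y / f y)) (closedBall c R) := by
      intro y hy
      exact ((hP y).fun_mul (((hf.deriv y hy).fun_div (hf y hy)
        (fun h => by simpa using (hz y hy).1 h)).differentiableAt)).differentiableWithinAt
    exact DiffContOnCl.circleIntegral_eq_zero hR.le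
      (DifferentiableOn.diffContOnCl (by rwa [closure_ball _ hR.ne']))
  | insert a Z haZ ih =>
    intro f hf hz hsub
    have hab : a ∈ ball c R := hsub (by simp)
    have hac : a ∈ closedBall c R := ball_subset_closedBall hab
    have hne : ¬ ∀ᶠ y in 𝓝 a, f y = 0 := by
      intro h
      have h1 : ∀ᶠ y in 𝓝[≠] a, y ∉ (insert a Z : Finset ℂ) := by
        have : ∀ᶠ y in 𝓝[≠] a, y ∉ ((insert a Z : Finset ℂ) : Set ℂ) \ {a} := by
          refine Filter.Eventually.filter_mono nhdsWithin_le_nhds ?_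
          exact (((Finset.finite_toSet _).subset sdiff_subset).isClosed.isOpen_compl.mem_nhds
            (by simp))
        filter_upwards [this, self_mem_nhdsWithin] with y hy hya hy'
        exact hy ⟨hy', hya⟩
      obtain ⟨y, hy1, hy2, hy3⟩ := (h1.and ((h.filter_mono nhdsWithin_le_nhds).and
        (Filter.Eventually.filter_mono nhdsWithin_le_nhds (isOpen_ball.mem_nhds hab)))).exists
      exact hy1 ((hz y (ball_subset_closedBall hy3)).1 hy2)
    obtain ⟨k, g, hk, hg, hga, hfg⟩ := exists_eq_pow_mul hf hac ((hz a hac).2 (by simp)) hne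
    have hgz : ∀ y ∈ closedBall c R, g y = 0 ↔ y ∈ Z := by
      intro y hy
      by_cases hya : y = a
      · rw [hya]; exact ⟨fun h => absurd h hga, fun h => absurd h haZ⟩
      · have h1 := hz y hy
        rw [hfg y hya, mul_eq_zero, Finset.mem_insert] at h1
        have h2 : (y - a) ^ k ≠ 0 := pow_ne_zero _ (sub_ne_zero.2 hya)
        tauto
    have hsub' : (Z : Set ℂ) ⊆ ball c R := fun y hy => hsub (by simp [Finset.mem_coe.1 hy])
    obtain ⟨m, hm, hmP⟩ := ih g hg hgz hsub'
    refine ⟨fun y => if y = a then k else m y, fun y hy => ?_, fun P hP => ?_⟩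
    · by_cases hya : y = a
      · simpa [hya] using hk
      · simpa [hya] using hm y (by simpa [hya] using hy)
    · have hsa : ∀ y ∈ sphere c R, y ≠ a := by
        rintro y hy rfl
        exact (mem_ball.1 hab).ne (mem_sphere.1 hy)
      have hsZ : ∀ y ∈ sphere c R, g y ≠ 0 := by
        intro y hy h
        have := hsub' ((hgz y (sphere_subset_closedBall hy)).1 h)
        exact (mem_ball.1 this).ne (mem_sphere.1 hy)
      -- Writing f = (y - a)^k g gives f'/f = k/(y - a) + g'/g: Cauchy's formula evaluates the first
      -- term, induction the second.
      have h1 : ∀ y ∈ sphere c R, P y * (deriv f y / f y) =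
          k * ((y - a)⁻¹ • P y) + P y * (deriv g y / g y) := by
        intro y hy
        have hya := sub_ne_zero.2 (hsa y hy)
        have h2 : f =ᶠ[𝓝 y] fun y => (y - a) ^ k * g y := by
          filter_upwards [isOpen_ne.mem_nhds (hsa y hy)] with z hz using hfg z hz
        have h3 : HasDerivAt (fun y => (y - a) ^ k * g y) _ y :=
          (((hasDerivAt_id y).sub_const a).fun_pow k).fun_mul
            (hg y (sphere_subset_closedBall hy)).differentiableAt.hasDerivAt
        rw [h2.deriv_eq, h3.deriv, hfg y (hsa y hy), smul_eq_mul]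
        have h4 := hsZ y hy
        obtain ⟨k', rfl⟩ : ∃ k', k = k' + 1 := ⟨k - 1, by omega⟩
        simp only [id, Nat.add_sub_cancel]
        field_simp
        ring
      have hPc : ContinuousOn P (sphere c R) := hP.continuous.continuousOn
      have hi1 : ContinuousOn (fun y => (y - a)⁻¹ • P y) (sphere c R) :=
        ((continuousOn_id.sub continuousOn_const).inv₀
          (fun y hy => sub_ne_zero.2 (hsa y hy))).smul hPc
      have hi1' : ContinuousOn (fun y => (k : ℂ) * ((y - a)⁻¹ • P y)) (sphere c R) :=
        continuousOn_const.mul hi1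
      have hi2 : ContinuousOn (fun y => P y * (deriv g y / g y)) (sphere c R) :=
        hPc.mul ((hg.deriv.continuousOn.mono sphere_subset_closedBall).div
          (hg.continuousOn.mono sphere_subset_closedBall) hsZ)
      rw [circleIntegral.integral_congr hR.le h1, circleIntegral.integral_add
        (hi1'.circleIntegrable hR.le) (hi2.circleIntegrable hR.le),
        circleIntegral.integral_const_mul, hmP P hP,
        (hP.diffContOnCl).circleIntegral_sub_inv_smul hab, Finset.sum_insert haZ]
      have h5 : ∑ y ∈ Z, (((if y = a then k else m y : ℕ) : ℂ)) * P y = ∑ y ∈ Z, (m y : ℂ) * P y :=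
        Finset.sum_congr rfl fun y hy => by
          rw [if_neg (fun h : y = a => haZ (h ▸ hy))]
      rw [h5]
      simp only [if_true, smul_eq_mul]
      ring

lemma finite_zeros {c : ℂ} {R : ℝ} (hR : 0 < R) {f : ℂ → ℂ} (hf : AnalyticOnNhd ℂ f (closedBall c R))
    (hs : ∀ y ∈ sphere c R, f y ≠ 0) : {y | y ∈ closedBall c R ∧ f y = 0}.Finite := by
  by_contra hinf
  obtain ⟨z, hz, hacc⟩ := Set.Infinite.exists_accPt_of_subset_isCompact hinf
    (isCompact_closedBall c R) fun y hy => hy.1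
  have h1 := hf.eqOn_zero_of_preconnected_of_frequently_eq_zero
    (convex_closedBall c R).isPreconnected hz
    ((accPt_iff_frequently_nhdsNE.1 hacc).mono fun y hy => hy.2)
  obtain ⟨y, hy⟩ := (NormedSpace.sphere_nonempty (x := c)).2 hR.le
  exact hs y hy (h1 (sphere_subset_closedBall hy))

end OneVariable

section Hankel

open Polynomial in
/-- A Hankel determinant detects the number of atoms. -/
lemma det_hankel_ne_zero_of_card {Z : Finset ℂ} {m : ℂ → ℕ} (hm : ∀ a ∈ Z, 0 < m a) {κ : ℂ}
    (hκ : κ ≠ 0) : (Matrix.of fun i j : Fin Z.card =>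
      κ * ∑ a ∈ Z, (m a : ℂ) * a ^ (i + j : ℕ)).det ≠ 0 := by
  classical
  intro hdet
  obtain ⟨v, hv, hMv⟩ := Matrix.exists_mulVec_eq_zero_iff.2 hdet
  -- A kernel vector is read as a polynomial P of degree less than |Z|, orthogonal to all such
  -- polynomials for the weights m. Testing against the Lagrange basis gives P = 0 on Z, hence P =
  -- 0.
  set P : ℂ[X] := ∑ j : Fin Z.card, C (v j) * X ^ (j : ℕ) with hP
  have hPdeg : P.degree < Z.card := by
    rw [hP]
    refine (degree_sum_fin_lt _)
  have hsum : ∀ i : Fin Z.card, ∑ a ∈ Z, (m a : ℂ) * (a ^ (i : ℕ) * P.eval a) = 0 := by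
    intro i
    have h1 := congrFun hMv i
    simp only [Matrix.mulVec, dotProduct, Matrix.of_apply, Pi.zero_apply] at h1
    have h2 : κ * ∑ a ∈ Z, (m a : ℂ) * (a ^ (i : ℕ) * P.eval a) = 0 := by
      rw [← h1, Finset.mul_sum]
      simp_rw [Finset.mul_sum, Finset.sum_mul]
      rw [Finset.sum_comm]
      refine Finset.sum_congr rfl fun a _ => ?_
      rw [hP, eval_finsetSum, Finset.mul_sum, Finset.mul_sum, Finset.mul_sum]
      refine Finset.sum_congr rfl fun j _ => ?_
      simp only [eval_mul, eval_C, eval_pow, eval_X, pow_add]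
      ring
    exact (mul_eq_zero.1 h2).resolve_left hκ
  have hQ : ∀ Q : ℂ[X], Q.natDegree < Z.card →
      ∑ a ∈ Z, (m a : ℂ) * (Q.eval a * P.eval a) = 0 := by
    intro Q hQ
    simp_rw [eval_eq_sum_range' hQ, Finset.sum_mul, Finset.mul_sum]
    rw [Finset.sum_comm]
    refine Finset.sum_eq_zero fun i hi => ?_
    have h1 := hsum ⟨i, Finset.mem_range.1 hi⟩
    have h2 := congrArg (fun z => Q.coeff i * z) h1
    simp only [Finset.mul_sum, mul_zero] at h2
    rw [← h2]
    exact Finset.sum_congr rfl fun a _ => by ring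
  have hzero : ∀ b ∈ Z, P.eval b = 0 := by
    intro b hb
    have hpos : 0 < Z.card := Finset.card_pos.2 ⟨b, hb⟩
    have hinj : Set.InjOn (id : ℂ → ℂ) Z := Function.injective_id.injOn
    have h1 := hQ (Lagrange.basis Z id b) (by
      rw [Lagrange.natDegree_basis hinj hb]; omega)
    rw [Finset.sum_eq_single b] at h1
    · have h2 : (Lagrange.basis Z id b).eval b = 1 := Lagrange.eval_basis_self hinj hb
      rw [h2, one_mul] at h1
      exact (mul_eq_zero.1 h1).resolve_left (by exact_mod_cast (hm b hb).ne')
    · intro a ha hab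
      have h2 : (Lagrange.basis Z id b).eval a = 0 := Lagrange.eval_basis_of_ne (v := id) hab.symm ha
      rw [h2, zero_mul, mul_zero]
    · exact fun h => absurd hb h
  have hP0 : P = 0 := Polynomial.eq_zero_of_degree_lt_of_eval_finset_eq_zero Z hPdeg hzero
  refine hv (funext fun j => ?_)
  have h1 : P.coeff j = v j := by
    rw [hP]
    simp [coeff_C_mul, coeff_X_pow, Fin.val_inj]
  rw [← h1, hP0, coeff_zero, Pi.zero_apply]

-- The coefficients of the polynomial with simple roots at Z form a nonzero kernel vector as soon as
-- the matrix has size greater than |Z|.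
open Polynomial in
lemma det_hankel_eq_zero_of_card_lt {Z : Finset ℂ} {m : ℂ → ℕ} {κ : ℂ} {n : ℕ} (hn : Z.card < n) :
    (Matrix.of fun i j : Fin n => κ * ∑ a ∈ Z, (m a : ℂ) * a ^ (i + j : ℕ)).det = 0 := by
  classical
  set P : ℂ[X] := Lagrange.nodal Z id with hP
  have hdeg : P.natDegree < n := by rw [hP, Lagrange.natDegree_nodal]; exact hn
  refine Matrix.exists_mulVec_eq_zero_iff.1 ⟨fun j => P.coeff j, fun h => ?_, funext fun i => ?_⟩
  · have h1 := congrFun h ⟨P.natDegree, hdeg⟩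
    have h2 : P.coeff P.natDegree = 1 := Lagrange.nodal_monic
    simp [h2] at h1
  · have h3 : ∀ a ∈ Z, ∑ j : Fin n, P.coeff j * a ^ (j : ℕ) = 0 := fun a ha => by
      have h4 : P.eval a = 0 := Lagrange.eval_nodal_at_node (v := id) ha
      rw [eval_eq_sum_range' hdeg, ← Fin.sum_univ_eq_sum_range (fun j => P.coeff j * a ^ j)] at h4
      exact h4
    simp only [Matrix.mulVec, dotProduct, Matrix.of_apply, Pi.zero_apply]
    simp_rw [Finset.mul_sum, Finset.sum_mul]
    rw [Finset.sum_comm]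
    refine Finset.sum_eq_zero fun a ha => ?_
    have h5 := congrArg (fun z => κ * (m a * a ^ (i : ℕ)) * z) (h3 a ha)
    simp only [Finset.mul_sum, mul_zero] at h5
    rw [← h5]
    exact Finset.sum_congr rfl fun j _ => by rw [pow_add]; ring

end Hankel

end LogAffine

end

/-! ### Zeros depending on a parameter; singularities of a plane analytic curve are isolated. -/

noncomputable section
open Set Metric
namespace LogAffine

/-- On the line over `x`, the function `f` is analytic on a closed disc and has no zeros on its
boundary. -/
structure IsGoodDisc (f : C2 → ℂ) (c : ℂ) (R : ℝ) (x : ℂ) : Prop where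
  pos : 0 < R
  analytic : ∀ y ∈ closedBall c R, AnalyticAt ℂ f (x, y)
  ne_zero : ∀ y ∈ sphere c R, f (x, y) ≠ 0

/-- Moments of the zeros in a disc of the line over `x`. -/
def zeroMoment (f : C2 → ℂ) (c : ℂ) (R : ℝ) (P : ℂ → ℂ) (x : ℂ) : ℂ :=
  ∮ y in C(c, R), P y * (fderiv ℂ f (x, y) (0, 1) / f (x, y))

/-- The zeros in a disc of the line over `x`. -/
def zerosIn (f : C2 → ℂ) (c : ℂ) (R : ℝ) (x : ℂ) : Set ℂ := {y | y ∈ ball c R ∧ f (x, y) = 0}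

variable {f : C2 → ℂ} {c : ℂ} {R : ℝ} {x : ℂ}

lemma IsGoodDisc.eventually (h : IsGoodDisc f c R x) : ∀ᶠ x' in 𝓝 x, IsGoodDisc f c R x' := by
  have h1 : ∀ᶠ x' in 𝓝 x, ∀ y ∈ closedBall c R, AnalyticAt ℂ f (x', y) :=
    eventually_forall_mem_of_isCompact (isCompact_closedBall _ _) fun y hy =>
      (h.analytic y hy).eventually_analyticAt
  have h2 : ∀ᶠ x' in 𝓝 x, ∀ y ∈ sphere c R, f (x', y) ≠ 0 :=
    eventually_forall_mem_of_isCompact (p := fun q => f q ≠ 0) (isCompact_sphere _ _) fun y hy =>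
      (h.analytic y (sphere_subset_closedBall hy)).continuousAt.eventually_ne (h.ne_zero y hy)
  filter_upwards [h1, h2] with x' h1 h2 using ⟨h.pos, h1, h2⟩

lemma IsGoodDisc.analyticOnNhd (h : IsGoodDisc f c R x) :
    AnalyticOnNhd ℂ (fun y => f (x, y)) (closedBall c R) := fun y hy =>
  AnalyticAt.snd_slice (h.analytic y hy)

lemma IsGoodDisc.finite_zerosIn (h : IsGoodDisc f c R x) : (zerosIn f c R x).Finite :=
  (finite_zeros h.pos h.analyticOnNhd h.ne_zero).subset fun _ hy =>
    ⟨ball_subset_closedBall hy.1, hy.2⟩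

lemma IsGoodDisc.exists_zeroMoment (h : IsGoodDisc f c R x) {Z : Finset ℂ}
    (hZ : (Z : Set ℂ) = zerosIn f c R x) :
    ∃ m : ℂ → ℕ, (∀ a ∈ Z, 0 < m a) ∧ ∀ P : ℂ → ℂ, Differentiable ℂ P →
      zeroMoment f c R P x = 2 * Real.pi * Complex.I * ∑ a ∈ Z, m a * P a := by
  obtain ⟨m, hm, hmP⟩ := exists_circleIntegral_logDeriv h.pos Z (fun y => f (x, y))
    h.analyticOnNhd (fun y hy => by
      rw [← Finset.mem_coe, hZ]
      refine ⟨fun h0 => ⟨?_, h0⟩, fun h0 => h0.2⟩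
      rcases (mem_closedBall.1 hy).lt_or_eq with h1 | h1
      · exact h1
      · exact absurd h0 (h.ne_zero y h1)) (by rw [hZ]; exact fun y hy => hy.1)
  refine ⟨m, hm, fun P hP => ?_⟩
  rw [← hmP P hP, zeroMoment]
  refine circleIntegral.integral_congr h.pos.le fun y hy => ?_
  have h1 : HasDerivAt (fun y => f (x, y)) (fderiv ℂ f (x, y) (0, 1)) y :=
    (h.analytic y (sphere_subset_closedBall hy)).differentiableAt.hasFDerivAt.comp_hasDerivAt y
      ((hasDerivAt_const y x).prodMk (hasDerivAt_id y))
  simp only [h1.deriv]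

/-- The integrand is analytic near the circle, where f has no zeros, so the integral is holomorphic
in the parameter. -/
lemma IsGoodDisc.analyticAt_zeroMoment (h : IsGoodDisc f c R x) {P : ℂ → ℂ}
    (hP : Differentiable ℂ P) : AnalyticAt ℂ (zeroMoment f c R P) x := by
  have key : ∀ x', IsGoodDisc f c R x' → DifferentiableAt ℂ (zeroMoment f c R P) x' := by
    intro x' h'
    refine differentiableAt_integral_path
      (Φ := fun q : C2 => P q.2 * (fderiv ℂ f q (0, 1) / f q)) (continuous_circleMap c R)
      (c := deriv (circleMap c R)) ?_ fun t _ => ?_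
    · have h1 : deriv (circleMap c R) = fun θ => circleMap 0 R θ * Complex.I := by
        funext θ; exact deriv_circleMap c R θ
      rw [h1]
      exact (continuous_circleMap 0 R).mul continuous_const
    · have hs : circleMap c R t ∈ sphere c R := circleMap_mem_sphere c h'.pos.le t
      have h1 := h'.analytic _ (sphere_subset_closedBall hs)
      have h2 : AnalyticAt ℂ (fun q : C2 => P q.2) (x', circleMap c R t) :=
        AnalyticAt.comp (g := P) (f := Prod.snd)
          (hP.analyticAt _) analyticAt_snd
      exact h2.fun_mul ((analyticAt_clm_apply h1.fderiv analyticAt_const).fun_div h1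
        (h'.ne_zero _ hs))
  obtain ⟨U, hU, hUo, hxU⟩ := _root_.eventually_nhds_iff.1 h.eventually
  exact DifferentiableOn.analyticAt (s := U)
    (fun x' hx' => (key x' (hU x' hx')).differentiableWithinAt) (hUo.mem_nhds hxU)

/-- The Hankel determinant of the moments. -/
def hankelDet (f : C2 → ℂ) (c : ℂ) (R : ℝ) (n : ℕ) (x : ℂ) : ℂ :=
  (Matrix.of fun i j : Fin n => zeroMoment f c R (fun y => y ^ (i + j : ℕ)) x).det

lemma IsGoodDisc.analyticAt_hankelDet (h : IsGoodDisc f c R x) (n : ℕ) :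
    AnalyticAt ℂ (hankelDet f c R n) x := by
  have h1 : hankelDet f c R n = fun x => ∑ σ : Equiv.Perm (Fin n), ((Equiv.Perm.sign σ : ℤ) : ℂ) *
      ∏ i, zeroMoment f c R (fun y => y ^ ((σ i : Fin n) + i : ℕ)) x := by
    funext x
    rw [hankelDet, Matrix.det_apply']
    rfl
  rw [h1]
  refine Finset.analyticAt_fun_sum _ fun σ _ => analyticAt_const.fun_mul
    (Finset.analyticAt_fun_prod _ fun i _ => h.analyticAt_zeroMoment (differentiable_pow _))

lemma IsGoodDisc.hankelDet_eq (h : IsGoodDisc f c R x) : ∃ m : ℂ → ℕ,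
    (∀ a ∈ h.finite_zerosIn.toFinset, 0 < m a) ∧ ∀ n, hankelDet f c R n x =
      (Matrix.of fun i j : Fin n => (2 * Real.pi * Complex.I : ℂ) *
        ∑ a ∈ h.finite_zerosIn.toFinset, (m a : ℂ) * a ^ (i + j : ℕ)).det := by
  obtain ⟨m, hm, hmP⟩ := h.exists_zeroMoment h.finite_zerosIn.coe_toFinset
  refine ⟨m, hm, fun n => ?_⟩
  rw [hankelDet]
  congr 1
  ext i j
  exact hmP _ (differentiable_pow _)

lemma IsGoodDisc.hankelDet_ncard_ne_zero (h : IsGoodDisc f c R x) {n : ℕ}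
    (hn : (zerosIn f c R x).ncard = n) : hankelDet f c R n x ≠ 0 := by
  obtain ⟨m, hm, hd⟩ := h.hankelDet_eq
  rw [Set.ncard_eq_toFinset_card _ h.finite_zerosIn] at hn
  subst hn
  rw [hd]
  exact det_hankel_ne_zero_of_card hm Complex.two_pi_I_ne_zero

lemma IsGoodDisc.le_ncard (h : IsGoodDisc f c R x) {n : ℕ} (hn : hankelDet f c R n x ≠ 0) :
    n ≤ (zerosIn f c R x).ncard := by
  obtain ⟨m, hm, hd⟩ := h.hankelDet_eq
  by_contra! hlt
  rw [Set.ncard_eq_toFinset_card _ h.finite_zerosIn] at hlt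
  exact hn ((hd n).trans (det_hankel_eq_zero_of_card_lt hlt))

/-- The zeroth moment is 2πi times the number of zeros with multiplicity. Being continuous in x, it
bounds the number of distinct zeros uniformly nearby. -/
lemma IsGoodDisc.ncard_le (h : IsGoodDisc f c R x) :
    ((zerosIn f c R x).ncard : ℝ) ≤ ‖zeroMoment f c R (fun _ => 1) x‖ := by
  obtain ⟨m, hm, hmP⟩ := h.exists_zeroMoment h.finite_zerosIn.coe_toFinset
  rw [hmP _ (differentiable_const _), Set.ncard_eq_toFinset_card _ h.finite_zerosIn]
  set Z := h.finite_zerosIn.toFinset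
  have h1 : ∑ a ∈ Z, (m a : ℂ) * 1 = ((∑ a ∈ Z, m a : ℕ) : ℂ) := by push_cast; simp
  have h2 : Z.card ≤ ∑ a ∈ Z, m a := by
    rw [Finset.card_eq_sum_ones]; exact Finset.sum_le_sum hm
  have h3 : (Z.card : ℝ) ≤ ((∑ a ∈ Z, m a : ℕ) : ℝ) := by exact_mod_cast h2
  rw [h1, norm_mul, Complex.norm_natCast]
  have h4 : ‖(2 * Real.pi * Complex.I : ℂ)‖ = 2 * Real.pi := by
    simp [abs_of_pos Real.pi_pos]
  rw [h4]
  nlinarith [Real.pi_gt_three, Nat.cast_nonneg (α := ℝ) Z.card]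

/-- The number of distinct zeros is constant near a point, except perhaps at the point. -/
lemma IsGoodDisc.eventually_ncard_eq (h : IsGoodDisc f c R x) :
    ∃ n, ∀ᶠ x' in 𝓝[≠] x, (zerosIn f c R x').ncard = n := by
  classical
  set p : ℕ → Prop := fun n => ∃ᶠ x' in 𝓝[≠] x, n ≤ (zerosIn f c R x').ncard with hp
  have hgood : ∀ᶠ x' in 𝓝[≠] x, IsGoodDisc f c R x' := h.eventually.filter_mono nhdsWithin_le_nhds
  obtain ⟨K, hK⟩ : ∃ K : ℕ, ∀ᶠ x' in 𝓝[≠] x, (zerosIn f c R x').ncard ≤ K := by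
    obtain ⟨K, hK⟩ := exists_nat_gt ‖zeroMoment f c R (fun _ => 1) x‖
    refine ⟨K, ?_⟩
    filter_upwards [hgood, ((h.analyticAt_zeroMoment
      (differentiable_const (1 : ℂ))).continuousAt.norm.eventually_lt_const hK).filter_mono
      nhdsWithin_le_nhds] with x' h1 h2
    exact_mod_cast (h1.ncard_le.trans h2.le)
  have hp0 : p 0 := Filter.Eventually.frequently (Filter.Eventually.of_forall fun _ => Nat.zero_le _)
  -- n is the largest number such that at least n distinct zeros occur arbitrarily close to x. The
  -- n-th Hankel determinant is nonzero at such points, so as an analytic function it has no other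
  -- zero near x except perhaps x itself, and its non-vanishing forces at least n zeros.
  have hpm : p (Nat.findGreatest p K) := Nat.findGreatest_spec (Nat.zero_le K) hp0
  set n := Nat.findGreatest p K
  have hnot : ¬ p (n + 1) := by
    intro h1
    by_cases hle : n + 1 ≤ K
    · exact absurd (Nat.le_findGreatest hle h1) (by omega)
    · obtain ⟨x', h2, h3⟩ := (h1.and_eventually hK).exists
      omega
  have hle : ∀ᶠ x' in 𝓝[≠] x, (zerosIn f c R x').ncard ≤ n := by
    filter_upwards [Filter.not_frequently.1 hnot] with x' hx'
    omega
  have hdet : ∀ᶠ x' in 𝓝[≠] x, hankelDet f c R n x' ≠ 0 := by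
    refine (h.analyticAt_hankelDet n).eventually_eq_zero_or_eventually_ne_zero.resolve_left ?_
    intro h0
    obtain ⟨x', h1, h2, h3, h4⟩ := (hpm.and_eventually (hle.and (hgood.and
      (h0.filter_mono nhdsWithin_le_nhds)))).exists
    exact h3.hankelDet_ncard_ne_zero (le_antisymm h2 h1) h4
  refine ⟨n, ?_⟩
  filter_upwards [hle, hdet, hgood] with x' h1 h2 h3
  exact le_antisymm h1 (h3.le_ncard h2)

/-- Where the number of distinct zeros is locally constant, the zeros are graphs. -/
lemma IsGoodDisc.exists_graph (h : IsGoodDisc f c R x)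
    (hn : ∀ᶠ x' in 𝓝 x, (zerosIn f c R x').ncard = (zerosIn f c R x).ncard) {y₀ : ℂ}
    (hy₀ : y₀ ∈ zerosIn f c R x) :
    ∃ g : ℂ → ℂ, AnalyticAt ℂ g x ∧ ∀ᶠ q in 𝓝 ((x, y₀) : C2), f q = 0 ↔ q.2 = g q.1 := by
  classical
  set Z := h.finite_zerosIn.toFinset with hZ
  have hmem : ∀ y, y ∈ Z ↔ y ∈ zerosIn f c R x := fun y => h.finite_zerosIn.mem_toFinset
  obtain ⟨η, hη0, hη⟩ : ∃ η > 0, ∀ a ∈ Z, closedBall a η ⊆ ball c R ∧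
      ∀ b ∈ Z, a ≠ b → 2 * η < dist a b := by
    have h1 : ∀ᶠ η in 𝓝[>] (0 : ℝ), ∀ a ∈ Z, closedBall a η ⊆ ball c R ∧
        ∀ b ∈ Z, a ≠ b → 2 * η < dist a b := by
      rw [Filter.eventually_all_finset]
      intro a ha
      refine Filter.Eventually.and ?_ ?_
      · have h2 : 0 < R - dist a c := sub_pos.2 (mem_ball.1 ((hmem a).1 ha).1)
        filter_upwards [Ioo_mem_nhdsGT h2] with η hη
        refine closedBall_subset_ball' ?_
        linarith [hη.2]
      · rw [Filter.eventually_all_finset]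
        intro b hb
        by_cases hab : a = b
        · exact Filter.Eventually.of_forall fun _ h => absurd hab h
        · have h2 : 0 < dist a b / 2 := half_pos (dist_pos.2 hab)
          filter_upwards [Ioo_mem_nhdsGT h2] with η hη _
          linarith [hη.2]
    obtain ⟨η, h2, h3⟩ := (h1.and self_mem_nhdsWithin).exists
    exact ⟨η, h3, h2⟩
  have hgood : ∀ a ∈ Z, IsGoodDisc f a η x := by
    intro a ha
    refine ⟨hη0, fun y hy => h.analytic y (ball_subset_closedBall ((hη a ha).1 hy)),
      fun y hy h0 => ?_⟩
    have hyZ : y ∈ Z := (hmem y).2 ⟨(hη a ha).1 (sphere_subset_closedBall hy), h0⟩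
    have hd : dist y a = η := hy
    have hne : y ≠ a := by
      rintro rfl
      rw [dist_self] at hd
      exact hη0.ne hd
    have := (hη y hyZ).2 a ha hne
    linarith
  have hex : ∀ᶠ x' in 𝓝 x, ∀ a ∈ Z, ∃ y ∈ ball a η, f (x', y) = 0 := by
    rw [Filter.eventually_all_finset]
    intro a ha
    exact eventually_exists_zero hη0 (hgood a ha).analytic ((hmem a).1 ha).2 (hgood a ha).ne_zero
  have hy₀Z : y₀ ∈ Z := (hmem y₀).2 hy₀
  -- Each of the disjoint discs around the zeros over x contains at least one zero over x'. The
  -- total number being unchanged, each contains exactly one.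
  have huniq : ∀ᶠ x' in 𝓝 x, ∃ z, zerosIn f y₀ η x' = {z} := by
    filter_upwards [hex, hn, h.eventually] with x' h1 h2 h3
    choose! z hz hfz using h1
    have hinj : Set.InjOn z Z := by
      intro a ha b hb hab
      by_contra hne
      have h4 := (hη a ha).2 b hb hne
      have h5 := mem_ball'.1 (hz a ha)
      have h6 := mem_ball.1 (hz b hb)
      rw [← hab] at h6
      linarith [dist_triangle a (z a) b]
    have hsub : Z.image z ⊆ h3.finite_zerosIn.toFinset := by
      intro y hy
      obtain ⟨a, ha, rfl⟩ := Finset.mem_image.1 hy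
      exact h3.finite_zerosIn.mem_toFinset.2
        ⟨(hη a ha).1 (ball_subset_closedBall (hz a ha)), hfz a ha⟩
    rw [Set.ncard_eq_toFinset_card _ h3.finite_zerosIn,
      Set.ncard_eq_toFinset_card _ h.finite_zerosIn] at h2
    have heq := Finset.eq_of_subset_of_card_le hsub
      (by rw [Finset.card_image_of_injOn hinj, h2])
    refine ⟨z y₀, Set.eq_singleton_iff_unique_mem.2 ⟨⟨hz _ hy₀Z, hfz _ hy₀Z⟩, fun y hy => ?_⟩⟩
    have hyZ : y ∈ Z.image z := by
      rw [heq]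
      exact h3.finite_zerosIn.mem_toFinset.2
        ⟨(hη _ hy₀Z).1 (ball_subset_closedBall hy.1), hy.2⟩
    obtain ⟨a, ha, rfl⟩ := Finset.mem_image.1 hyZ
    by_contra hne
    have hay : a ≠ y₀ := fun h => hne (by rw [h])
    have h4 := (hη a ha).2 y₀ hy₀Z hay
    have h5 := mem_ball'.1 (hz a ha)
    have h6 := mem_ball.1 hy.1
    linarith [dist_triangle a (z a) y₀]
  have hgy := hgood y₀ hy₀Z
  have hratio : ∀ x', IsGoodDisc f y₀ η x' → ∀ z, zerosIn f y₀ η x' = {z} →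
      zeroMoment f y₀ η (fun _ => 1) x' ≠ 0 ∧
      zeroMoment f y₀ η id x' / zeroMoment f y₀ η (fun _ => 1) x' = z := by
    intro x' h1 z hz
    obtain ⟨m, hm, hmP⟩ := h1.exists_zeroMoment (Z := {z}) (by rw [hz]; simp)
    have hm0 : (m z : ℂ) ≠ 0 := by exact_mod_cast (hm z (by simp)).ne'
    have hpi := Complex.two_pi_I_ne_zero
    rw [hmP _ (differentiable_const _), hmP _ differentiable_id, Finset.sum_singleton,
      Finset.sum_singleton, mul_one]
    refine ⟨mul_ne_zero hpi hm0, ?_⟩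
    rw [← mul_assoc, id, mul_div_cancel_left₀ _ (mul_ne_zero hpi hm0)]
  -- With a single zero in the disc, first moment over zeroth moment is that zero, the multiplicity
  -- cancelling; hence the zero depends analytically on the parameter.
  refine ⟨fun x' => zeroMoment f y₀ η id x' / zeroMoment f y₀ η (fun _ => 1) x', ?_, ?_⟩
  · obtain ⟨z, hz⟩ := huniq.self_of_nhds
    exact (hgy.analyticAt_zeroMoment differentiable_id).fun_div
      (hgy.analyticAt_zeroMoment (differentiable_const _)) (hratio x hgy z hz).1
  · have h1 : Filter.Tendsto (Prod.fst : C2 → ℂ) (𝓝 (x, y₀)) (𝓝 x) :=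
      continuous_fst.tendsto _
    have h2 : ∀ᶠ q in 𝓝 ((x, y₀) : C2), q.2 ∈ ball y₀ η :=
      (continuous_snd.tendsto _).eventually (isOpen_ball.mem_nhds (mem_ball_self hη0))
    filter_upwards [h1.eventually huniq, h1.eventually hgy.eventually, h2] with q ⟨z, hz⟩ h3 h4
    rw [(hratio _ h3 z hz).2, ← Set.mem_singleton_iff (a := q.2), ← hz]
    exact ⟨fun h => ⟨h4, h⟩, fun h => h.2⟩

/-- The singularities of a plane analytic curve are isolated. -/
theorem eventually_exists_graph {f : C2 → ℂ} (hf : AnalyticAt ℂ f 0)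
    (hne : ¬ ∀ᶠ y in 𝓝 (0 : ℂ), f (0, y) = 0) :
    ∀ᶠ p in 𝓝 (0 : C2), p ≠ 0 → f p = 0 →
      ∃ g : ℂ → ℂ, AnalyticAt ℂ g p.1 ∧ ∀ᶠ q in 𝓝 p, f q = 0 ↔ q.2 = g q.1 := by
  have hslice : AnalyticAt ℂ (fun y => f (0, y)) 0 := AnalyticAt.snd_slice hf
  have h1 := hslice.eventually_eq_zero_or_eventually_ne_zero.resolve_left hne
  rw [eventually_nhdsWithin_iff] at h1
  have h2 : ∀ᶠ y in 𝓝 (0 : ℂ), AnalyticAt ℂ f (0, y) :=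
    (Continuous.tendsto (by fun_prop : Continuous fun y : ℂ => ((0, y) : C2)) 0).eventually
      hf.eventually_analyticAt
  obtain ⟨δ, hδ, hδ'⟩ := Metric.nhds_basis_closedBall.mem_iff.1 (Filter.inter_mem h1 h2)
  have hgood : IsGoodDisc f 0 δ 0 := by
    refine ⟨hδ, fun y hy => (hδ' hy).2, fun y hy => (hδ' (sphere_subset_closedBall hy)).1 ?_⟩
    rintro rfl
    simp at hy
    exact hδ.ne hy
  obtain ⟨n, hn⟩ := hgood.eventually_ncard_eq
  have hn' : ∀ᶠ x in 𝓝 (0 : ℂ), x ≠ 0 → ∀ᶠ x' in 𝓝 x, (zerosIn f 0 δ x').ncard = n := by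
    rw [← eventually_eventually_nhdsWithin, eventually_nhdsWithin_iff] at hn
    filter_upwards [hn] with x hx hx0
    have := hx hx0
    rwa [isOpen_compl_singleton.nhdsWithin_eq hx0] at this
  have hfst : Filter.Tendsto (Prod.fst : C2 → ℂ) (𝓝 0) (𝓝 0) := continuous_fst.tendsto 0
  have hball : ∀ᶠ p in 𝓝 (0 : C2), p.2 ∈ ball (0 : ℂ) δ :=
    (continuous_snd.tendsto (0 : C2)).eventually (isOpen_ball.mem_nhds (mem_ball_self hδ))
  filter_upwards [hfst.eventually hn', hfst.eventually hgood.eventually, hball]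
    with p h3 h4 h5 hp0 hfp
  -- On the line x = 0 the origin is the only zero in the disc, so every other nearby point of the
  -- curve lies over some x ≠ 0, where the count is locally constant.
  have hp1 : p.1 ≠ 0 := by
    intro hp1
    have hp2 : p.2 ≠ 0 := fun hp2 => hp0 (Prod.ext hp1 hp2)
    refine (hδ' (ball_subset_closedBall h5)).1 hp2 ?_
    rwa [show ((0 : ℂ), p.2) = p from Prod.ext hp1.symm rfl]
  have h6 := h3 hp1
  rw [← h6.self_of_nhds] at h6
  exact h4.exists_graph h6 ⟨h5, hfp⟩

end LogAffine

end

/-! ### The singular points of the polar divisor are isolated. -/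

noncomputable section
open Set Metric
namespace LogAffine

lemma exists_equiv_of_injective {T : End2} (h : ∀ u, T u = 0 → u = 0) :
    ∃ e : C2 ≃L[ℂ] C2, (e : C2 →L[ℂ] C2) = T := by
  have hinj : Function.Injective (T : C2 →ₗ[ℂ] C2) := by
    rw [← LinearMap.ker_eq_bot, LinearMap.ker_eq_bot']
    exact h
  exact ⟨(LinearEquiv.ofInjectiveEndo (T : C2 →ₗ[ℂ] C2) hinj).toContinuousLinearEquiv, rfl⟩

lemma exists_equiv_apply_eq {v : C2} (hv : v ≠ 0) : ∃ e : C2 ≃L[ℂ] C2, e (0, 1) = v := by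
  obtain ⟨w, hw⟩ : ∃ w : C2, ∀ x y : ℂ, x • w + y • v = 0 → x = 0 ∧ y = 0 := by
    by_cases h2 : v.2 = 0
    · have h1 : v.1 ≠ 0 := fun h1 => hv (Prod.ext h1 h2)
      refine ⟨(0, 1), fun x y h => ?_⟩
      have e1 := congrArg Prod.fst h
      have e2 := congrArg Prod.snd h
      simp [h2] at e1 e2
      exact ⟨e2, e1.resolve_right h1⟩
    · refine ⟨(1, 0), fun x y h => ?_⟩
      have e1 := congrArg Prod.fst h
      have e2 := congrArg Prod.snd h
      simp [h2] at e1 e2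
      simpa [e2] using e1
  set T : End2 := (ContinuousLinearMap.fst ℂ ℂ ℂ).smulRight w +
    (ContinuousLinearMap.snd ℂ ℂ ℂ).smulRight v
  obtain ⟨e, he⟩ := exists_equiv_of_injective (T := T) fun u hu => by
    obtain ⟨h1, h2⟩ := hw u.1 u.2 hu
    exact Prod.ext h1 h2
  refine ⟨e, ?_⟩
  have h1 : e (0, 1) = T (0, 1) := congrArg (fun T : C2 →L[ℂ] C2 => T (0, 1)) he
  rw [h1]
  simp [T]

/-- A function which does not vanish near a point does not vanish along some line. -/
lemma exists_line_ne_zero {f : C2 → ℂ} {q₀ : C2} (hf : AnalyticAt ℂ f q₀)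
    (hne : ¬ ∀ᶠ q in 𝓝 q₀, f q = 0) :
    ∃ v : C2, v ≠ 0 ∧ ¬ ∀ᶠ t in 𝓝 (0 : ℂ), f (q₀ + t • v) = 0 := by
  obtain ⟨r, hr, hfr⟩ := Metric.eventually_nhds_iff_ball.1 hf.eventually_analyticAt
  obtain ⟨q₁, hq₁, hfq⟩ : ∃ q ∈ ball q₀ r, f q ≠ 0 := by
    by_contra! h
    exact hne (Filter.eventually_of_mem (ball_mem_nhds q₀ hr) h)
  by_cases hv : q₁ - q₀ = 0
  · have : q₁ = q₀ := sub_eq_zero.1 hv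
    refine ⟨(0, 1), by simp, fun h => hfq ?_⟩
    rw [this]
    simpa using h.self_of_nhds
  · refine ⟨q₁ - q₀, hv, fun h => hfq ?_⟩
    have hn : 0 < ‖q₁ - q₀‖ := norm_pos_iff.2 hv
    have hline : ∀ t ∈ ball (0 : ℂ) (r / ‖q₁ - q₀‖), q₀ + t • (q₁ - q₀) ∈ ball q₀ r := by
      intro t ht
      rw [mem_ball_zero_iff, lt_div_iff₀ hn] at ht
      rwa [mem_ball_iff_norm, add_sub_cancel_left, norm_smul]
    have ha : AnalyticOnNhd ℂ (fun t : ℂ => f (q₀ + t • (q₁ - q₀)))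
        (ball 0 (r / ‖q₁ - q₀‖)) := fun t ht =>
      AnalyticAt.comp (g := f) (f := fun t : ℂ => q₀ + t • (q₁ - q₀)) (hfr _ (hline t ht))
        (analyticAt_const.add (analyticAt_id.smul analyticAt_const))
    have h1 := ha.eqOn_zero_of_preconnected_of_eventuallyEq_zero
      (convex_ball _ _).isPreconnected (mem_ball_self (div_pos hr hn)) h
    have h2 : (1 : ℂ) ∈ ball (0 : ℂ) (r / ‖q₁ - q₀‖) := by
      rw [mem_ball_zero_iff, norm_one, lt_div_iff₀ hn, one_mul]
      exact mem_ball_iff_norm.1 hq₁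
    have h3 := h1 h2
    simpa using h3

section Surface

variable {S : Type*} [TopologicalSpace S] [ChartedSpace C2 S] [IsManifold 𝓘(ℂ, C2) ω S]
variable {A : MeromorphicAffineStructure S}

/-- A curve which is a graph near a point is smooth there. -/
lemma mem_regularPart_of_graph {D : Set S} {e : OpenPartialHomeomorph S C2} (he : IsCoord e) {x : S}
    (hx : x ∈ e.source) {f : C2 → ℂ} (hf : ∀ y ∈ e.source, y ∈ D ↔ f (e y) = 0) (hxD : x ∈ D)
    {g : ℂ → ℂ} (hg : AnalyticAt ℂ g (e x).1)
    (hfg : ∀ᶠ q in 𝓝 (e x), f q = 0 ↔ q.2 = g q.1) : x ∈ regularPart D := by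
  set Ψ : C2 → C2 := fun q => (q.1 - (e x).1, q.2 - g q.1) with hΨ
  have hg' : AnalyticAt ℂ (fun q : C2 => g q.1) (e x) :=
    AnalyticAt.comp (g := g) (f := Prod.fst) hg analyticAt_fst
  have hΨa : AnalyticAt ℂ Ψ (e x) :=
    (analyticAt_fst.fun_sub analyticAt_const).prod (analyticAt_snd.fun_sub hg')
  have hd := hΨa.differentiableAt.hasFDerivAt
  have hd' : HasFDerivAt Ψ _ (e x) := ((hasFDerivAt_fst (𝕜 := ℂ) (p := e x)).sub_const (e x).1).prodMk
    ((hasFDerivAt_snd (𝕜 := ℂ) (p := e x)).fun_sub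
      (hg.differentiableAt.hasDerivAt.comp_hasFDerivAt (e x) (hasFDerivAt_fst (𝕜 := ℂ) (p := e x))))
  obtain ⟨T, hT⟩ := exists_equiv_of_injective (T := fderiv ℂ Ψ (e x)) fun u hu => by
    rw [hd'.fderiv] at hu
    have h1 := congrArg Prod.fst hu
    have h2 := congrArg Prod.snd hu
    simp at h1 h2
    rw [h1] at h2
    exact Prod.ext h1 (by simpa using h2)
  rw [← hT] at hd
  obtain ⟨e', he', hxe', hy⟩ := he.exists_trans hx hΨa hd hfg
  refine ⟨e', he', hxe', ?_, fun y hys => ?_⟩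
  · obtain ⟨-, h2, h3⟩ := hy x hxe'
    rw [h2, hΨ]
    exact Prod.ext (sub_self _) (sub_eq_zero.2 (h3.1 ((hf x hx).1 hxD)))
  · obtain ⟨h1, h2, h3⟩ := hy y hys
    rw [hf y h1, h3, h2, hΨ]
    exact sub_eq_zero.symm

/-- The singular points of the polar divisor are isolated. -/
theorem eventually_mem_regularPart (hlog : A.IsLogarithmic) {p : S} (hp : p ∈ A.polar) :
    ∀ᶠ x in 𝓝 p, x ≠ p → x ∈ A.polar → x ∈ regularPart A.polar := by
  obtain ⟨e, f, -, -, he, hpe, hf, -, -, hz, hred, -, -⟩ := hlog p hp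
  have hfa : AnalyticAt ℂ f (e p) :=
    analyticOnNhd_of_differentiableOn e.open_target hf _ (e.map_source hpe)
  have hf0 : f (e p) = 0 := (hz _ (e.map_source hpe)).1 (by rwa [e.left_inv hpe])
  -- Reducedness excludes f ≡ 0 near the point, since then df would vanish as well.
  have hne : ¬ ∀ᶠ q in 𝓝 (e p), f q = 0 := by
    intro h
    have h1 : ∀ᶠ q in 𝓝 (e p), fderiv ℂ f q = 0 := h.eventually_nhds.mono fun q hq => by
      have : f =ᶠ[𝓝 q] fun _ => 0 := hq
      rw [this.fderiv_eq, fderiv_const_apply]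
    obtain ⟨q, h2, h3⟩ := ((mem_closure_iff_frequently.1 (hred _ (e.map_source hpe) hf0)).and_eventually
      h1).exists
    exact h2.2.2 h3
  -- A linear change of coordinates turns a line on which f is not identically zero into the
  -- vertical axis, as `eventually_exists_graph` requires.
  obtain ⟨v, hv, hline⟩ := exists_line_ne_zero hfa hne
  obtain ⟨T, hT⟩ := exists_equiv_apply_eq hv
  have hTd : HasFDerivAt (fun q => T.symm (q - e p)) (T.symm : C2 →L[ℂ] C2) (e p) :=
    (T.symm : C2 →L[ℂ] C2).hasFDerivAt.comp (e p) ((hasFDerivAt_id (e p)).sub_const (e p))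
  have hTa : AnalyticAt ℂ (fun q => T.symm (q - e p)) (e p) :=
    ((T.symm : C2 →L[ℂ] C2).analyticAt _).comp (analyticAt_id.sub analyticAt_const)
  obtain ⟨e₁, he₁, hpe₁, hy⟩ := he.exists_trans hpe hTa hTd (P := fun _ => True) (by simp)
  set f₁ : C2 → ℂ := fun z => f (e p + T z) with hf₁
  have he₁p : e₁ p = 0 := by rw [(hy p hpe₁).2.1]; simp
  have hdiv : ∀ y ∈ e₁.source, y ∈ A.polar ↔ f₁ (e₁ y) = 0 := by
    intro y hys
    obtain ⟨h1, h2, -⟩ := hy y hys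
    rw [hf₁, h2]
    simp only [ContinuousLinearEquiv.apply_symm_apply, add_sub_cancel]
    rw [← hz _ (e.map_source h1), e.left_inv h1]
  have hf₁a : AnalyticAt ℂ f₁ 0 := by
    refine AnalyticAt.comp (g := f) (f := fun z => e p + T z) (by simpa using hfa) ?_
    exact analyticAt_const.add ((T : C2 →L[ℂ] C2).analyticAt 0)
  have hf₁ne : ¬ ∀ᶠ y in 𝓝 (0 : ℂ), f₁ (0, y) = 0 := by
    intro h
    refine hline (h.mono fun y hy => ?_)
    rw [← hT, ← map_smul]
    simpa [hf₁] using hy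
  have hcont : Filter.Tendsto e₁ (𝓝 p) (𝓝 0) := by
    rw [← he₁p]; exact e₁.continuousAt hpe₁
  filter_upwards [hcont.eventually (eventually_exists_graph hf₁a hf₁ne),
    e₁.open_source.mem_nhds hpe₁] with x hx hxs hxp hxpol
  obtain ⟨g, hg, hfg⟩ := hx (fun h => hxp (e₁.injOn hxs hpe₁ (h.trans he₁p.symm)))
    ((hdiv x hxs).1 hxpol)
  exact mem_regularPart_of_graph he₁ hxs hdiv hxpol hg hfg

lemma regularPart_subset (D : Set S) : regularPart D ⊆ D := fun p ⟨_, he⟩ =>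
  (he.divisor p he.mem).2 (by rw [he.centred]; rfl)

lemma IsBranch.subset {D D₀ : Set S} (h : IsBranch D D₀) (hD : IsClosed D) : D₀ ⊆ D := by
  obtain ⟨p, -, rfl⟩ := h
  exact hD.closure_subset_iff.2 ((connectedComponentIn_subset _ _).trans (regularPart_subset D))

end Surface

end LogAffine

end

/-! ### Conclusion. -/

open LogAffine in
theorem theorem3 {S : Type*} [TopologicalSpace S] [T2Space S] [ChartedSpace C2 S]
    [IsManifold 𝓘(ℂ, C2) ω S]
    (A : MeromorphicAffineStructure S) (hlog : A.IsLogarithmic)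
    (D₀ : Set S) (hD₀ : IsBranch A.polar D₀) (hpar : A.HasParabolicLocalMonodromy D₀) :
    ∃ E : Set S, E ⊆ D₀ ∧ IsClosed E ∧ IsDiscrete E ∧
      ∀ p ∈ D₀, p ∉ E → ∃ e : OpenPartialHomeomorph S C2, IsAdapted A.polar e p ∧
        ((∃ n : ℕ, A.IsGivenBy e (modelOne n)) ∨
          ∃ n : ℕ, 0 < n ∧ ∃ c : ℂ, (c = 0 ∨ c = 1) ∧ A.IsGivenBy e (modelTwo n c)) := by
  have hsub := hD₀.subset A.isClosed_polar
  have hcl : IsClosed D₀ := by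
    obtain ⟨p, -, rfl⟩ := hD₀
    exact isClosed_closure
  have hisol : ∀ x ∈ D₀, ∀ᶠ y in 𝓝 x, y ≠ x → y ∉ D₀ \ regularPart A.polar := fun x hx =>
    (eventually_mem_regularPart hlog (hsub hx)).mono fun y hy hyx hyE =>
      hyE.2 (hy hyx (hsub hyE.1))
  -- E is the set of singular points of D on D₀. Near any point of D₀ there is no other point of E,
  -- which makes E both closed and discrete.
  refine ⟨D₀ \ regularPart A.polar, Set.sdiff_subset, ?_, ⟨?_⟩, fun p hp hpE => ?_⟩
  · refine isClosed_of_closure_subset fun x hx => ?_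
    have hxD : x ∈ D₀ := hcl.closure_subset_iff.2 Set.sdiff_subset hx
    obtain ⟨y, hy, hyx⟩ := ((mem_closure_iff_frequently.1 hx).and_eventually (hisol x hxD)).exists
    by_cases h : y = x
    · rwa [← h]
    · exact absurd hy (hyx h)
  · rw [discreteTopology_subtype_iff]
    intro x hx
    rw [Filter.inf_principal_eq_bot]
    exact eventually_nhdsWithin_iff.2 (hisol x hx.1)
  · exact (isParabolicPoint_of_mem_branch hlog hD₀ hpar hp
      (by_contra fun h => hpE ⟨hp, h⟩)).exists_model
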